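/- Let $\mathbf{Top}$ be a convenient category of spaces: a full replete subcategory of the category of topological spaces that is complete, cocomplete and cartesian closed and contains the unit interval $I=[0,1]$. Let $\mathcal C$ be a topologically bicomplete category, i.e. a (locally small) complete and cocomplete category that is enriched, tensored and cotensored over $\mathbf{Top}$, and let $\mathcal C^{\mathbf 2}$ be its category of arrows. *Cole's step-one factorization.* For $f\colon X\to Y$ in $\mathcal C$ let $Nf$ be the pullback of $f$ along the evaluation $p_0\colon Y^I\to Y$ at $0$, with projections $\phi_f\colon Nf\to X$ and $\chi_f\colon Nf\to Y^I$; let $Ef$ be the pushout of $\phi_f$ along the inclusion $i_0\colon Nf\to Nf\otimes I$ at $0$; let $Lf\colon X\to Ef$ be the coprojection, and let $Rf\colon Ef\to Y$ be induced by $f$ and the adjunct $Nf\otimes I\to Y$ of $\chi_f$. This is a functorial factorization $f=Rf\circ Lf$, and $R$ is an endofunctor of $\mathcal C^{\mathbf 2}$ over $\mathrm{cod}$, pointed by the squares $(Lf,1_Y)\colon f\to Rf$. *Smallness.* An orthogonal factorization system $(\mathcal E,\mathcal M)$ on $\mathcal C$ is a weak factorization system whose liftings are unique; it is well-copowered if every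 object has only a set of $\mathcal E$-quotients up to isomorphism. For a regular cardinal $\alpha$, an $\alpha$-indexed $\mathcal M$-colimit over an object $Y$ is a colimit cocone $(f_\beta\to f_\alpha)_{\beta<\alpha}$ of arrows $f_\beta\colon X_\beta\to Y$, indexed by the ordinals $\beta<\alpha$, whose transition maps and legs are the identity on $Y$ and whose legs $X_\beta\to X_\alpha$ all lie in $\mathcal M$. $\mathcal C$ satisfies the *monomorphism hypothesis* if there are a well-copowered orthogonal factorization system $(\mathcal E,\mathcal M)$ on $\mathcal C$ and a regular cardinal $\alpha$ such that $N\colon\mathcal C^{\mathbf 2}\to\mathcal C$ sends all $\alpha$-indexed $\mathcal M$-colimits over objects $Y$ to colimits. A pointed endofunctor $T$ of $\mathcal C^{\mathbf 2}$ over $\mathrm{cod}$ satisfies *Kelly's smallness condition* $(\dagger)$ if there are a well-copowered orthogonal factorization system $(\mathcal E,\mathcal M)$ on $\mathcal C$ and a regular cardinal $\alpha$ such that $T$ sends all $\alpha$-indexed $\mathcal M$-colimits over objects $Y$ to colimits in $\mathcal C^{\mathbf 2}$. *The free monad sequence* of a pointed endofunctor $(T,\tau)$ of a category $\mathcal D$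 is the transfinite sequence of endofunctors $X_0\to X_1\to\cdots\to X_\beta\to\cdots$, indexed by all (small) ordinals, with transformations $\sigma_\beta\colon TX_\beta\to X_{\beta+1}$, such that $X_0\cong\mathrm{id}$; $X_\beta=\operatorname{colim}_{\gamma<\beta}X_\gamma$ for limit $\beta$; $X_\beta\to X_{\beta+1}$ is $\sigma_\beta\circ\tau X_\beta$; and $\sigma_\beta$ is universal among maps out of $TX_\beta$ that, for every $\gamma<\beta$, coequalize $TX_\gamma\to TX_\beta$ and $TX_\gamma\xrightarrow{\sigma_\gamma}X_{\gamma+1}\to X_\beta\xrightarrow{\tau X_\beta}TX_\beta$ (all colimits and universal properties being objectwise). It converges if at every object of $\mathcal D$ it is eventually constant up to isomorphism. *Algebraic weak factorization systems.* An algebraic weak factorization system on a functorial factorization $(L,R)$ with middle-object functor $E$ consists of a comonad structure on $L$ with counit $\vec\epsilon$ and a monad structure on $R$ with unit $\vec\eta$, where $\vec\epsilon_f=(1,Rf)$ and $\vec\eta_f=(Lf,1)$ are the canonical squares, such that, with $\delta_f\colon Ef\to ELf$ and $\mu_f\colon ERf\to Ef$ the nontrivial components of the comultiplication and the multiplication,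 $\delta_f\circ\mu_f=\mu_{Lf}\circ E(\delta_f,\mu_f)\circ\delta_{Rf}$ for all $f$. **Theorem.** If $\mathcal C$ is a topologically bicomplete category that satisfies the monomorphism hypothesis, then Cole's pointed endofunctor $R$ of $\mathcal C^{\mathbf 2}$ satisfies $(\dagger)$. The free monad sequence of $R$ exists and converges, and its colimit $F$, pointed by $\mathrm{id}\cong X_0\to F$, is (up to isomorphism of pointed endofunctors) the right functor of a functorial factorization $(C,F)$ on $\mathcal C$. Every functorial factorization $(C,F)$ obtained in this way underlies an algebraic weak factorization system $(\mathbb C,\mathbb F)$ whose monad $\mathbb F$ is the free monad on $R$: restriction along the canonical map $R\cong X_1\to F$ is an isomorphism, over $\mathcal C^{\mathbf 2}$, from the category of $\mathbb F$-algebras to the category of algebras of the pointed endofunctor $R$. -/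

import Mathlib

open CategoryTheory CategoryTheory.Limits MonoidalCategory

universe v' u' v u

/-! ### Factorization systems and sequential `M`-colimits -/

section FactorizationSystems

variable {C : Type u} [Category.{v} C]

/-- An orthogonal factorization system: a weak factorization system whose liftings are unique
(uniqueness of factorizations up to a unique isomorphism is a consequence). -/
structure IsOrthogonalFactorizationSystem (E M : MorphismProperty C) : Prop where
  isWeakFactorizationSystem : E.IsWeakFactorizationSystem M
  lift_unique : ∀ {A B X Y : C} (e : A ⟶ B) (m : X ⟶ Y), E e → M m →
    ∀ l l' : B ⟶ X, e ≫ l = e ≫ l' → l ≫ m = l' ≫ m → l = l'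

/-- Every object has only a set of `E`-quotients, up to isomorphism under the object. -/
def IsWellCopowered (E : MorphismProperty C) : Prop :=
  ∀ X : C, ∃ (ι : Type v) (Q : ι → C) (q : ∀ i, X ⟶ Q i),
    ∀ {Z : C} (e : X ⟶ Z), E e → ∃ (i : ι) (φ : Q i ≅ Z), q i ≫ φ.hom = e

/-- The inclusion of the slice over `Y` into the arrow category, which sends a morphism over `Y`
to the square with the identity of `Y` as its codomain component. -/
@[simps]
def overToArrow (Y : C) : Over Y ⥤ Arrow C where
  obj X := Arrow.mk X.hom
  map φ := Arrow.homMk φ.left (𝟙 Y)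

/-- `F` sends to colimit cocones the colimit cocones of `κ`-indexed sequences of the form
`X₀ ⟶ X₁ ⟶ ⋯ ⟶ X_β ⟶ ⋯ ⟶ X_κ = colim X_β` of arrows `f_β : X_β ⟶ Y` with a fixed codomain `Y`,
all of whose legs `X_β ⟶ X_κ` belong to `M`. -/
def PreservesSequentialColimitsOverCod (M : MorphismProperty C) (κ : Cardinal.{v})
    {D : Type u'} [Category.{v'} D] (F : Arrow C ⥤ D) : Prop :=
  ∀ (Y : C) (X : κ.ord.ToType ⥤ Over Y) (c : Cocone X), Nonempty (IsColimit c) →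
    (∀ β, M (c.ι.app β).left) →
      Nonempty (IsColimit (F.mapCocone ((overToArrow Y).mapCocone c)))

/-- Kelly's smallness condition (†) for a pointed endofunctor `T` of the arrow category over `cod`:
there are a well-copowered orthogonal factorization system `(E, M)` on `C` and a regular cardinal
`κ` such that `T` sends `κ`-indexed `M`-colimits of arrows with a fixed codomain to colimits. -/
def KellySmallness (T : Arrow C ⥤ Arrow C) : Prop :=
  ∃ E M : MorphismProperty C, IsOrthogonalFactorizationSystem E M ∧ IsWellCopowered E ∧
    ∃ κ : Cardinal.{v}, κ.IsRegular ∧ PreservesSequentialColimitsOverCod M κ T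

end FactorizationSystems

/-! ### Functorial factorizations and algebraic weak factorization systems -/

section AlgebraicWeakFactorizationSystems

variable (C : Type u) [Category.{v} C]

/-- A functorial factorization `f = p_f ∘ i_f` of all the arrows of `C`. -/
abbrev FunctorialFactorization :=
  MorphismProperty.FunctorialFactorizationData (⊤ : MorphismProperty C) (⊤ : MorphismProperty C)

namespace FunctorialFactorization

variable {C} (G : FunctorialFactorization C)

lemma fac_app (f : Arrow C) : G.i.app f ≫ G.p.app f = f.hom :=
  congr_app G.fac f

/-- The left functor `L`. -/
@[simps]
def left : Arrow C ⥤ Arrow C where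
  obj f := Arrow.mk (G.i.app f)
  map φ := Arrow.homMk φ.left (G.Z.map φ) (G.i.naturality φ)

/-- The right functor `R`. -/
@[simps]
def right : Arrow C ⥤ Arrow C where
  obj f := Arrow.mk (G.p.app f)
  map φ := Arrow.homMk (G.Z.map φ) φ.right (G.p.naturality φ)

/-- The canonical copoint `ε : L ⟶ 𝟭`. -/
@[simps]
def counit : G.left ⟶ 𝟭 (Arrow C) where
  app f := Arrow.homMk (𝟙 _) (G.p.app f) ((Category.id_comp _).trans (G.fac_app f).symm)
  naturality _ _ φ := by
    ext
    · exact (Category.comp_id _).trans (Category.id_comp _).symm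
    · exact G.p.naturality φ

/-- The canonical point `η : 𝟭 ⟶ R`. -/
@[simps]
def unit : 𝟭 (Arrow C) ⟶ G.right where
  app f := Arrow.homMk (G.i.app f) (𝟙 _) ((G.fac_app f).trans (Category.comp_id _).symm)
  naturality _ _ φ := by
    ext
    · exact G.i.naturality φ
    · exact (Category.comp_id _).trans (Category.id_comp _).symm

/-- A comonad structure on `(L, ε)` together with a monad structure on `(R, η)`. -/
structure ComonadMonadStructure where
  /-- the comultiplication of the comonad -/
  δ : G.left ⟶ G.left ⋙ G.left
  /-- the multiplication of the monad -/
  μ : G.right ⋙ G.right ⟶ G.right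
  coassoc : ∀ f, δ.app f ≫ G.left.map (δ.app f) = δ.app f ≫ δ.app (G.left.obj f)
  left_counit : ∀ f, δ.app f ≫ G.counit.app (G.left.obj f) = 𝟙 _
  right_counit : ∀ f, δ.app f ≫ G.left.map (G.counit.app f) = 𝟙 _
  assoc : ∀ f, G.right.map (μ.app f) ≫ μ.app f = μ.app (G.right.obj f) ≫ μ.app f
  left_unit : ∀ f, G.unit.app (G.right.obj f) ≫ μ.app f = 𝟙 _
  right_unit : ∀ f, G.right.map (G.unit.app f) ≫ μ.app f = 𝟙 _

namespace ComonadMonadStructure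

variable {G} (A : G.ComonadMonadStructure)

/-- The comonad of the structure. -/
@[simps!]
def comonad : Comonad (Arrow C) where
  toFunctor := G.left
  ε := G.counit
  δ := A.δ
  coassoc := A.coassoc
  left_counit := A.left_counit
  right_counit := A.right_counit

/-- The monad of the structure. -/
@[simps!]
def monad : Monad (Arrow C) where
  toFunctor := G.right
  η := G.unit
  μ := A.μ
  assoc := A.assoc
  left_unit := A.left_unit
  right_unit := A.right_unit

/-- The nontrivial component `δ_f : E f ⟶ E (L f)` of the comultiplication. -/
def comul (f : Arrow C) : G.Z.obj f ⟶ G.Z.obj (G.left.obj f) := (A.δ.app f).right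

/-- The nontrivial component `μ_f : E (R f) ⟶ E f` of the multiplication. -/
def mul (f : Arrow C) : G.Z.obj (G.right.obj f) ⟶ G.Z.obj f := (A.μ.app f).left

lemma comul_p (f : Arrow C) : A.comul f ≫ G.p.app (G.left.obj f) = 𝟙 _ :=
  congr_arg CommaMorphism.right (A.left_counit f)

lemma i_mul (f : Arrow C) : G.i.app (G.right.obj f) ≫ A.mul f = 𝟙 _ :=
  congr_arg CommaMorphism.left (A.left_unit f)

/-- The component `Δ_f : L (R f) ⟶ R (L f)`, the square with sides `δ_f` and `μ_f`. -/
def distrib (f : Arrow C) : G.left.obj (G.right.obj f) ⟶ G.right.obj (G.left.obj f) :=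
  Arrow.homMk (A.comul f) (A.mul f) ((A.comul_p f).trans (A.i_mul f).symm)

end ComonadMonadStructure

/-- An algebraic weak factorization system with underlying functorial factorization `G`: a comonad
structure on `(L, ε)` and a monad structure on `(R, η)` such that `Δ : L R ⟶ R L` is a distributive
law, which amounts to `δ ∘ μ = μ_L ∘ E (δ, μ) ∘ δ_R`. -/
structure AWFS extends G.ComonadMonadStructure where
  distributive : ∀ f : Arrow C,
    toComonadMonadStructure.mul f ≫ toComonadMonadStructure.comul f =
      toComonadMonadStructure.comul (G.right.obj f) ≫
        G.Z.map (toComonadMonadStructure.distrib f) ≫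
          toComonadMonadStructure.mul (G.left.obj f)

end FunctorialFactorization

end AlgebraicWeakFactorizationSystems

/-! ### The free monad sequence of a pointed endofunctor -/

section FreeMonad

variable {D : Type u} [Category.{v} D]

/-- The category of algebras of a pointed endofunctor `(T, τ)`. -/
abbrev PointedAlgebra (T : D ⥤ D) (τ : 𝟭 D ⟶ T) :=
  ObjectProperty.FullSubcategory
    (fun A : Endofunctor.Algebra T => τ.app A.a ≫ A.str = 𝟙 A.a)

/-- The functor over `D` from the algebras of a monad `F` to the algebras of a pointed endofunctor
`(T, τ)` that is given by restriction along a morphism `φ` of pointed endofunctors. -/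
@[simps]
def restrictAlgebra {T : D ⥤ D} {τ : 𝟭 D ⟶ T} (F : Monad D) (φ : T ⟶ F.toFunctor)
    (hφ : τ ≫ φ = F.η) : F.Algebra ⥤ PointedAlgebra T τ where
  obj A := ⟨⟨A.A, φ.app A.A ≫ A.a⟩, by
    have h := congr_app hφ A.A
    rw [NatTrans.comp_app] at h
    rw [← Category.assoc, h, A.unit]⟩
  map g := ObjectProperty.homMk ⟨g.f, by
    change T.map g.f ≫ φ.app _ ≫ _ = (φ.app _ ≫ _) ≫ g.f
    rw [← Category.assoc, φ.naturality, Category.assoc, g.h, Category.assoc]⟩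

/-- The monad `F` is the (algebraically) free monad on the pointed endofunctor `(T, τ)`, by means
of the morphism `φ : T ⟶ F` of pointed endofunctors: restriction along `φ` is an isomorphism, over
`D`, from the category of `F`-algebras to the category of `T`-algebras. -/
def IsFreeMonad {T : D ⥤ D} (τ : 𝟭 D ⟶ T) (F : Monad D) (φ : T ⟶ F.toFunctor) : Prop :=
  ∃ hφ : τ ≫ φ = F.η, (restrictAlgebra F φ hφ).Full ∧ (restrictAlgebra F φ hφ).Faithful ∧
    Function.Bijective (restrictAlgebra F φ hφ).obj

/-- The free monad sequence of a pointed endofunctor `(T, τ)`: a transfinite sequence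
`X₀ ⟶ X₁ ⟶ ⋯ ⟶ X_β ⟶ ⋯` of endofunctors with transformations `σ_β : T X_β ⟶ X_{β+1}`, where
`X₀ = 𝟭` and `X_β = colim_{γ < β} X_γ` for limit `β`, and where `σ_β` is the universal
transformation out of `T X_β` that, for all `γ < β`, identifies the two transformations
`T X_γ ⟶ T X_β` and `T X_γ ⟶ X_{γ+1} ⟶ X_β ⟶ T X_β`. Thus `X₁ = T`, the object `X_{β+2}` is the
coequalizer of a pair `T X_β ⇉ T X_{β+1}`, and `X_{β+1}` is the coequalizer of a pair
`colim_{γ < β} T X_γ ⇉ T X_β` for limit `β`. -/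
structure FreeMonadSequence (T : D ⥤ D) (τ : 𝟭 D ⟶ T) where
  /-- the sequence of endofunctors -/
  X : Ordinal.{v} ⥤ (D ⥤ D)
  /-- the sequence starts at the identity -/
  zero : X.obj 0 ≅ 𝟭 D
  /-- the structure maps -/
  σ : ∀ β : Ordinal.{v}, X.obj β ⋙ T ⟶ X.obj (Order.succ β)
  unit_σ : ∀ (β : Ordinal.{v}) (A : D), τ.app ((X.obj β).obj A) ≫ (σ β).app A =
    (X.map (homOfLE (Order.le_succ β))).app A
  σ_condition : ∀ (γ β : Ordinal.{v}) (h : γ < β) (A : D),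
    T.map ((X.map (homOfLE h.le)).app A) ≫ (σ β).app A =
      (σ γ).app A ≫ (X.map (homOfLE (Order.succ_le_of_lt h))).app A ≫
        τ.app ((X.obj β).obj A) ≫ (σ β).app A
  σ_universal : ∀ (β : Ordinal.{v}) (A Z : D) (g : T.obj ((X.obj β).obj A) ⟶ Z),
    (∀ (γ : Ordinal.{v}) (h : γ < β),
      T.map ((X.map (homOfLE h.le)).app A) ≫ g =
        (σ γ).app A ≫ (X.map (homOfLE (Order.succ_le_of_lt h))).app A ≫
          τ.app ((X.obj β).obj A) ≫ g) →
    ∃! k : (X.obj (Order.succ β)).obj A ⟶ Z, (σ β).app A ≫ k = g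
  continuous : ∀ A : D, (X ⋙ (evaluation D D).obj A).IsWellOrderContinuous

namespace FreeMonadSequence

variable {T : D ⥤ D} {τ : 𝟭 D ⟶ T} (S : FreeMonadSequence T τ)

/-- The sequence converges: at every object it is eventually constant. -/
def Converges : Prop :=
  ∀ A : D, ∃ β : Ordinal.{v}, ∀ (γ : Ordinal.{v}) (h : β ≤ γ),
    IsIso ((S.X.map (homOfLE h)).app A)

/-- An endofunctor `F` pointed by `η` is the value of the sequence: it is the (objectwise) colimit
of the whole sequence, and `η` is the leg at `0`. -/
structure Value (F : D ⥤ D) (η : 𝟭 D ⟶ F) where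
  /-- the legs `X_β ⟶ F` of the colimit cocone -/
  ι : S.X ⟶ (Functor.const Ordinal.{v}).obj F
  isColimit : ∀ A : D, Nonempty (IsColimit
    (((evaluation D D).obj A).mapCocone (Cocone.mk F ι)))
  unit : S.zero.inv ≫ ι.app 0 = η

variable {S} in
/-- The canonical morphism `T ≅ X₁ ⟶ F` into the value of the sequence. -/
def Value.fromGenerator {F : D ⥤ D} {η : 𝟭 D ⟶ F} (c : S.Value F η) : T ⟶ F :=
  T.leftUnitor.inv ≫ Functor.whiskerRight S.zero.inv T ≫ S.σ 0 ≫ c.ι.app (Order.succ 0)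

end FreeMonadSequence

end FreeMonad

/-! ### Tensors and cotensors -/

section Tensors

variable (V : Type u') [Category.{v'} V] [MonoidalCategory V]
  {C : Type u} [Category.{v} C] [EnrichedOrdinaryCategory V C]

/-- A tensor `K ⊗ X` of `X : C` by `K : V`, with its universal map `K ⟶ Hom (X, K ⊗ X)`. By the
Yoneda lemma the bijections express the enriched natural isomorphism
`Hom (K ⊗ X, Y) ≅ Hom (X, Y) ^ K` in `V`. -/
structure TensorObj (K : V) (X : C) where
  /-- the underlying object of the tensor -/
  pt : C
  /-- the universal map -/
  coev : K ⟶ (X ⟶[V] pt)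
  bijective : ∀ (A : V) (Y : C), Function.Bijective
    (fun h : A ⟶ (pt ⟶[V] Y) => (coev ⊗ₘ h) ≫ eComp V X pt Y)

/-- A cotensor `Y ^ K` of `Y : C` by `K : V`, with its universal map `K ⟶ Hom (Y ^ K, Y)`. By the
Yoneda lemma the bijections express the enriched natural isomorphism
`Hom (X, Y ^ K) ≅ Hom (X, Y) ^ K` in `V`. -/
structure CotensorObj (K : V) (Y : C) where
  /-- the underlying object of the cotensor -/
  pt : C
  /-- the universal map -/
  ev : K ⟶ (pt ⟶[V] Y)
  bijective : ∀ (A : V) (X : C), Function.Bijective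
    (fun h : A ⟶ (X ⟶[V] pt) => (h ⊗ₘ ev) ≫ eComp V X pt Y)

variable (C) in
/-- `C` is tensored over `V`. -/
class Tensored where
  /-- the chosen tensors -/
  tensor : ∀ (K : V) (X : C), TensorObj V K X

variable (C) in
/-- `C` is cotensored over `V`. -/
class Cotensored where
  /-- the chosen cotensors -/
  cotensor : ∀ (K : V) (Y : C), CotensorObj V K Y

variable {V} in
/-- Morphisms out of a tensor. -/
noncomputable def TensorObj.homEquiv {K : V} {X : C} (t : TensorObj V K X) (Y : C) :
    (t.pt ⟶ Y) ≃ (K ⟶ (X ⟶[V] Y)) :=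
  Equiv.ofBijective (fun g => t.coev ≫ eHomWhiskerLeft V X g) (by
    have h : (fun g : t.pt ⟶ Y => t.coev ≫ eHomWhiskerLeft V X g) =
        (fun k : K ⊗ 𝟙_ V ⟶ (X ⟶[V] Y) => (ρ_ K).inv ≫ k) ∘
          (fun k => (t.coev ⊗ₘ k) ≫ eComp V X t.pt Y) ∘ eHomEquiv V := by
      ext g
      simp [eHomWhiskerLeft, MonoidalCategory.tensorHom_def]
    rw [h]
    refine Function.Bijective.comp ?_ ((t.bijective _ _).comp (eHomEquiv V).bijective)
    exact ((ρ_ K).symm.homFromEquiv).symm.bijective)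

variable {V} in
/-- Morphisms into a cotensor. -/
noncomputable def CotensorObj.homEquiv {K : V} {Y : C} (t : CotensorObj V K Y) (X : C) :
    (X ⟶ t.pt) ≃ (K ⟶ (X ⟶[V] Y)) :=
  Equiv.ofBijective (fun g => t.ev ≫ eHomWhiskerRight V g Y) (by
    have h : (fun g : X ⟶ t.pt => t.ev ≫ eHomWhiskerRight V g Y) =
        (fun k : 𝟙_ V ⊗ K ⟶ (X ⟶[V] Y) => (λ_ K).inv ≫ k) ∘
          (fun k => (k ⊗ₘ t.ev) ≫ eComp V X t.pt Y) ∘ eHomEquiv V := by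
      ext g
      simp [eHomWhiskerRight, MonoidalCategory.tensorHom_def']
    rw [h]
    refine Function.Bijective.comp ?_ ((t.bijective _ _).comp (eHomEquiv V).bijective)
    exact ((λ_ K).symm.homFromEquiv).symm.bijective)

variable {V} in
lemma TensorObj.homEquiv_apply {K : V} {X : C} (t : TensorObj V K X) {Y : C} (g : t.pt ⟶ Y) :
    t.homEquiv Y g = t.coev ≫ eHomWhiskerLeft V X g := rfl

variable {V} in
lemma CotensorObj.homEquiv_apply {K : V} {Y : C} (t : CotensorObj V K Y) {X : C}
    (g : X ⟶ t.pt) : t.homEquiv X g = t.ev ≫ eHomWhiskerRight V g Y := rfl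

lemma eHomEquiv_symm_comp {X Y Z : C} (a : 𝟙_ V ⟶ (X ⟶[V] Y)) (g : Y ⟶ Z) :
    (eHomEquiv V).symm a ≫ g = (eHomEquiv V).symm (a ≫ eHomWhiskerLeft V X g) := by
  apply (eHomEquiv V).injective
  rw [eHomEquiv_comp, Equiv.apply_symm_apply, Equiv.apply_symm_apply]
  simp [eHomWhiskerLeft, MonoidalCategory.tensorHom_def, unitors_inv_equal]

lemma comp_eHomEquiv_symm {X Y Z : C} (g : X ⟶ Y) (a : 𝟙_ V ⟶ (Y ⟶[V] Z)) :
    g ≫ (eHomEquiv V).symm a = (eHomEquiv V).symm (a ≫ eHomWhiskerRight V g Z) := by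
  apply (eHomEquiv V).injective
  rw [eHomEquiv_comp, Equiv.apply_symm_apply, Equiv.apply_symm_apply]
  simp [eHomWhiskerRight, MonoidalCategory.tensorHom_def']

variable {V}

section Tensor

variable [Tensored V C]

variable (C) in
/-- The functor `X ↦ X ⊗ K`. -/
noncomputable def tensorFunctor (K : V) : C ⥤ C where
  obj X := (Tensored.tensor K X).pt
  map {X X'} u := ((Tensored.tensor K X).homEquiv _).symm
    ((Tensored.tensor K X').coev ≫ eHomWhiskerRight V u _)
  map_id X := by
    rw [Equiv.symm_apply_eq, TensorObj.homEquiv_apply]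
    simp
  map_comp {X X' X''} u u' := by
    rw [Equiv.symm_apply_eq, TensorObj.homEquiv_apply, eHomWhiskerLeft_comp, ← Category.assoc,
      ← TensorObj.homEquiv_apply, Equiv.apply_symm_apply, Category.assoc,
      ← eHom_whisker_exchange, ← Category.assoc, ← TensorObj.homEquiv_apply,
      Equiv.apply_symm_apply, Category.assoc, eHomWhiskerRight_comp]

/-- The universal map `K ⟶ Hom (X, X ⊗ K)`. -/
noncomputable def tensorCoev (K : V) (X : C) : K ⟶ (X ⟶[V] (tensorFunctor C K).obj X) :=
  (Tensored.tensor K X).coev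

/-- The bijection between morphisms `X ⊗ K ⟶ Y` and morphisms `K ⟶ Hom (X, Y)`. -/
noncomputable def tensorHomEquiv (K : V) (X Y : C) :
    ((tensorFunctor C K).obj X ⟶ Y) ≃ (K ⟶ (X ⟶[V] Y)) :=
  (Tensored.tensor K X).homEquiv Y

lemma tensorHomEquiv_apply (K : V) {X Y : C} (g : (tensorFunctor C K).obj X ⟶ Y) :
    tensorHomEquiv K X Y g = tensorCoev K X ≫ eHomWhiskerLeft V X g := rfl

lemma tensorCoev_map (K : V) {X X' : C} (u : X ⟶ X') :
    tensorCoev K X ≫ eHomWhiskerLeft V X ((tensorFunctor C K).map u) =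
      tensorCoev K X' ≫ eHomWhiskerRight V u _ :=
  ((Tensored.tensor K X).homEquiv _).apply_symm_apply _

/-- The natural morphism `X ⟶ X ⊗ K` induced by a point `z` of `K`. -/
noncomputable def tensorPoint {K : V} (z : 𝟙_ V ⟶ K) (X : C) : X ⟶ (tensorFunctor C K).obj X :=
  (eHomEquiv V).symm (z ≫ tensorCoev K X)

lemma tensorPoint_naturality {K : V} (z : 𝟙_ V ⟶ K) {X X' : C} (u : X ⟶ X') :
    u ≫ tensorPoint z X' = tensorPoint z X ≫ (tensorFunctor C K).map u := by
  rw [tensorPoint, tensorPoint, comp_eHomEquiv_symm, eHomEquiv_symm_comp, Category.assoc,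
    Category.assoc, tensorCoev_map]

end Tensor

section Cotensor

variable [Cotensored V C]

variable (C) in
/-- The functor `Y ↦ Y ^ K`. -/
noncomputable def cotensorFunctor (K : V) : C ⥤ C where
  obj Y := (Cotensored.cotensor K Y).pt
  map {Y Y'} u := ((Cotensored.cotensor K Y').homEquiv _).symm
    ((Cotensored.cotensor K Y).ev ≫ eHomWhiskerLeft V _ u)
  map_id Y := by
    rw [Equiv.symm_apply_eq, CotensorObj.homEquiv_apply]
    simp
  map_comp {Y Y' Y''} u u' := by
    rw [Equiv.symm_apply_eq, CotensorObj.homEquiv_apply, eHomWhiskerRight_comp, ← Category.assoc,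
      ← CotensorObj.homEquiv_apply, Equiv.apply_symm_apply, Category.assoc,
      eHom_whisker_exchange, ← Category.assoc, ← CotensorObj.homEquiv_apply,
      Equiv.apply_symm_apply, Category.assoc, eHomWhiskerLeft_comp]

/-- The universal map `K ⟶ Hom (Y ^ K, Y)`. -/
noncomputable def cotensorEv (K : V) (Y : C) : K ⟶ ((cotensorFunctor C K).obj Y ⟶[V] Y) :=
  (Cotensored.cotensor K Y).ev

/-- The bijection between morphisms `X ⟶ Y ^ K` and morphisms `K ⟶ Hom (X, Y)`. -/
noncomputable def cotensorHomEquiv (K : V) (X Y : C) :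
    (X ⟶ (cotensorFunctor C K).obj Y) ≃ (K ⟶ (X ⟶[V] Y)) :=
  (Cotensored.cotensor K Y).homEquiv X

lemma cotensorHomEquiv_apply (K : V) {X Y : C} (g : X ⟶ (cotensorFunctor C K).obj Y) :
    cotensorHomEquiv K X Y g = cotensorEv K Y ≫ eHomWhiskerRight V g Y := rfl

lemma cotensorEv_map (K : V) {Y Y' : C} (u : Y ⟶ Y') :
    cotensorEv K Y' ≫ eHomWhiskerRight V ((cotensorFunctor C K).map u) Y' =
      cotensorEv K Y ≫ eHomWhiskerLeft V _ u :=
  ((Cotensored.cotensor K Y').homEquiv _).apply_symm_apply _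

/-- The natural morphism `Y ^ K ⟶ Y`, evaluation at a point `z` of `K`. -/
noncomputable def cotensorPoint {K : V} (z : 𝟙_ V ⟶ K) (Y : C) :
    (cotensorFunctor C K).obj Y ⟶ Y :=
  (eHomEquiv V).symm (z ≫ cotensorEv K Y)

lemma cotensorPoint_naturality {K : V} (z : 𝟙_ V ⟶ K) {Y Y' : C} (u : Y ⟶ Y') :
    cotensorPoint z Y ≫ u = (cotensorFunctor C K).map u ≫ cotensorPoint z Y' := by
  rw [cotensorPoint, cotensorPoint, eHomEquiv_symm_comp, comp_eHomEquiv_symm, Category.assoc,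
    Category.assoc, cotensorEv_map]

variable [Tensored V C]

/-- The bijection between morphisms `X ⟶ Y ^ K` and morphisms `X ⊗ K ⟶ Y`. -/
noncomputable def adjunct (K : V) (X Y : C) :
    (X ⟶ (cotensorFunctor C K).obj Y) ≃ ((tensorFunctor C K).obj X ⟶ Y) :=
  (cotensorHomEquiv K X Y).trans (tensorHomEquiv K X Y).symm

lemma coev_adjunct (K : V) {X Y : C} (g : X ⟶ (cotensorFunctor C K).obj Y) :
    tensorCoev K X ≫ eHomWhiskerLeft V X (adjunct K X Y g) =
      cotensorEv K Y ≫ eHomWhiskerRight V g Y := by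
  rw [← tensorHomEquiv_apply, adjunct, Equiv.trans_apply, Equiv.apply_symm_apply,
    cotensorHomEquiv_apply]

lemma adjunct_comp (K : V) {X Y Y' : C} (g : X ⟶ (cotensorFunctor C K).obj Y) (u : Y ⟶ Y') :
    adjunct K X Y' (g ≫ (cotensorFunctor C K).map u) = adjunct K X Y g ≫ u := by
  apply (tensorHomEquiv K X Y').injective
  rw [tensorHomEquiv_apply, tensorHomEquiv_apply, coev_adjunct, eHomWhiskerLeft_comp,
    ← Category.assoc, coev_adjunct, eHomWhiskerRight_comp, ← Category.assoc, cotensorEv_map,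
    Category.assoc, Category.assoc, eHom_whisker_exchange]

lemma comp_adjunct (K : V) {X X' Y : C} (u : X ⟶ X') (g : X' ⟶ (cotensorFunctor C K).obj Y) :
    adjunct K X Y (u ≫ g) = (tensorFunctor C K).map u ≫ adjunct K X' Y g := by
  apply (tensorHomEquiv K X Y).injective
  rw [tensorHomEquiv_apply, tensorHomEquiv_apply, coev_adjunct, eHomWhiskerLeft_comp,
    ← Category.assoc, tensorCoev_map, Category.assoc, ← eHom_whisker_exchange, ← Category.assoc,
    coev_adjunct, eHomWhiskerRight_comp, Category.assoc]

lemma tensorPoint_adjunct {K : V} (z : 𝟙_ V ⟶ K) {X Y : C}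
    (g : X ⟶ (cotensorFunctor C K).obj Y) :
    tensorPoint z X ≫ adjunct K X Y g = g ≫ cotensorPoint z Y := by
  rw [tensorPoint, cotensorPoint, eHomEquiv_symm_comp, comp_eHomEquiv_symm, Category.assoc,
    Category.assoc, coev_adjunct]

end Cotensor

end Tensors

/-! ### Cole's factorization -/

section Cole

variable {V : Type u'} [Category.{v'} V] [MonoidalCategory V]
  (C : Type u) [Category.{v} C] [EnrichedOrdinaryCategory V C] [Cotensored V C]
  [HasPullbacks C] {I : V} (z : 𝟙_ V ⟶ I)

/-- The mapping path object functor: `N f` is the pullback of `f : X ⟶ Y` along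
`p₀ : Y ^ I ⟶ Y`, the evaluation at the point `z` of `I`. -/
noncomputable def mappingPath : Arrow C ⥤ C where
  obj f := pullback f.hom (cotensorPoint z f.right)
  map {f g} α := pullback.map _ _ _ _ α.left ((cotensorFunctor C I).map α.right) α.right
    α.w.symm (cotensorPoint_naturality z α.right)
  map_id f := by
    apply pullback.hom_ext <;> simp [pullback.map]
  map_comp α β := by
    apply pullback.hom_ext
    · refine (pullback.lift_fst _ _ _).trans (Eq.symm ((Category.assoc _ _ _).trans
        ((congr_arg _ (pullback.lift_fst _ _ _)).trans ((Category.assoc _ _ _).symm.trans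
          ((congr_arg (· ≫ β.left) (pullback.lift_fst _ _ _)).trans ?_)))))
      simp
    · refine (pullback.lift_snd _ _ _).trans (Eq.symm ((Category.assoc _ _ _).trans
        ((congr_arg _ (pullback.lift_snd _ _ _)).trans ((Category.assoc _ _ _).symm.trans
          ((congr_arg (· ≫ (cotensorFunctor C I).map β.right)
            (pullback.lift_snd _ _ _)).trans ?_)))))
      simp

variable {C}

/-- The projection `φ_f : N f ⟶ X`. -/
noncomputable def mappingPathFst (f : Arrow C) : (mappingPath C z).obj f ⟶ f.left :=
  pullback.fst _ _

/-- The projection `χ_f : N f ⟶ Y ^ I`. -/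
noncomputable def mappingPathSnd (f : Arrow C) :
    (mappingPath C z).obj f ⟶ (cotensorFunctor C I).obj f.right :=
  pullback.snd _ _

lemma mappingPathFst_naturality {f g : Arrow C} (α : f ⟶ g) :
    (mappingPath C z).map α ≫ mappingPathFst z g = mappingPathFst z f ≫ α.left :=
  pullback.lift_fst _ _ _

lemma mappingPathSnd_naturality {f g : Arrow C} (α : f ⟶ g) :
    (mappingPath C z).map α ≫ mappingPathSnd z g =
      mappingPathSnd z f ≫ (cotensorFunctor C I).map α.right :=
  pullback.lift_snd _ _ _

variable [Tensored V C]

/-- The adjunct `N f ⊗ I ⟶ Y` of `χ_f`. -/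
noncomputable def mappingPathEval (f : Arrow C) :
    (tensorFunctor C I).obj ((mappingPath C z).obj f) ⟶ f.right :=
  adjunct I _ _ (mappingPathSnd z f)

lemma mappingPathEval_naturality {f g : Arrow C} (α : f ⟶ g) :
    (tensorFunctor C I).map ((mappingPath C z).map α) ≫ mappingPathEval z g =
      mappingPathEval z f ≫ α.right := by
  rw [mappingPathEval, mappingPathEval, ← comp_adjunct, mappingPathSnd_naturality, adjunct_comp]

lemma mappingPath_condition (f : Arrow C) :
    mappingPathFst z f ≫ f.hom =
      tensorPoint z ((mappingPath C z).obj f) ≫ mappingPathEval z f := by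
  rw [mappingPathEval, tensorPoint_adjunct]
  exact pullback.condition

variable [HasPushouts C]

variable (C) in
/-- The functor `f ↦ E f`, where `E f` is the pushout of `φ_f : N f ⟶ X` along the inclusion
`i₀ : N f ⟶ N f ⊗ I` at the point `z` of `I`. -/
noncomputable def coleObj : Arrow C ⥤ C where
  obj f := pushout (mappingPathFst z f) (tensorPoint z ((mappingPath C z).obj f))
  map {f g} α := pushout.map _ _ _ _ α.left
    ((tensorFunctor C I).map ((mappingPath C z).map α)) ((mappingPath C z).map α)
    (mappingPathFst_naturality z α).symm (tensorPoint_naturality z ((mappingPath C z).map α)).symm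
  map_id f := by
    apply pushout.hom_ext <;> simp [pushout.map]
  map_comp α β := by
    apply pushout.hom_ext
    · refine (pushout.inl_desc _ _ _).trans (Eq.symm ((Category.assoc _ _ _).symm.trans
        ((congr_arg (· ≫ _) (pushout.inl_desc _ _ _)).trans ((Category.assoc _ _ _).trans
          ((congr_arg (α.left ≫ ·) (pushout.inl_desc _ _ _)).trans ?_)))))
      simp
    · refine (pushout.inr_desc _ _ _).trans (Eq.symm ((Category.assoc _ _ _).symm.trans
        ((congr_arg (· ≫ _) (pushout.inr_desc _ _ _)).trans ((Category.assoc _ _ _).trans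
          ((congr_arg ((tensorFunctor C I).map ((mappingPath C z).map α) ≫ ·)
            (pushout.inr_desc _ _ _)).trans ?_)))))
      simp

/-- The left factor `L f : X ⟶ E f`, a coprojection of the pushout. -/
noncomputable def coleInl (f : Arrow C) : f.left ⟶ (coleObj C z).obj f :=
  pushout.inl _ _

/-- The coprojection `ψ_f : N f ⊗ I ⟶ E f`. -/
noncomputable def coleInr (f : Arrow C) :
    (tensorFunctor C I).obj ((mappingPath C z).obj f) ⟶ (coleObj C z).obj f :=
  pushout.inr _ _

/-- The right factor `R f : E f ⟶ Y`, induced by `f` and by the adjunct `N f ⊗ I ⟶ Y`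
of `χ_f`. -/
noncomputable def coleDesc (f : Arrow C) : (coleObj C z).obj f ⟶ f.right :=
  pushout.desc f.hom (mappingPathEval z f) (mappingPath_condition z f)

lemma coleInl_desc (f : Arrow C) : coleInl z f ≫ coleDesc z f = f.hom :=
  pushout.inl_desc _ _ _

lemma coleInr_desc (f : Arrow C) : coleInr z f ≫ coleDesc z f = mappingPathEval z f :=
  pushout.inr_desc _ _ _

lemma coleInl_naturality {f g : Arrow C} (α : f ⟶ g) :
    α.left ≫ coleInl z g = coleInl z f ≫ (coleObj C z).map α :=
  (pushout.inl_desc _ _ _).symm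

lemma coleInr_naturality {f g : Arrow C} (α : f ⟶ g) :
    (tensorFunctor C I).map ((mappingPath C z).map α) ≫ coleInr z g =
      coleInr z f ≫ (coleObj C z).map α :=
  (pushout.inr_desc _ _ _).symm

lemma coleObj_hom_ext {f : Arrow C} {Z : C} {a b : (coleObj C z).obj f ⟶ Z}
    (h₁ : coleInl z f ≫ a = coleInl z f ≫ b) (h₂ : coleInr z f ≫ a = coleInr z f ≫ b) : a = b :=
  pushout.hom_ext h₁ h₂

lemma coleDesc_naturality {f g : Arrow C} (α : f ⟶ g) :
    (coleObj C z).map α ≫ coleDesc z g = coleDesc z f ≫ α.right := by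
  apply coleObj_hom_ext
  · rw [← Category.assoc, ← coleInl_naturality, Category.assoc, coleInl_desc, ← Category.assoc,
      coleInl_desc]
    exact α.w
  · rw [← Category.assoc, ← coleInr_naturality, Category.assoc, coleInr_desc, ← Category.assoc,
      coleInr_desc, mappingPathEval_naturality]

variable (C) in
/-- Cole's step-one functorial factorization `X ⟶ E f ⟶ Y` of `f : X ⟶ Y`. -/
noncomputable def coleFactorization : FunctorialFactorization C where
  Z := coleObj C z
  i :=
    { app f := coleInl z f
      naturality _ _ α := coleInl_naturality z α }
  p :=
    { app f := coleDesc z f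
      naturality _ _ α := coleDesc_naturality z α }
  fac := by
    ext f
    exact coleInl_desc z f
  hi _ := trivial
  hp _ := trivial

end Cole

/-! ### Convenient categories of spaces and the monomorphism hypothesis -/

section Spaces

/-- A convenient category of spaces: a full replete subcategory of the category of topological
spaces that is complete, cocomplete and cartesian closed and that contains the unit interval. For
example `k`-spaces, compactly generated weak Hausdorff spaces, or `Δ`-generated spaces. Its limits
and its colimits need not be those of the category of all topological spaces. -/
class ConvenientSpaces (P : ObjectProperty TopCat.{v}) where
  isClosedUnderIsomorphisms : P.IsClosedUnderIsomorphisms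
  hasLimits : HasLimits P.FullSubcategory
  hasColimits : HasColimits P.FullSubcategory
  /-- the chosen finite products -/
  cartesian : CartesianMonoidalCategory P.FullSubcategory
  /-- cartesian closedness -/
  closed : MonoidalClosed P.FullSubcategory
  interval_mem : P TopCat.I

attribute [reducible] ConvenientSpaces.cartesian ConvenientSpaces.closed

attribute [instance] ConvenientSpaces.cartesian ConvenientSpaces.closed

variable (P : ObjectProperty TopCat.{v}) [ConvenientSpaces P]

/-- The unit interval as an object of a convenient category of spaces. -/
def interval : P.FullSubcategory := ⟨TopCat.I, ConvenientSpaces.interval_mem⟩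

/-- The endpoint `0` of the unit interval, as a morphism from the terminal space. -/
def intervalZero : 𝟙_ P.FullSubcategory ⟶ interval P :=
  ObjectProperty.homMk (TopCat.ofHom (ContinuousMap.const _ (ULift.up 0)))

variable (C : Type u) [Category.{v} C] [EnrichedOrdinaryCategory P.FullSubcategory C]
  [Cotensored P.FullSubcategory C]

/-- The monomorphism hypothesis: for some well-copowered orthogonal factorization system `(E, M)`
and some regular cardinal `κ`, the mapping path object functor preserves the colimits of
`κ`-indexed sequences over a fixed codomain whose legs belong to `M`. -/
def MonomorphismHypothesis [HasPullbacks C] : Prop :=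
  ∃ E M : MorphismProperty C, IsOrthogonalFactorizationSystem E M ∧ IsWellCopowered E ∧
    ∃ κ : Cardinal.{v}, κ.IsRegular ∧
      PreservesSequentialColimitsOverCod M κ (mappingPath C (intervalZero P))

/-- Cole's step-one functorial factorization for the unit interval with its endpoint `0`. -/
noncomputable def coleStepOne [Tensored P.FullSubcategory C] [HasPullbacks C] [HasPushouts C] :
    FunctorialFactorization C :=
  coleFactorization C (intervalZero P)

end Spaces

/-! The free monad sequence approximates, at each arrow f, the free algebra on f for the pointed
endofunctor. The universal property of `σ` extends a map from f into an algebra uniquely along all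
stages (`existsUnique_isAlgebraMap`), and one invertible successor step makes the sequence constant
from there on (`isIso_x_of_succ`). The stable value is then a free algebra, and the monad structure
and the isomorphism of categories of algebras are formal consequences (`Value.isFreeMonad`).

Convergence is Kelly's argument. A well-copowered E consists of epimorphisms (Cantor), and the
E-images of one stage in the later stages form only a set up to isomorphism; so they stabilize, in
the sense that the image maps back to some fixed stage b (`exists_stable_image`). Take a κ-indexed
sequence of stages that outgrows these bounds, with supremum α. The images in stage α interleave
with the stages, so their colimit is again X_α, but now with legs in M. By smallness R preserves
this colimit, which makes X_α an algebra compatible with the sequence, and the sequence stops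
(`isIso_x_succ_of_interleaving`). Smallness speaks of a fixed codomain, whereas the stages have
codomains that agree only up to isomorphism; `isIso_x_right` bridges the gap.

For Cole's R, smallness passes from N to E because E is a pushout of the domain, N and N ⊗ I, and
tensoring with I is a left adjoint (`isColimit_coleObj`).

The comonad comes from composing algebras. By transposition an R-algebra structure on f : X ⟶ Y is a
path lifting function N f ⟶ X^I, and these compose: lift along the second morphism, then along the
first. Let E, L and R now belong to the free factorization. The composite of the free algebras R(L
f) and R f is an algebra, and δ_f : E f ⟶ E(L f) is the algebra map that extends L(L f). Every
comonad law and the distributive law compare two algebra maps out of a free algebra that agree on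
the unit.

Existence is a recursion over all small ordinals in a category with only small colimits. A stage is
recorded as a partial algebra L X ⟶ Y, so that the next one depends on it alone and limit stages are
colimits of partial algebras. The recursion runs in a larger category with large colimits, but its
stages stay in the essential image of the original one (`exists_transfiniteSequence`). It is applied
to the category of endofunctors; objectwise universality follows from the right adjoint of
evaluation, which is built from products. -/

/-! ### Free algebra sequences -/

section FreeAlgebraSequences

universe w

variable {D : Type u} [Category.{v} D]

/-- The free algebra sequence of a pointed endofunctor `(T, τ)` at a single object `X.obj 0`. -/
structure FreeAlgebraSequence (T : D ⥤ D) (τ : 𝟭 D ⟶ T) where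
  /-- the sequence of objects -/
  X : Ordinal.{w} ⥤ D
  /-- the structure maps -/
  σ : ∀ β : Ordinal.{w}, T.obj (X.obj β) ⟶ X.obj (Order.succ β)
  unit_σ : ∀ β : Ordinal.{w}, τ.app (X.obj β) ≫ σ β = X.map (homOfLE (Order.le_succ β))
  σ_condition : ∀ (γ β : Ordinal.{w}) (h : γ < β),
    T.map (X.map (homOfLE h.le)) ≫ σ β =
      σ γ ≫ X.map (homOfLE (Order.succ_le_of_lt h)) ≫ τ.app (X.obj β) ≫ σ β
  σ_universal : ∀ (β : Ordinal.{w}) (Z : D) (g : T.obj (X.obj β) ⟶ Z),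
    (∀ (γ : Ordinal.{w}) (h : γ < β),
      T.map (X.map (homOfLE h.le)) ≫ g =
        σ γ ≫ X.map (homOfLE (Order.succ_le_of_lt h)) ≫ τ.app (X.obj β) ≫ g) →
    ∃! k : X.obj (Order.succ β) ⟶ Z, σ β ≫ k = g
  continuous : X.IsWellOrderContinuous

namespace FreeAlgebraSequence

variable {T : D ⥤ D} {τ : 𝟭 D ⟶ T} (P : FreeAlgebraSequence.{v, u, w} T τ)

/-- The transition morphisms of the sequence. -/
def x {γ β : Ordinal.{w}} (h : γ ≤ β) : P.X.obj γ ⟶ P.X.obj β := P.X.map (homOfLE h)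

lemma x_self (β : Ordinal.{w}) : P.x (le_refl β) = 𝟙 _ := P.X.map_id β

lemma x_comp {γ β α : Ordinal.{w}} (h : γ ≤ β) (h' : β ≤ α) :
    P.x h ≫ P.x h' = P.x (h.trans h') :=
  (P.X.map_comp (homOfLE h) (homOfLE h')).symm

lemma x_comp_assoc {γ β α : Ordinal.{w}} (h : γ ≤ β) (h' : β ≤ α) {Z : D}
    (g : P.X.obj α ⟶ Z) : P.x h ≫ P.x h' ≫ g = P.x (h.trans h') ≫ g := by
  rw [← Category.assoc, x_comp]

lemma τ_σ (β : Ordinal.{w}) : τ.app (P.X.obj β) ≫ P.σ β = P.x (Order.le_succ β) := P.unit_σ β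

lemma τ_σ_assoc (β : Ordinal.{w}) {Z : D} (g : P.X.obj (Order.succ β) ⟶ Z) :
    τ.app (P.X.obj β) ≫ P.σ β ≫ g = P.x (Order.le_succ β) ≫ g := by
  rw [← Category.assoc, τ_σ]

lemma τ_naturality {A B : D} (g : A ⟶ B) : g ≫ τ.app B = τ.app A ≫ T.map g :=
  τ.naturality g

/-- For γ < β this is `σ_condition` with the unit law absorbed; it makes `σ` natural along the whole
sequence. -/
lemma map_σ {γ β : Ordinal.{w}} (h : γ ≤ β) :
    T.map (P.x h) ≫ P.σ β = P.σ γ ≫ P.x (Order.succ_le_succ h) := by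
  obtain rfl | h' := h.eq_or_lt
  · rw [x_self, x_self, T.map_id, Category.id_comp, Category.comp_id]
  · refine (P.σ_condition γ β h').trans ?_
    rw [P.unit_σ]
    exact congr_arg (P.σ γ ≫ ·) (P.x_comp _ _)

lemma σ_hom_ext {β : Ordinal.{w}} {Z : D} {k k' : P.X.obj (Order.succ β) ⟶ Z}
    (h : P.σ β ≫ k = P.σ β ≫ k') : k = k' := by
  refine (P.σ_universal β Z (P.σ β ≫ k') fun γ h => ?_).unique h rfl
  have := P.σ_condition γ β h
  rw [← Category.assoc, this]
  simp only [Category.assoc]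

/-- The universal property of `σ`, in terms of morphisms that factor the unit condition. -/
lemma exists_desc {β : Ordinal.{w}} {Z : D} (g : T.obj (P.X.obj β) ⟶ Z)
    (hg : ∀ (γ : Ordinal.{w}) (h : γ < β), T.map (P.x h.le) ≫ g =
      P.σ γ ≫ P.x (Order.succ_le_of_lt h) ≫ τ.app (P.X.obj β) ≫ g) :
    ∃ k : P.X.obj (Order.succ β) ⟶ Z, P.σ β ≫ k = g :=
  (P.σ_universal β Z g hg).exists

lemma hom_ext_of_isSuccLimit {β : Ordinal.{w}} (hβ : Order.IsSuccLimit β) {Z : D}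
    {k k' : P.X.obj β ⟶ Z} (h : ∀ (γ : Ordinal.{w}) (h : γ < β), P.x h.le ≫ k = P.x h.le ≫ k') :
    k = k' := by
  obtain ⟨hc⟩ := P.continuous.nonempty_isColimit β hβ
  exact hc.hom_ext fun γ => h γ.1 γ.2

lemma exists_desc_of_isSuccLimit {β : Ordinal.{w}} (hβ : Order.IsSuccLimit β) {Z : D}
    (g : ∀ (γ : Ordinal.{w}), γ < β → (P.X.obj γ ⟶ Z))
    (hg : ∀ (γ γ' : Ordinal.{w}) (h : γ ≤ γ') (h' : γ' < β),
      P.x h ≫ g γ' h' = g γ (h.trans_lt h')) :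
    ∃ k : P.X.obj β ⟶ Z, ∀ (γ : Ordinal.{w}) (h : γ < β), P.x h.le ≫ k = g γ h := by
  obtain ⟨hc⟩ := P.continuous.nonempty_isColimit β hβ
  refine ⟨hc.desc ⟨Z, ⟨fun γ => g γ.1 γ.2, fun γ γ' φ => ?_⟩⟩, fun γ h => hc.fac _ ⟨γ, h⟩⟩
  exact (hg γ.1 γ'.1 (leOfHom φ) γ'.2).trans (Category.comp_id _).symm

/-- The transition from `β` to `succ β` is invertible as soon as `X_β` carries a compatible
algebra structure. -/
lemma isIso_x_succ {β : Ordinal.{w}} (h : T.obj (P.X.obj β) ⟶ P.X.obj β)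
    (hx : ∀ (γ : Ordinal.{w}) (hγ : γ < β),
      T.map (P.x hγ.le) ≫ h = P.σ γ ≫ P.x (Order.succ_le_of_lt hγ))
    (hτ : τ.app (P.X.obj β) ≫ h = 𝟙 (P.X.obj β)) (hσ : P.σ β = h ≫ P.x (Order.le_succ β)) :
    IsIso (P.x (Order.le_succ β)) := by
  obtain ⟨k, hk⟩ := P.exists_desc h fun γ hγ => by
    rw [hx γ hγ, hτ, Category.comp_id]
  refine ⟨k, ?_, ?_⟩
  · rw [← τ_σ, Category.assoc, hk, hτ]
  · apply P.σ_hom_ext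
    rw [← Category.assoc, hk, ← hσ, Category.comp_id]

/-- Once a transition to the successor is invertible, the sequence is constant. -/
lemma isIso_x_of_succ {δ : Ordinal.{w}} (hδ : IsIso (P.x (Order.le_succ δ)))
    (β : Ordinal.{w}) (h : δ ≤ β) : IsIso (P.x h) := by
  induction β using WellFoundedLT.induction with
  | ind β ih =>
  obtain h' | rfl := h.lt_or_eq
  swap
  · rw [x_self]
    infer_instance
  obtain rfl | ⟨β, rfl⟩ | hβ := Ordinal.zero_or_succ_or_isSuccLimit β
  · exact absurd h' not_lt_zero
  · replace h' : δ ≤ β := Order.le_of_lt_succ h'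
    obtain h'' | rfl := h'.lt_or_eq
    swap
    · exact hδ
    have hi (γ : Ordinal.{w}) (h₁ : δ ≤ γ) (h₂ : γ ≤ β) : IsIso (P.x h₁) :=
      ih γ (Order.lt_succ_of_le h₂) h₁
    have := hi β h' le_rfl
    -- Since X_δ ⟶ X_β is invertible, `σ δ` can be transported to an algebra structure on X_β, to
    -- which `isIso_x_succ` applies.
    let h₀ : T.obj (P.X.obj β) ⟶ P.X.obj β :=
      inv (T.map (P.x h')) ≫ P.σ δ ≫ P.x (Order.succ_le_of_lt h'')
    have hh₀ : T.map (P.x h') ≫ h₀ = P.σ δ ≫ P.x (Order.succ_le_of_lt h'') :=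
      IsIso.hom_inv_id_assoc _ _
    have hτ : τ.app (P.X.obj β) ≫ h₀ = 𝟙 (P.X.obj β) := by
      rw [← cancel_epi (P.x h'), ← Category.assoc, τ_naturality, Category.assoc, hh₀,
        τ_σ_assoc, x_comp, Category.comp_id]
    have : IsIso (P.x (Order.le_succ β)) := by
      refine P.isIso_x_succ h₀ (fun γ hγ => ?_) hτ ?_
      · obtain h₁ | h₁ := le_total γ δ
        · rw [← P.x_comp h₁ h', T.map_comp, Category.assoc, hh₀, ← Category.assoc, map_σ,
            Category.assoc, x_comp]
        · have := hi γ h₁ hγ.le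
          rw [← cancel_epi (T.map (P.x h₁)), ← Category.assoc, ← T.map_comp, x_comp, hh₀,
            ← Category.assoc, map_σ, Category.assoc, x_comp]
      · rw [← cancel_epi (T.map (P.x h')), ← Category.assoc, hh₀, map_σ, Category.assoc, x_comp]
    rw [← P.x_comp h' (Order.le_succ β)]
    infer_instance
  · have hg (γ : Ordinal.{w}) (hγ : γ < β) : IsIso (P.x (le_max_left δ γ)) :=
      ih _ (max_lt h' hγ) _
    -- The inverse X_β ⟶ X_δ: a stage γ goes forward to max δ γ, where the induction hypothesis
    -- applies, and then back to δ.
    obtain ⟨k, hk⟩ := P.exists_desc_of_isSuccLimit hβ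
      (fun γ hγ => haveI := hg γ hγ; P.x (le_max_right δ γ) ≫ inv (P.x (le_max_left δ γ)))
      (fun γ γ' h₁ h₂ => by
        have := hg γ' h₂
        have := hg γ (h₁.trans_lt h₂)
        rw [← cancel_mono (P.x (le_max_left δ γ'))]
        simp only [Category.assoc, IsIso.inv_hom_id, Category.comp_id]
        rw [x_comp, ← P.x_comp (le_max_left δ γ) (max_le_max le_rfl h₁), IsIso.inv_hom_id_assoc,
          x_comp])
    refine ⟨k, ?_, ?_⟩
    · have := hg δ h'
      rw [hk δ h']
      exact IsIso.hom_inv_id _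
    · apply P.hom_ext_of_isSuccLimit hβ
      intro γ hγ
      have := hg γ hγ
      rw [← Category.assoc, hk γ hγ, Category.comp_id, Category.assoc,
        ← P.x_comp (le_max_left δ γ) (max_lt h' hγ).le, IsIso.inv_hom_id_assoc, x_comp]

/-- The morphisms `X_β ⟶ B` to an algebra `b : T B ⟶ B` that are compatible with the structure
maps of the sequence. -/
structure IsAlgebraMap {B : D} (b : T.obj B ⟶ B) {β : Ordinal.{w}} (k : P.X.obj β ⟶ B) :
    Prop where
  map_comp : ∀ (γ : Ordinal.{w}) (h : γ < β),
    T.map (P.x h.le ≫ k) ≫ b = P.σ γ ≫ P.x (Order.succ_le_of_lt h) ≫ k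

variable {P} in
lemma IsAlgebraMap.restrict {B : D} {b : T.obj B ⟶ B} {β γ : Ordinal.{w}} {k : P.X.obj β ⟶ B}
    (hk : P.IsAlgebraMap b k) (h : γ ≤ β) : P.IsAlgebraMap b (P.x h ≫ k) where
  map_comp α hα := by
    rw [x_comp_assoc, x_comp_assoc]
    exact hk.map_comp α (hα.trans_le h)

/-- Every morphism from the first object of the sequence to an algebra extends uniquely to the
whole sequence. -/
lemma existsUnique_isAlgebraMap {B : D} (b : T.obj B ⟶ B) (hb : τ.app B ≫ b = 𝟙 B)
    (g : P.X.obj 0 ⟶ B) (β : Ordinal.{w}) :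
    ∃! k : P.X.obj β ⟶ B, P.x (zero_le : 0 ≤ β) ≫ k = g ∧ P.IsAlgebraMap b k := by
  induction β using WellFoundedLT.induction with
  | ind β ih =>
  obtain rfl | ⟨β, rfl⟩ | hβ := Ordinal.zero_or_succ_or_isSuccLimit β
  · refine ⟨g, ⟨?_, ⟨fun γ h => absurd h not_lt_zero⟩⟩, fun k hk => ?_⟩
    · rw [x_self, Category.id_comp]
    · rw [← hk.1, x_self, Category.id_comp]
  · obtain ⟨k, ⟨hk₀, hk⟩, hk'⟩ := ih β (Order.lt_succ β)
    -- At stage β + 1 the condition for the index β forces `P.σ β ≫ l = T.map k ≫ b`; the unit law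
    -- of `b` shows that this map satisfies the hypothesis of `σ_universal`.
    obtain ⟨l, hl⟩ := P.exists_desc (T.map k ≫ b) (fun γ h => by
      rw [← Category.assoc, ← T.map_comp, hk.map_comp γ h]
      congr 2
      rw [← Category.assoc, ← τ_naturality, Category.assoc, hb, Category.comp_id])
    have hxl : P.x (Order.le_succ β) ≫ l = k := by
      rw [← τ_σ, Category.assoc, hl, ← Category.assoc, ← τ_naturality, Category.assoc, hb,
        Category.comp_id]
    refine ⟨l, ⟨?_, ⟨fun γ h => ?_⟩⟩, fun m hm => ?_⟩
    · rw [← P.x_comp (zero_le : 0 ≤ β) (Order.le_succ β), Category.assoc, hxl, hk₀]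
    · obtain h' | rfl := (Order.le_of_lt_succ h).lt_or_eq
      · rw [← P.x_comp h'.le (Order.le_succ β), Category.assoc, hxl, hk.map_comp γ h',
          ← P.x_comp (Order.succ_le_of_lt h') (Order.le_succ β), Category.assoc, hxl]
      · rw [hxl, x_self, Category.id_comp, hl]
    · apply P.σ_hom_ext
      have h₁ : P.x (Order.le_succ β) ≫ m = k :=
        hk' _ ⟨by rw [x_comp_assoc]; exact hm.1, hm.2.restrict _⟩
      have h₂ := hm.2.map_comp β (Order.lt_succ β)
      rw [x_self, Category.id_comp, h₁] at h₂
      rw [hl, h₂]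
  · choose k hk hk' using fun γ (hγ : γ < β) => ih γ hγ
    obtain ⟨l, hl⟩ := P.exists_desc_of_isSuccLimit hβ k (fun γ γ' h h' =>
      hk' _ _ _ ⟨by rw [x_comp_assoc]; exact (hk γ' h').1, (hk γ' h').2.restrict _⟩)
    refine ⟨l, ⟨?_, ⟨fun γ h => ?_⟩⟩, fun m hm => ?_⟩
    · have h0 : 0 < β := hβ.bot_lt
      rw [hl 0 h0, ← (hk 0 h0).1, x_self, Category.id_comp]
    -- At a limit, the condition for γ is read off at stage γ + 1, which is still below β.
    · have h' := hβ.succ_lt h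
      have h₂ := (hk _ h').2.map_comp γ (Order.lt_succ γ)
      rw [x_self, Category.id_comp] at h₂
      rw [hl γ h, hl _ h', ← h₂]
      congr 2
      exact (hk' _ _ _ ⟨by rw [x_comp_assoc]; exact (hk _ h').1, (hk _ h').2.restrict _⟩).symm
    · apply P.hom_ext_of_isSuccLimit hβ
      intro γ h
      rw [hl γ h]
      exact hk' _ _ _ ⟨by rw [x_comp_assoc]; exact hm.1, hm.2.restrict _⟩

variable {P} in
lemma IsAlgebraMap.comp {B B' : D} {b : T.obj B ⟶ B} {b' : T.obj B' ⟶ B'} {β : Ordinal.{w}}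
    {k : P.X.obj β ⟶ B} (hk : P.IsAlgebraMap b k) {l : B ⟶ B'} (hl : T.map l ≫ b' = b ≫ l) :
    P.IsAlgebraMap b' (k ≫ l) where
  map_comp γ h := by
    rw [← Category.assoc, T.map_comp, Category.assoc, hl, ← Category.assoc, hk.map_comp γ h]
    simp only [Category.assoc]

/-- A cocone on the sequence whose legs are eventually invertible. -/
structure StableCocone (L : D) where
  /-- the legs -/
  leg : ∀ β : Ordinal.{w}, P.X.obj β ⟶ L
  x_leg : ∀ {γ β : Ordinal.{w}} (h : γ ≤ β), P.x h ≫ leg β = leg γ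
  exists_isIso_leg : ∃ β, ∀ γ, β ≤ γ → IsIso (leg γ)

namespace StableCocone

variable {P} {L : D} (c : P.StableCocone L)

lemma x_leg_assoc {γ β : Ordinal.{w}} (h : γ ≤ β) {Z : D} (g : L ⟶ Z) :
    P.x h ≫ c.leg β ≫ g = c.leg γ ≫ g := by
  rw [← Category.assoc, x_leg]

/-- The structure is `σ β` transported along one invertible leg. Compatibility with an earlier leg
is naturality of `σ`; for a later one, the transition from β is itself invertible and can be
cancelled. -/
lemma exists_str : ∃ a : T.obj L ⟶ L,
    ∀ β, T.map (c.leg β) ≫ a = P.σ β ≫ c.leg (Order.succ β) := by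
  obtain ⟨β, hβ⟩ := c.exists_isIso_leg
  have := hβ β le_rfl
  refine ⟨inv (T.map (c.leg β)) ≫ P.σ β ≫ c.leg (Order.succ β), fun γ => ?_⟩
  have key {α α' : Ordinal.{w}} (h : α ≤ α') :
      T.map (P.x h) ≫ P.σ α' ≫ c.leg (Order.succ α') = P.σ α ≫ c.leg (Order.succ α) := by
    rw [← Category.assoc, P.map_σ h, Category.assoc, c.x_leg]
  obtain h | h := le_total γ β
  · rw [← c.x_leg h, T.map_comp, Category.assoc, IsIso.hom_inv_id_assoc, key h]
  · have := hβ γ h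
    have hx : IsIso (P.x h) := by
      have : IsIso (P.x h ≫ c.leg γ) := by
        rw [x_leg]
        infer_instance
      exact IsIso.of_isIso_comp_right _ (c.leg γ)
    rw [← cancel_epi (T.map (P.x h)), key h, ← Category.assoc, ← T.map_comp, x_leg,
      IsIso.hom_inv_id_assoc]

/-- The algebra structure on the vertex of a stable cocone. -/
noncomputable def str : T.obj L ⟶ L := c.exists_str.choose

lemma map_leg_str (β : Ordinal.{w}) :
    T.map (c.leg β) ≫ c.str = P.σ β ≫ c.leg (Order.succ β) :=
  c.exists_str.choose_spec β

lemma unit_str : τ.app L ≫ c.str = 𝟙 L := by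
  obtain ⟨β, hβ⟩ := c.exists_isIso_leg
  have := hβ β le_rfl
  rw [← cancel_epi (c.leg β), ← Category.assoc, τ_naturality, Category.assoc, map_leg_str,
    Category.comp_id, τ_σ_assoc, x_leg]

lemma isAlgebraMap_leg (β : Ordinal.{w}) : P.IsAlgebraMap c.str (c.leg β) where
  map_comp γ h := by
    rw [x_leg, x_leg, map_leg_str]

/-- The algebra maps out of the vertex are determined by their restrictions to the first object
of the sequence. -/
lemma hom_ext {B : D} (b : T.obj B ⟶ B) (hb : τ.app B ≫ b = 𝟙 B) {k k' : L ⟶ B}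
    (hk : T.map k ≫ b = c.str ≫ k) (hk' : T.map k' ≫ b = c.str ≫ k')
    (h : c.leg 0 ≫ k = c.leg 0 ≫ k') : k = k' := by
  obtain ⟨β, hβ⟩ := c.exists_isIso_leg
  have := hβ β le_rfl
  rw [← cancel_epi (c.leg β)]
  refine (P.existsUnique_isAlgebraMap b hb (c.leg 0 ≫ k) β).unique
    ⟨?_, (c.isAlgebraMap_leg β).comp hk⟩ ⟨?_, (c.isAlgebraMap_leg β).comp hk'⟩
  · rw [x_leg_assoc]
  · rw [x_leg_assoc, h]

lemma exists_lift {B : D} (b : T.obj B ⟶ B) (hb : τ.app B ≫ b = 𝟙 B) (g : P.X.obj 0 ⟶ B) :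
    ∃ k : L ⟶ B, T.map k ≫ b = c.str ≫ k ∧ c.leg 0 ≫ k = g := by
  obtain ⟨β, hβ⟩ := c.exists_isIso_leg
  have := hβ β le_rfl
  have := hβ _ (Order.le_succ β)
  -- The extension is taken at β + 1 and not at β: only there does `IsAlgebraMap` contain the
  -- equation for the index β.
  obtain ⟨k, ⟨hk₀, hk⟩, -⟩ := P.existsUnique_isAlgebraMap b hb g (Order.succ β)
  have h₁ : P.x (Order.le_succ β) ≫ k = c.leg β ≫ inv (c.leg (Order.succ β)) ≫ k := by
    rw [← c.x_leg (Order.le_succ β), Category.assoc, IsIso.hom_inv_id_assoc]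
  refine ⟨inv (c.leg (Order.succ β)) ≫ k, ?_, ?_⟩
  · have h₂ := hk.map_comp β (Order.lt_succ β)
    rw [h₁, x_self, Category.id_comp] at h₂
    rw [← cancel_epi (T.map (c.leg β)), ← Category.assoc, ← T.map_comp, h₂, ← Category.assoc,
      map_leg_str, Category.assoc, IsIso.hom_inv_id_assoc]
  · rw [← c.x_leg (zero_le : 0 ≤ Order.succ β), Category.assoc, IsIso.hom_inv_id_assoc, hk₀]

end StableCocone

end FreeAlgebraSequence

end FreeAlgebraSequences

/-! ### The value of a convergent free monad sequence -/

section FreeMonadValue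

variable {D : Type u} [Category.{v} D] {T : D ⥤ D} {τ : 𝟭 D ⟶ T}

namespace FreeMonadSequence

variable (S : FreeMonadSequence T τ)

/-- The free algebra sequence at an object. -/
@[simps]
def atObj (A : D) : FreeAlgebraSequence.{v, u, v} T τ where
  X := S.X ⋙ (evaluation D D).obj A
  σ β := (S.σ β).app A
  unit_σ β := S.unit_σ β A
  σ_condition γ β h := S.σ_condition γ β h A
  σ_universal β Z g hg := S.σ_universal β A Z g hg
  continuous := S.continuous A

variable {S}

lemma Converges.exists_isEventuallyConstantFrom (hS : S.Converges) (A : D) :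
    ∃ β, (S.X ⋙ (evaluation D D).obj A).IsEventuallyConstantFrom β := by
  obtain ⟨β, hβ⟩ := hS A
  exact ⟨β, fun γ f => hβ γ (leOfHom f)⟩

namespace Value

variable {F : D ⥤ D} {η : 𝟭 D ⟶ F} (c : S.Value F η)

/-- The legs of the colimit cocone at an object, which are eventually invertible. -/
def stableCocone (hS : S.Converges) (A : D) : (S.atObj A).StableCocone (F.obj A) where
  leg β := (c.ι.app β).app A
  x_leg h := (congr_app (c.ι.naturality (homOfLE h)) A).trans (Category.comp_id _)
  exists_isIso_leg := by
    obtain ⟨β, hβ⟩ := hS.exists_isEventuallyConstantFrom A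
    obtain ⟨hc⟩ := c.isColimit A
    exact ⟨β, fun γ h => hβ.isIso_ι_of_isColimit' hc γ (homOfLE h)⟩

variable (hS : S.Converges)

/-- The algebra structure on the value of a convergent sequence. -/
noncomputable def str (A : D) : T.obj (F.obj A) ⟶ F.obj A := (c.stableCocone hS A).str

lemma unit_str (A : D) : τ.app (F.obj A) ≫ c.str hS A = 𝟙 (F.obj A) :=
  (c.stableCocone hS A).unit_str

/-- The isomorphism of an object with the first object of its free algebra sequence. -/
def zeroIso (A : D) : A ≅ (S.atObj A).X.obj 0 := (S.zero.app A).symm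

/-- The component at an object of the unit of the value. -/
def unitApp (_ : S.Value F η) (A : D) : A ⟶ F.obj A := η.app A

lemma zeroIso_hom_leg (A : D) :
    (zeroIso A).hom ≫ (c.stableCocone hS A).leg 0 = c.unitApp A :=
  congr_app c.unit A

lemma unitApp_naturality {A B : D} (h : A ⟶ B) : h ≫ c.unitApp B = c.unitApp A ≫ F.map h :=
  η.naturality h

/-- This is the compatibility of the structure map with the leg at 0, since that leg is the unit up
to `zeroIso`. -/
lemma fromGenerator_app (A : D) :
    c.fromGenerator.app A = T.map (c.unitApp A) ≫ c.str hS A := by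
  have h := (c.stableCocone hS A).map_leg_str 0
  refine (Category.id_comp _).trans ((congr_arg (T.map (zeroIso A).hom ≫ ·) h.symm).trans ?_)
  rw [← zeroIso_hom_leg c hS, T.map_comp, Category.assoc]
  rfl

include hS in
lemma unit_fromGenerator : τ ≫ c.fromGenerator = η := by
  ext A
  rw [NatTrans.comp_app, c.fromGenerator_app hS, ← Category.assoc]
  refine (congr_arg (· ≫ _) (τ.naturality (c.unitApp A)).symm).trans ?_
  rw [Category.assoc, unit_str]
  exact Category.comp_id _

/-- The functoriality of the stages of the sequence. -/
def stageMap (β : Ordinal.{v}) {A B : D} (h : A ⟶ B) :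
    (S.atObj A).X.obj β ⟶ (S.atObj B).X.obj β := (S.X.obj β).map h

lemma stageMap_σ (β : Ordinal.{v}) {A B : D} (h : A ⟶ B) :
    T.map (stageMap β h) ≫ (S.atObj B).σ β = (S.atObj A).σ β ≫ stageMap (Order.succ β) h :=
  (S.σ β).naturality h

lemma leg_naturality (β : Ordinal.{v}) {A B : D} (h : A ⟶ B) :
    (c.stableCocone hS A).leg β ≫ F.map h = stageMap β h ≫ (c.stableCocone hS B).leg β :=
  ((c.ι.app β).naturality h).symm

/-- After restriction along an invertible leg this is the naturality of `σ` and of the legs. -/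
lemma str_naturality {A B : D} (h : A ⟶ B) :
    T.map (F.map h) ≫ c.str hS B = c.str hS A ≫ F.map h := by
  obtain ⟨β, hβ⟩ := (c.stableCocone hS A).exists_isIso_leg
  have := hβ β le_rfl
  rw [← cancel_epi (T.map ((c.stableCocone hS A).leg β)), ← Category.assoc, ← T.map_comp,
    leg_naturality, T.map_comp, Category.assoc, str, str, (c.stableCocone hS B).map_leg_str,
    ← Category.assoc, stageMap_σ, Category.assoc, ← leg_naturality, ← Category.assoc,
    ← Category.assoc, (c.stableCocone hS A).map_leg_str]

/-- The algebra maps out of the value are determined by their restrictions along the unit. -/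
lemma str_hom_ext {A B : D} (b : T.obj B ⟶ B) (hb : τ.app B ≫ b = 𝟙 B) {k k' : F.obj A ⟶ B}
    (hk : T.map k ≫ b = c.str hS A ≫ k) (hk' : T.map k' ≫ b = c.str hS A ≫ k')
    (h : c.unitApp A ≫ k = c.unitApp A ≫ k') : k = k' := by
  refine (c.stableCocone hS A).hom_ext b hb hk hk' ?_
  rwa [← cancel_epi (zeroIso A).hom, ← Category.assoc, ← Category.assoc, zeroIso_hom_leg]

include c hS in
lemma exists_lift {A B : D} (b : T.obj B ⟶ B) (hb : τ.app B ≫ b = 𝟙 B) (g : A ⟶ B) :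
    ∃ k : F.obj A ⟶ B, T.map k ≫ b = c.str hS A ≫ k ∧ c.unitApp A ≫ k = g := by
  obtain ⟨k, hk, hk'⟩ := (c.stableCocone hS A).exists_lift b hb ((zeroIso A).inv ≫ g)
  refine ⟨k, hk, ?_⟩
  rw [← zeroIso_hom_leg c hS, Category.assoc, hk', Iso.hom_inv_id_assoc]

/-- The extension of a morphism into an algebra to an algebra map out of the value. -/
noncomputable def lift {A B : D} (b : T.obj B ⟶ B) (hb : τ.app B ≫ b = 𝟙 B) (g : A ⟶ B) :
    F.obj A ⟶ B :=
  (c.exists_lift hS b hb g).choose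

lemma map_lift {A B : D} (b : T.obj B ⟶ B) (hb : τ.app B ≫ b = 𝟙 B) (g : A ⟶ B) :
    T.map (c.lift hS b hb g) ≫ b = c.str hS A ≫ c.lift hS b hb g :=
  (c.exists_lift hS b hb g).choose_spec.1

lemma unit_lift {A B : D} (b : T.obj B ⟶ B) (hb : τ.app B ≫ b = 𝟙 B) (g : A ⟶ B) :
    c.unitApp A ≫ c.lift hS b hb g = g :=
  (c.exists_lift hS b hb g).choose_spec.2

/-- The component at an object of the multiplication on the value. -/
noncomputable def mulApp (A : D) : F.obj (F.obj A) ⟶ F.obj A :=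
  c.lift hS (c.str hS A) (c.unit_str hS A) (𝟙 (F.obj A))

lemma map_mulApp (A : D) :
    T.map (c.mulApp hS A) ≫ c.str hS A = c.str hS (F.obj A) ≫ c.mulApp hS A :=
  c.map_lift hS (c.str hS A) (c.unit_str hS A) _

lemma unit_mulApp (A : D) : c.unitApp (F.obj A) ≫ c.mulApp hS A = 𝟙 (F.obj A) :=
  c.unit_lift hS (c.str hS A) (c.unit_str hS A) _

/-- Both sides are algebra maps out of a free algebra, so it suffices to compare them on the unit.
The right unit law and associativity below hold for the same reason. -/
lemma mulApp_naturality {A B : D} (h : A ⟶ B) :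
    F.map (F.map h) ≫ c.mulApp hS B = c.mulApp hS A ≫ F.map h := by
  refine c.str_hom_ext hS (c.str hS B) (c.unit_str hS B) ?_ ?_ ?_
  · rw [T.map_comp, Category.assoc, map_mulApp, ← Category.assoc, ← Category.assoc,
      str_naturality]
  · rw [T.map_comp, Category.assoc, str_naturality, ← Category.assoc, map_mulApp, Category.assoc]
  · rw [← Category.assoc, ← Category.assoc, unit_mulApp, Category.id_comp, ← unitApp_naturality,
      Category.assoc, unit_mulApp, Category.comp_id]

lemma map_unit_mulApp (A : D) : F.map (c.unitApp A) ≫ c.mulApp hS A = 𝟙 (F.obj A) := by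
  refine c.str_hom_ext hS (c.str hS A) (c.unit_str hS A) ?_ ?_ ?_
  · rw [T.map_comp, Category.assoc, map_mulApp, ← Category.assoc, ← Category.assoc,
      str_naturality]
  · rw [T.map_id, Category.id_comp, Category.comp_id]
  · rw [← Category.assoc, ← unitApp_naturality, Category.assoc, unit_mulApp]

lemma mulApp_assoc (A : D) : F.map (c.mulApp hS A) ≫ c.mulApp hS A =
    c.mulApp hS (F.obj A) ≫ c.mulApp hS A := by
  refine c.str_hom_ext hS (c.str hS A) (c.unit_str hS A) ?_ ?_ ?_
  · rw [T.map_comp, Category.assoc, map_mulApp, ← Category.assoc, ← Category.assoc,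
      str_naturality]
  · rw [T.map_comp, Category.assoc, map_mulApp, ← Category.assoc, ← Category.assoc, map_mulApp]
  · rw [← Category.assoc, ← Category.assoc, unit_mulApp, Category.id_comp, ← unitApp_naturality,
      Category.assoc, unit_mulApp, Category.comp_id]

/-- The multiplication on the value of a convergent sequence. -/
noncomputable def mul : F ⋙ F ⟶ F where
  app A := c.mulApp hS A
  naturality _ _ h := c.mulApp_naturality hS h

end Value

section Free

variable (M : Monad D) (c : S.Value M.toFunctor M.η) (hS : S.Converges)

include hS in
lemma Value.unit_fromGenerator_comp {A : D} (a : M.obj A ⟶ A) (ha : c.unitApp A ≫ a = 𝟙 A) :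
    τ.app A ≫ c.fromGenerator.app A ≫ a = 𝟙 A := by
  have h := congr_app (c.unit_fromGenerator hS) A
  rw [← Category.assoc]
  exact (congr_arg (· ≫ a) h).trans ha

variable (hM : ∀ A, M.μ.app A = c.mulApp hS A)

include hM

/-- Restricting the free monad algebra on `A` along the canonical map gives back the structure
`c.str`, because the multiplication is an algebra map split by the unit. -/
lemma Value.fromGenerator_comp_μ (A : D) :
    c.fromGenerator.app (M.obj A) ≫ M.μ.app A = c.str hS A := by
  rw [c.fromGenerator_app hS, Category.assoc, hM, ← map_mulApp, ← Category.assoc, ← T.map_comp,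
    unit_mulApp, T.map_id, Category.id_comp]

/-- The structure map of an algebra of the monad is a map of algebras of the pointed
endofunctor. -/
lemma Value.map_algebra {A : D} (a : M.obj A ⟶ A)
    (ha : M.μ.app A ≫ a = M.map a ≫ a) :
    T.map a ≫ c.fromGenerator.app A ≫ a = c.str hS A ≫ a := by
  rw [← Category.assoc, c.fromGenerator.naturality, Category.assoc, ← ha, ← Category.assoc,
    c.fromGenerator_comp_μ M hS hM]

/-- This yields fullness: both sides are maps of algebras of the pointed endofunctor out of the free
algebra on `A`, and both restrict to `g`. -/
lemma Value.algebra_hom {A B : D} (a : M.obj A ⟶ A) (b : M.obj B ⟶ B)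
    (hau : c.unitApp A ≫ a = 𝟙 A) (hbu : c.unitApp B ≫ b = 𝟙 B)
    (ha : M.μ.app A ≫ a = M.map a ≫ a) (hb : M.μ.app B ≫ b = M.map b ≫ b) (g : A ⟶ B)
    (hg : T.map g ≫ c.fromGenerator.app B ≫ b = (c.fromGenerator.app A ≫ a) ≫ g) :
    M.map g ≫ b = a ≫ g := by
  refine c.str_hom_ext hS (c.fromGenerator.app B ≫ b) (c.unit_fromGenerator_comp M hS b hbu)
    ?_ ?_ ?_
  · rw [T.map_comp, Category.assoc, c.map_algebra M hS hM b hb, ← Category.assoc,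
      ← Category.assoc, c.str_naturality]
  · rw [T.map_comp, Category.assoc, hg, ← Category.assoc, c.map_algebra M hS hM a ha,
      Category.assoc]
  · rw [← Category.assoc, ← Category.assoc, hau, Category.id_comp, ← unitApp_naturality,
      Category.assoc, hbu, Category.comp_id]

/-- The extension of the identity of an algebra to the free algebra on it is the candidate monad
structure; both sides are algebra maps that restrict to it along the unit. -/
lemma Value.lift_assoc {B : D} (b : T.obj B ⟶ B) (hb : τ.app B ≫ b = 𝟙 B) :
    M.μ.app B ≫ c.lift hS b hb (𝟙 B) =
      M.map (c.lift hS b hb (𝟙 B)) ≫ c.lift hS b hb (𝟙 B) := by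
  rw [hM]
  refine c.str_hom_ext hS b hb ?_ ?_ ?_
  · rw [T.map_comp, Category.assoc, map_lift, ← Category.assoc, ← Category.assoc, map_mulApp]
  · rw [T.map_comp, Category.assoc, map_lift, ← Category.assoc, ← Category.assoc,
      c.str_naturality]
  · rw [← Category.assoc, unit_mulApp, Category.id_comp, ← Category.assoc, ← unitApp_naturality,
      Category.assoc, unit_lift, Category.comp_id]

/-- The value of a convergent free monad sequence is the free monad. -/
lemma Value.isFreeMonad : IsFreeMonad τ M c.fromGenerator := by
  have hφ := c.unit_fromGenerator hS
  refine ⟨hφ, ⟨fun {A B} g => ?_⟩, ⟨fun {A B} g g' h => ?_⟩, fun A B h => ?_, fun B => ?_⟩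
  · exact ⟨⟨g.hom.f, c.algebra_hom M hS hM A.a B.a A.unit B.unit A.assoc B.assoc g.hom.f g.hom.h⟩,
      rfl⟩
  · ext
    exact congr_arg (fun k => k.hom.f) h
  · obtain ⟨A, a, hu, ha⟩ := A
    obtain ⟨B, b, hu', hb⟩ := B
    have h₁ := congr_arg (fun X => X.obj) h
    injection h₁ with h₂ h₃
    dsimp at h₂
    subst h₂
    congr 1
    -- Injectivity on objects: both structure maps are algebra maps from the free algebra to the
    -- common restriction, and both split the unit.
    have h₄ : c.fromGenerator.app A ≫ a = c.fromGenerator.app A ≫ b := eq_of_heq h₃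
    refine c.str_hom_ext hS (c.fromGenerator.app A ≫ a) (c.unit_fromGenerator_comp M hS a hu)
      (c.map_algebra M hS hM a ha) ?_ (hu.trans hu'.symm)
    rw [h₄]
    exact c.map_algebra M hS hM b hb
  · obtain ⟨⟨B, b⟩, hb⟩ := B
    refine ⟨⟨B, c.lift hS b hb (𝟙 B), c.unit_lift hS b hb (𝟙 B), c.lift_assoc M hS hM b hb⟩, ?_⟩
    have h : c.fromGenerator.app B ≫ c.lift hS b hb (𝟙 B) = b := by
      rw [c.fromGenerator_app hS, Category.assoc, ← map_lift, ← Category.assoc, ← T.map_comp,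
        unit_lift, T.map_id, Category.id_comp]
    simp only [restrictAlgebra]
    congr 2

end Free

end FreeMonadSequence

end FreeMonadValue

/-! ### Quotients and chains of quotients -/

section WellCopowered

variable {C : Type u} [Category.{v} C] {E M : MorphismProperty C}

/-- A wide pushout of copies of a morphism with left lifting property has that property. -/
lemma llp_head_widePushout [HasColimits C] {A B : C} {e : A ⟶ B} (he : M.llp e) (J : Type v) :
    M.llp (WidePushout.head (fun _ : J => e)) := by
  intro X Y m hm
  refine ⟨fun {f g} sq => ⟨⟨?_⟩⟩⟩
  have := he m hm
  have w (j : J) : f ≫ m = e ≫ WidePushout.ι (fun _ : J => e) j ≫ g := by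
    rw [← Category.assoc]
    exact sq.w.trans (congr_arg (· ≫ g) (WidePushout.arrow_ι (fun _ : J => e) j).symm)
  let l (j : J) := CommSq.lift (CommSq.mk (w j))
  have hl (j : J) : e ≫ l j = f := CommSq.fac_left _
  have hr (j : J) : l j ≫ m = WidePushout.ι (fun _ : J => e) j ≫ g := CommSq.fac_right _
  refine ⟨WidePushout.desc f l hl, WidePushout.head_desc _ f l hl, ?_⟩
  apply WidePushout.hom_ext
  · intro j
    rw [← Category.assoc, WidePushout.ι_desc, hr]
  · rw [← Category.assoc, WidePushout.head_desc, sq.w]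

/-- The left class of a well-copowered weak factorization system consists of epimorphisms. -/
lemma IsWellCopowered.epi [HasColimits C] (hE : IsWellCopowered E)
    (hEM : E.IsWeakFactorizationSystem M) {A B : C} (e : A ⟶ B) (he : E e) : Epi e := by
  classical
  refine ⟨fun {Z} a b hab => ?_⟩
  by_contra hne
  obtain ⟨ι, Q, q, hQ⟩ := hE A
  -- Cantor's argument: the wide pushout of `Set H` copies of `e` is an E-quotient of `A`, hence
  -- isomorphic to some `Q k`, so its coprojections give a map `Set H → H`. Sending one copy of `B`
  -- by `a` and all the others by `b ≠ a` separates the coprojections, so this map is injective.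
  let H : Type v := Σ k, (B ⟶ Q k)
  have hhead : E (WidePushout.head (fun _ : Set H => e)) := by
    have := hEM.llp
    rw [← this] at he ⊢
    exact llp_head_widePushout he _
  obtain ⟨k, φ, -⟩ := hQ _ hhead
  refine Function.cantor_injective
    (fun s : Set H => (⟨k, WidePushout.ι (fun _ : Set H => e) s ≫ φ.inv⟩ : H)) ?_
  intro s t hst
  by_contra hne'
  have h₁ : WidePushout.ι (fun _ : Set H => e) s = WidePushout.ι (fun _ : Set H => e) t := by
    rw [← cancel_mono φ.inv]
    exact eq_of_heq (Sigma.mk.inj hst).2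
  let f : Set H → (B ⟶ Z) := fun j => if j = s then a else b
  have hf (j : Set H) : e ≫ f j = e ≫ a := by
    dsimp only [f]
    split_ifs
    · rfl
    · exact hab.symm
  have h₂ := congr_arg (· ≫ WidePushout.desc (e ≫ a) f hf) h₁
  rw [WidePushout.ι_desc, WidePushout.ι_desc] at h₂
  refine hne ?_
  simpa only [f, if_true, if_neg (Ne.symm hne')] using h₂

/-- A map from the ordinals to a small type has an unbounded fibre. -/
lemma exists_unbounded_fiber {ι : Type v} (f : Ordinal.{v} → ι) :
    ∃ i, ∀ δ : Ordinal.{v}, ∃ β, δ ≤ β ∧ f β = i := by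
  by_contra! h
  choose δ hδ using h
  exact hδ (f (⨆ i, δ i)) (⨆ i, δ i) (Ordinal.le_iSup δ _) rfl

/-- The `E`-images of a fixed object in the later stages of a transfinite sequence stabilize: for
some stage `b`, they all map to the stage `b`. -/
lemma exists_stable_image (hE : IsWellCopowered E) (hEM : E.IsWeakFactorizationSystem M)
    (Y : Ordinal.{v} ⥤ C) (γ : Ordinal.{v}) :
    ∃ (b : Ordinal.{v}) (hb : γ < b), ∀ (β : Ordinal.{v}) (h : b ≤ β)
      (f : MorphismProperty.MapFactorizationData E M (Y.map (homOfLE (hb.le.trans h)))),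
      ∃ r : f.Z ⟶ Y.obj b, f.i ≫ r = Y.map (homOfLE hb.le) := by
  have := hEM.hasFactorization
  -- The target is max γ β, so that the image of stage γ is defined for every ordinal β.
  let F (β : Ordinal.{v}) := MorphismProperty.factorizationData E M
    (Y.map (homOfLE (le_max_left γ β)))
  obtain ⟨ι, Q, q, hQ⟩ := hE (Y.obj γ)
  choose idx φ hφ using fun β => hQ (F β).i (F β).hi
  obtain ⟨i, hi⟩ := exists_unbounded_fiber idx
  -- The bound is a stage beyond γ at which the isomorphism class of the image is one that recurs at
  -- arbitrarily late stages.
  obtain ⟨b₀, hb₀, rfl⟩ := hi (Order.succ γ)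
  refine ⟨max γ b₀, lt_max_of_lt_right (Order.succ_le_iff.1 hb₀), fun β h f => ?_⟩
  -- Recurrence gives β' ≥ β with the same image as at `b₀`. The given factorization at β maps to
  -- the image at β' by lifting, then to the image at `b₀`, then to that stage.
  obtain ⟨β', hβ', hidx⟩ := hi β
  have hlift : HasLiftingProperty f.i (F β').p := by
    have h : M.llp f.i := hEM.llp.symm ▸ f.hi
    exact h _ (F β').hp
  have sq : CommSq (F β').i f.i (F β').p
      (f.p ≫ Y.map (homOfLE (hβ'.trans (le_max_right γ β')))) := by
    constructor
    rw [(F β').fac, ← Category.assoc, f.fac, ← Y.map_comp]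
    rfl
  -- Equality of the two indices is generalized to a variable so that it can be substituted in the
  -- dependent isomorphisms.
  have key (k : ι) (hk : idx β' = k) (e : Q k ≅ (F b₀).Z) (he : q k ≫ e.hom = (F b₀).i) :
      ∃ t : (F β').Z ⟶ (F b₀).Z, (F β').i ≫ t = (F b₀).i := by
    subst hk
    exact ⟨(φ β').inv ≫ e.hom, by rw [← hφ β', Category.assoc, Iso.hom_inv_id_assoc, he]⟩
  obtain ⟨t, ht⟩ := key _ hidx (φ b₀) (hφ b₀)
  refine ⟨sq.lift ≫ t ≫ (F b₀).p, ?_⟩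
  rw [← Category.assoc, sq.fac_left, ← Category.assoc, ht]
  exact (F b₀).fac

/-- Rapidly growing sequences of ordinals. -/
lemma exists_rapid_sequence {J : Type v} [LinearOrder J] [WellFoundedLT J]
    (f : Ordinal.{v} → Ordinal.{v}) :
    ∃ s : J → Ordinal.{v}, ∀ ξ ξ' : J, ξ < ξ' → f (s ξ) ≤ s ξ' := by
  let s : J → Ordinal.{v} := WellFoundedLT.fix (motive := fun _ => Ordinal.{v})
    (fun ξ ih => ⨆ η : Set.Iio ξ, f (ih η.1 η.2))
  refine ⟨s, fun ξ ξ' h => ?_⟩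
  have : s ξ' = ⨆ η : Set.Iio ξ', f (s η.1) :=
    WellFoundedLT.fix_eq (motive := fun _ => Ordinal.{v})
      (fun ξ ih => ⨆ η : Set.Iio ξ, f (ih η.1 η.2)) ξ'
  rw [this]
  exact Ordinal.le_iSup (fun η : Set.Iio ξ' => f (s η.1)) ⟨ξ, h⟩

end WellCopowered

/-! ### A criterion for convergence -/

section Criterion

variable {D : Type u} [Category.{v} D] {T : D ⥤ D} {τ : 𝟭 D ⟶ T}

universe w w' v''

/-- A free algebra sequence stops at a limit stage that is also the colimit of an interleaving
sequence whose colimit is preserved by the endofunctor. -/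
lemma FreeAlgebraSequence.isIso_x_succ_of_interleaving (P : FreeAlgebraSequence.{v, u, w} T τ)
    {α : Ordinal.{w}} (hα : Order.IsSuccLimit α) {J : Type w'} [LinearOrder J]
    (K : J ⥤ D) (s b : J → Ordinal.{w}) (hsb : ∀ ξ, s ξ ≤ b ξ) (hb : Monotone b)
    (hbα : ∀ ξ, b ξ < α) (hs : ∀ γ < α, ∃ ξ, γ ≤ s ξ)
    (i : ∀ ξ, P.X.obj (s ξ) ⟶ K.obj ξ) (r : ∀ ξ, K.obj ξ ⟶ P.X.obj (b ξ))
    (q : K ⟶ (Functor.const J).obj (P.X.obj α))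
    (hir : ∀ ξ, i ξ ≫ r ξ = P.x (hsb ξ)) (hrq : ∀ ξ, r ξ ≫ P.x (hbα ξ).le = q.app ξ)
    (hKr : ∀ {ξ ξ' : J} (h : ξ ≤ ξ'), K.map (homOfLE h) ≫ r ξ' = r ξ ≫ P.x (hb h))
    (hc : Nonempty (IsColimit (T.mapCocone ⟨P.X.obj α, q⟩))) :
    IsIso (P.x (Order.le_succ α)) := by
  obtain ⟨hc⟩ := hc
  have hsα (ξ : J) : Order.succ (b ξ) ≤ α := Order.succ_le_of_lt (hbα ξ)
  -- These maps form a cocone, and `T` preserves the colimit of `K`, so they glue to a map `T.obj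
  -- (P.X.obj α) ⟶ P.X.obj α`.
  let l (ξ : J) : T.obj (K.obj ξ) ⟶ P.X.obj α := T.map (r ξ) ≫ P.σ (b ξ) ≫ P.x (hsα ξ)
  have hl {ξ ξ' : J} (h : ξ ≤ ξ') : T.map (K.map (homOfLE h)) ≫ l ξ' = l ξ := by
    rw [← Category.assoc, ← T.map_comp, hKr h, T.map_comp, Category.assoc]
    congr 1
    rw [← Category.assoc, P.map_σ, Category.assoc, x_comp]
  obtain ⟨h, hh⟩ : ∃ h : T.obj (P.X.obj α) ⟶ P.X.obj α,
      ∀ ξ, T.map (r ξ ≫ P.x (hbα ξ).le) ≫ h = l ξ := by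
    refine ⟨hc.desc ⟨P.X.obj α, ⟨l, fun ξ ξ' φ => ?_⟩⟩, fun ξ => ?_⟩
    · exact (hl (leOfHom φ)).trans (Category.comp_id _).symm
    · rw [hrq]
      exact hc.fac ⟨P.X.obj α, ⟨l, _⟩⟩ ξ
  have hext {Z : D} {k k' : T.obj (P.X.obj α) ⟶ Z}
      (hk : ∀ ξ, T.map (r ξ ≫ P.x (hbα ξ).le) ≫ k = T.map (r ξ ≫ P.x (hbα ξ).le) ≫ k') :
      k = k' := by
    refine hc.hom_ext fun ξ => ?_
    have := hk ξ
    rw [hrq] at this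
    exact this
  have hx (γ : Ordinal.{w}) (hγ : γ < α) :
      T.map (P.x hγ.le) ≫ h = P.σ γ ≫ P.x (Order.succ_le_of_lt hγ) := by
    -- The transition from γ to α passes through `K.obj ξ`, where the glued map is known.
    obtain ⟨ξ, hξ⟩ := hs γ hγ
    have h₁ : P.x hγ.le = P.x hξ ≫ i ξ ≫ r ξ ≫ P.x (hbα ξ).le := by
      rw [← Category.assoc (i ξ), hir, x_comp, x_comp]
    rw [h₁, T.map_comp, T.map_comp, Category.assoc, Category.assoc, hh, ← Category.assoc,
      ← T.map_comp, ← Category.assoc, ← T.map_comp, Category.assoc, hir, x_comp, ← Category.assoc,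
      P.map_σ, Category.assoc, x_comp]
  refine P.isIso_x_succ h hx ?_ ?_
  · apply P.hom_ext_of_isSuccLimit hα
    intro γ hγ
    rw [← Category.assoc, τ_naturality, Category.assoc, hx γ hγ, P.τ_σ_assoc, x_comp,
      Category.comp_id]
  · refine hext fun ξ => ?_
    rw [← Category.assoc, hh, T.map_comp, Category.assoc, P.map_σ, Category.assoc, Category.assoc,
      x_comp]

end Criterion

/-! ### Convergence over the codomain -/

section OverCodomain

variable {C : Type u} [Category.{v} C]

/-- The morphism of arrows to an identity that is determined by its codomain component. -/
@[simps]
def toIdentity (f : Arrow C) {W : C} (g : f.right ⟶ W) : f ⟶ Arrow.mk (𝟙 W) where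
  left := f.hom ≫ g
  right := g
  w := by simp

/-- Identity arrows are the values of a right adjoint of cod, so mapping into them tests universal
properties on codomains alone. -/
lemma toIdentity_ext {f : Arrow C} {W : C} {a b : f ⟶ Arrow.mk (𝟙 W)} (h : a.right = b.right) :
    a = b := by
  have ha : a.left = f.hom ≫ a.right := (Category.comp_id _).symm.trans a.w
  have hb : b.left = f.hom ≫ b.right := (Category.comp_id _).symm.trans b.w
  ext
  · rw [ha, hb, h]
  · exact h

variable {G : FunctorialFactorization C} (P : FreeAlgebraSequence.{v, max u v, v} G.right G.unit)

namespace FreeAlgebraSequence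

lemma σ_right (β : Ordinal.{v}) : (P.σ β).right = (P.x (Order.le_succ β)).right := by
  rw [← P.τ_σ]
  exact (Category.id_comp _).symm

lemma x_right_comp {γ β α : Ordinal.{v}} (h : γ ≤ β) (h' : β ≤ α) :
    (P.x h).right ≫ (P.x h').right = (P.x (h.trans h')).right := by
  rw [← P.x_comp h h']
  rfl

lemma x_right_self (β : Ordinal.{v}) : (P.x (le_refl β)).right = 𝟙 (P.X.obj β).right := by
  rw [P.x_self]
  rfl

/-- The endofunctor lies over cod. Testing the universal property of `σ` against the identity arrow
of the codomain `W` gives the inverse; uniqueness, tested against the identity of `W'`, gives the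
second equation. -/
lemma isIso_x_succ_right (β : Ordinal.{v}) : IsIso (P.x (Order.le_succ β)).right := by
  let W := (P.X.obj β).right
  let W' := (P.X.obj (Order.succ β)).right
  let g : G.right.obj (P.X.obj β) ⟶ Arrow.mk (𝟙 W) := toIdentity _ (𝟙 W)
  obtain ⟨k, hk⟩ := P.exists_desc g (fun γ h => toIdentity_ext (by
    change (P.x h.le).right ≫ 𝟙 _ =
      (P.σ γ).right ≫ (P.x (Order.succ_le_of_lt h)).right ≫ 𝟙 _ ≫ 𝟙 _
    rw [P.σ_right]
    refine (Category.comp_id _).trans ?_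
    refine Eq.trans ?_ (congr_arg _ ((congr_arg _ (Category.comp_id _)).trans
      (Category.comp_id _))).symm
    exact (P.x_right_comp _ _).symm))
  have hk' : (P.x (Order.le_succ β)).right ≫ k.right = 𝟙 W := by
    rw [← P.σ_right]
    exact congr_arg Arrow.Hom.right hk
  let φ : Arrow.mk (𝟙 W) ⟶ Arrow.mk (𝟙 W') :=
    Arrow.homMk (P.x (Order.le_succ β)).right (P.x (Order.le_succ β)).right
      ((Category.comp_id _).trans (Category.id_comp _).symm)
  have h : k ≫ φ = toIdentity (P.X.obj (Order.succ β)) (𝟙 W') := by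
    apply P.σ_hom_ext
    rw [← Category.assoc, hk]
    refine toIdentity_ext ?_
    change 𝟙 W ≫ (P.x (Order.le_succ β)).right = (P.σ β).right ≫ 𝟙 W'
    rw [Category.id_comp, Category.comp_id, σ_right]
  exact ⟨k.right, hk', congr_arg Arrow.Hom.right h⟩

/-- At a limit the inverses already found form a cocone to the identity arrow of the first codomain,
and the colimit property produces the next inverse. -/
lemma isIso_x_zero_right (β : Ordinal.{v}) : IsIso (P.x (zero_le : 0 ≤ β)).right := by
  induction β using WellFoundedLT.induction with
  | ind β ih =>
  obtain rfl | ⟨β, rfl⟩ | hβ := Ordinal.zero_or_succ_or_isSuccLimit β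
  · rw [x_right_self]
    infer_instance
  · have := ih β (Order.lt_succ β)
    have := P.isIso_x_succ_right β
    rw [← P.x_right_comp zero_le (Order.le_succ β)]
    infer_instance
  · let W := (P.X.obj 0).right
    let W' := (P.X.obj β).right
    let g (γ : Ordinal.{v}) (hγ : γ < β) : P.X.obj γ ⟶ Arrow.mk (𝟙 W) :=
      haveI := ih γ hγ
      toIdentity _ (inv (P.x (zero_le : 0 ≤ γ)).right)
    obtain ⟨k, hk⟩ := P.exists_desc_of_isSuccLimit hβ g (fun γ γ' h h' => by
      have := ih γ' h'
      have := ih γ (h.trans_lt h')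
      refine toIdentity_ext ?_
      change (P.x h).right ≫ inv (P.x (zero_le : 0 ≤ γ')).right =
        inv (P.x (zero_le : 0 ≤ γ)).right
      rw [IsIso.comp_inv_eq, ← P.x_right_comp zero_le h, IsIso.inv_hom_id_assoc])
    have hkr (γ : Ordinal.{v}) (hγ : γ < β) : (P.x hγ.le).right ≫ k.right = (g γ hγ).right :=
      congr_arg Arrow.Hom.right (hk γ hγ)
    let φ : Arrow.mk (𝟙 W) ⟶ Arrow.mk (𝟙 W') :=
      Arrow.homMk (P.x (zero_le : 0 ≤ β)).right (P.x (zero_le : 0 ≤ β)).right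
        ((Category.comp_id _).trans (Category.id_comp _).symm)
    have h : k ≫ φ = toIdentity (P.X.obj β) (𝟙 W') := by
      apply P.hom_ext_of_isSuccLimit hβ
      intro γ hγ
      have := ih γ hγ
      rw [← Category.assoc, hk γ hγ]
      refine toIdentity_ext ?_
      change inv (P.x (zero_le : 0 ≤ γ)).right ≫ (P.x (zero_le : 0 ≤ β)).right =
        (P.x hγ.le).right ≫ 𝟙 W'
      rw [Category.comp_id, IsIso.inv_comp_eq, x_right_comp]
    refine ⟨k.right, ?_, congr_arg Arrow.Hom.right h⟩
    have h0 : 0 < β := hβ.bot_lt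
    have := ih 0 h0
    refine (hkr 0 h0).trans ?_
    change inv (P.x (zero_le : (0 : Ordinal.{v}) ≤ 0)).right = 𝟙 W
    rw [← IsIso.inv_id]
    congr 1
    exact P.x_right_self 0

lemma isIso_x_right {γ β : Ordinal.{v}} (h : γ ≤ β) : IsIso (P.x h).right := by
  have := P.isIso_x_zero_right γ
  have : IsIso ((P.x (zero_le : 0 ≤ γ)).right ≫ (P.x h).right) := by
    rw [x_right_comp]
    exact P.isIso_x_zero_right β
  exact IsIso.of_isIso_comp_left (P.x (zero_le : 0 ≤ γ)).right _

end FreeAlgebraSequence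

end OverCodomain

/-! ### Convergence -/

section Convergence

variable {C : Type u} [Category.{v} C]
  {G : FunctorialFactorization C} (P : FreeAlgebraSequence.{v, max u v, v} G.right G.unit)
  {E M : MorphismProperty C}

namespace FreeAlgebraSequence

lemma x_left_comp {γ β α : Ordinal.{v}} (h : γ ≤ β) (h' : β ≤ α) :
    (P.x h).left ≫ (P.x h').left = (P.x (h.trans h')).left := by
  rw [← P.x_comp h h']
  rfl

/-- The `E`-images of a stage of the sequence in a fixed later stage `α`, for stages that belong
to a sequence with supremum `α` along which these images stabilize. -/
structure ImageSequence (E M : MorphismProperty C) (J : Type v) [LinearOrder J]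
    (α : Ordinal.{v}) where
  /-- the stages -/
  s : J → Ordinal.{v}
  /-- the stages where the images of the previous ones stabilize -/
  b : J → Ordinal.{v}
  s_le_b : ∀ ξ, s ξ ≤ b ξ
  s_mono : Monotone s
  b_mono : Monotone b
  b_lt : ∀ ξ, b ξ < α
  cofinal : ∀ γ < α, ∃ ξ, γ ≤ s ξ
  /-- the factorizations -/
  F : ∀ ξ, E.MapFactorizationData M (P.x ((s_le_b ξ).trans (b_lt ξ).le)).left
  /-- the stabilization -/
  r : ∀ ξ, (F ξ).Z ⟶ (P.X.obj (b ξ)).left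
  i_r : ∀ ξ, (F ξ).i ≫ r ξ = (P.x (s_le_b ξ)).left

namespace ImageSequence

variable {P} {J : Type v} [LinearOrder J] {α : Ordinal.{v}} (Q : P.ImageSequence E M J α)
  (hEM : E.IsWeakFactorizationSystem M) (hepi : ∀ {A B : C} (e : A ⟶ B), E e → Epi e)

include hepi in
lemma epi_i (ξ : J) : Epi (Q.F ξ).i := hepi _ (Q.F ξ).hi

lemma fac (ξ : J) : (Q.F ξ).i ≫ (Q.F ξ).p =
    (P.x ((Q.s_le_b ξ).trans (Q.b_lt ξ).le)).left := (Q.F ξ).fac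

include hEM in
-- The transition between images is a diagonal filler. As the E-parts are epimorphisms, it is the
-- only one, which gives functoriality and all the compatibilities below.
lemma exists_map {ξ ξ' : J} (h : ξ ≤ ξ') : ∃ l : (Q.F ξ).Z ⟶ (Q.F ξ').Z,
    (Q.F ξ).i ≫ l = (P.x (Q.s_mono h)).left ≫ (Q.F ξ').i := by
  have hl : M.llp (Q.F ξ).i := hEM.llp.symm ▸ (Q.F ξ).hi
  have : HasLiftingProperty (Q.F ξ).i (Q.F ξ').p := hl _ (Q.F ξ').hp
  have sq : CommSq ((P.x (Q.s_mono h)).left ≫ (Q.F ξ').i) (Q.F ξ).i (Q.F ξ').p (Q.F ξ).p := by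
    constructor
    rw [fac, Category.assoc, fac, x_left_comp]
  exact ⟨sq.lift, sq.fac_left⟩

/-- The transition maps of the sequence of images. -/
noncomputable def map {ξ ξ' : J} (h : ξ ≤ ξ') : (Q.F ξ).Z ⟶ (Q.F ξ').Z :=
  (Q.exists_map hEM h).choose

lemma i_map {ξ ξ' : J} (h : ξ ≤ ξ') :
    (Q.F ξ).i ≫ Q.map hEM h = (P.x (Q.s_mono h)).left ≫ (Q.F ξ').i :=
  (Q.exists_map hEM h).choose_spec

include hepi

lemma map_p {ξ ξ' : J} (h : ξ ≤ ξ') : Q.map hEM h ≫ (Q.F ξ').p = (Q.F ξ).p := by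
  have := Q.epi_i hepi ξ
  rw [← cancel_epi (Q.F ξ).i, ← Category.assoc, i_map, Category.assoc, fac, x_left_comp, fac]

lemma r_x (ξ : J) : Q.r ξ ≫ (P.x (Q.b_lt ξ).le).left = (Q.F ξ).p := by
  have := Q.epi_i hepi ξ
  rw [← cancel_epi (Q.F ξ).i, ← Category.assoc, i_r, fac, x_left_comp]

lemma map_r {ξ ξ' : J} (h : ξ ≤ ξ') :
    Q.map hEM h ≫ Q.r ξ' = Q.r ξ ≫ (P.x (Q.b_mono h)).left := by
  have := Q.epi_i hepi ξ
  rw [← cancel_epi (Q.F ξ).i, ← Category.assoc, i_map, Category.assoc, i_r, ← Category.assoc, i_r,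
    x_left_comp, x_left_comp]

/-- The sequence of images as a functor to the slice category. -/
noncomputable def functor : J ⥤ Over (P.X.obj α).right where
  obj ξ := Over.mk ((Q.F ξ).p ≫ (P.X.obj α).hom)
  map φ := Over.homMk (Q.map hEM (leOfHom φ)) (by
    dsimp
    rw [← Category.assoc, map_p _ hEM hepi])
  map_id ξ := by
    ext
    have := Q.epi_i hepi ξ
    change Q.map hEM le_rfl = 𝟙 _
    rw [← cancel_epi (Q.F ξ).i, i_map, Category.comp_id, P.x_self]
    exact Category.id_comp _
  map_comp {ξ ξ' ξ''} φ ψ := by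
    ext
    have := Q.epi_i hepi ξ
    change Q.map hEM (leOfHom (φ ≫ ψ)) = Q.map hEM (leOfHom φ) ≫ Q.map hEM (leOfHom ψ)
    rw [← cancel_epi (Q.F ξ).i, i_map, ← Category.assoc, i_map, Category.assoc, i_map,
      ← Category.assoc, x_left_comp]

/-- The cocone of images over the stage `α`. -/
noncomputable def cocone : Cocone (Q.functor hEM hepi) where
  pt := Over.mk (P.X.obj α).hom
  ι :=
    { app ξ := Over.homMk (Q.F ξ).p
      naturality ξ ξ' φ := by
        ext
        exact (Q.map_p hEM hepi (leOfHom φ)).trans (Category.comp_id _).symm }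

/-- A cocone on the images restricts along their E-parts to a cofinal family of stages, hence to a
cocone on all stages below α, whose colimit is X_α. The codomain component is the identity because
the transitions are invertible on codomains. -/
lemma exists_desc (hα : Order.IsSuccLimit α) (t : Cocone (Q.functor hEM hepi)) :
    ∃ k : P.X.obj α ⟶ Arrow.mk t.pt.hom, k.right = 𝟙 (P.X.obj α).right ∧
      ∀ ξ, (Q.F ξ).p ≫ k.left = (t.ι.app ξ).left := by
  let l (ξ : J) : (Q.F ξ).Z ⟶ t.pt.left := (t.ι.app ξ).left
  have hlw (ξ : J) : l ξ ≫ t.pt.hom = (Q.F ξ).p ≫ (P.X.obj α).hom := Over.w (t.ι.app ξ)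
  have hl {ξ ξ' : J} (h : ξ ≤ ξ') : Q.map hEM h ≫ l ξ' = l ξ :=
    congr_arg CommaMorphism.left (t.w (homOfLE h))
  have hind {γ : Ordinal.{v}} {ξ ξ' : J} (h : γ ≤ Q.s ξ) (h' : γ ≤ Q.s ξ') :
      (P.x h).left ≫ (Q.F ξ).i ≫ l ξ = (P.x h').left ≫ (Q.F ξ').i ≫ l ξ' := by
    wlog hξ : ξ ≤ ξ' generalizing ξ ξ'
    · exact (this h' h (le_of_not_ge hξ)).symm
    rw [← hl hξ, ← Category.assoc (Q.F ξ).i, i_map, Category.assoc, ← Category.assoc, x_left_comp]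
  -- By `hind` the leg at γ does not depend on the index chosen beyond γ.
  choose ξ hξ using Q.cofinal
  let g (γ : Ordinal.{v}) (hγ : γ < α) : P.X.obj γ ⟶ Arrow.mk t.pt.hom :=
    Arrow.homMk ((P.x (hξ γ hγ)).left ≫ (Q.F (ξ γ hγ)).i ≫ l (ξ γ hγ)) (P.x hγ.le).right (by
      refine Eq.trans ?_ (P.x hγ.le).w
      change ((P.x (hξ γ hγ)).left ≫ (Q.F (ξ γ hγ)).i ≫ l (ξ γ hγ)) ≫ t.pt.hom = _
      rw [Category.assoc, Category.assoc, hlw, ← Category.assoc (Q.F _).i, fac, ← Category.assoc,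
        x_left_comp])
  obtain ⟨k, hk⟩ := P.exists_desc_of_isSuccLimit hα g (fun γ γ' h h' => by
    ext
    · change (P.x h).left ≫ (P.x (hξ γ' h')).left ≫ (Q.F _).i ≫ l _ =
        (P.x (hξ γ _)).left ≫ (Q.F _).i ≫ l _
      rw [← Category.assoc, x_left_comp]
      exact hind _ _
    · exact P.x_right_comp _ _)
  refine ⟨k, ?_, fun ζ => ?_⟩
  · have h0 : 0 < α := hα.bot_lt
    have := P.isIso_x_right h0.le
    have h : (P.x h0.le).right ≫ k.right = (P.x h0.le).right :=
      congr_arg Arrow.Hom.right (hk 0 h0)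
    rw [← cancel_epi (P.x h0.le).right]
    exact h.trans (Category.comp_id _).symm
  · have := Q.epi_i hepi ζ
    have hζ : Q.s ζ < α := (Q.s_le_b ζ).trans_lt (Q.b_lt ζ)
    have h : (P.x hζ.le).left ≫ k.left = (P.x (hξ _ hζ)).left ≫ (Q.F _).i ≫ l _ :=
      congr_arg Arrow.Hom.left (hk _ hζ)
    change (Q.F ζ).p ≫ k.left = l ζ
    rw [← cancel_epi (Q.F ζ).i, ← Category.assoc, fac]
    refine h.trans ((hind (hξ _ hζ) le_rfl).trans ?_)
    rw [P.x_self]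
    exact Category.id_comp _

/-- Stages and images interleave below α, so they have the same colimit. A morphism over the fixed
codomain becomes a square with identity codomain component, to which the colimit property of X_α in
the arrow category applies. -/
lemma nonempty_isColimit (hα : Order.IsSuccLimit α) :
    Nonempty (IsColimit (Q.cocone hEM hepi)) := by
  choose k hkr hkl using Q.exists_desc hEM hepi hα
  refine ⟨⟨fun t => Over.homMk (k t).left ?_, fun t ξ => ?_, fun t m hm => ?_⟩⟩
  · have := (k t).w
    rw [hkr] at this
    exact this.trans (Category.comp_id _)
  · ext
    exact hkl t ξ
  · ext
    let m₀ : (P.X.obj α).left ⟶ t.pt.left := m.left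
    let m' : P.X.obj α ⟶ Arrow.mk t.pt.hom :=
      Arrow.homMk m₀ (𝟙 _) ((Over.w m).trans (Category.comp_id _).symm)
    have h : m' = k t := by
      apply P.hom_ext_of_isSuccLimit hα
      intro γ hγ
      obtain ⟨ξ, hξ⟩ := Q.cofinal γ hγ
      have h₁ : (P.x hγ.le).left = (P.x hξ).left ≫ (Q.F ξ).i ≫ (Q.F ξ).p := by
        rw [fac, x_left_comp]
      have h₂ : (Q.F ξ).p ≫ m₀ = (Q.F ξ).p ≫ (k t).left :=
        (congr_arg CommaMorphism.left (hm ξ)).trans (hkl t ξ).symm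
      ext
      · change (P.x hγ.le).left ≫ m₀ = (P.x hγ.le).left ≫ (k t).left
        rw [h₁, Category.assoc, Category.assoc, Category.assoc, Category.assoc, h₂]
      · change (P.x hγ.le).right ≫ 𝟙 _ = (P.x hγ.le).right ≫ (k t).right
        rw [hkr]
    exact congr_arg Arrow.Hom.left h

lemma isIso_x_succ (hα : Order.IsSuccLimit α)
    (hc : Nonempty (IsColimit (G.right.mapCocone
      ((overToArrow _).mapCocone (Q.cocone hEM hepi))))) :
    IsIso (P.x (Order.le_succ α)) := by
  have hinv (ξ : J) : IsIso (P.x (Q.b_lt ξ).le).right := P.isIso_x_right _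
  -- The images lie over the codomain of stage α, so a map from an image back to stage `b ξ` needs
  -- the inverse of the transition on codomains.
  let t (ξ : J) : (P.X.obj α).right ⟶ (P.X.obj (Q.b ξ)).right := inv (P.x (Q.b_lt ξ).le).right
  refine P.isIso_x_succ_of_interleaving hα (Q.functor hEM hepi ⋙ overToArrow _) Q.s Q.b Q.s_le_b
    Q.b_mono Q.b_lt Q.cofinal
    (fun ξ => Arrow.homMk (Q.F ξ).i (P.x ((Q.s_le_b ξ).trans (Q.b_lt ξ).le)).right ?_)
    (fun ξ => Arrow.homMk (Q.r ξ) (t ξ) ?_)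
    ((overToArrow _).mapCocone (Q.cocone hEM hepi)).ι ?_ ?_ ?_ hc
  · refine Eq.trans ?_ (P.x ((Q.s_le_b ξ).trans (Q.b_lt ξ).le)).w
    change (Q.F ξ).i ≫ (Q.F ξ).p ≫ (P.X.obj α).hom = _
    rw [← Category.assoc, fac]
  · change Q.r ξ ≫ (P.X.obj (Q.b ξ)).hom = ((Q.F ξ).p ≫ (P.X.obj α).hom) ≫
      inv (P.x (Q.b_lt ξ).le).right
    rw [IsIso.eq_comp_inv, Category.assoc, ← Q.r_x hepi ξ, Category.assoc]
    congr 1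
    exact (P.x (Q.b_lt ξ).le).w.symm
  · intro ξ
    ext
    · exact Q.i_r ξ
    · change (P.x _).right ≫ inv (P.x (Q.b_lt ξ).le).right = (P.x (Q.s_le_b ξ)).right
      rw [IsIso.comp_inv_eq, x_right_comp]
  · intro ξ
    ext
    · exact Q.r_x hepi ξ
    · exact IsIso.inv_hom_id (P.x (Q.b_lt ξ).le).right
  · intro ξ ξ' h
    ext
    · exact Q.map_r hEM hepi h
    · change 𝟙 (P.X.obj α).right ≫ t ξ' = t ξ ≫ (P.x (Q.b_mono h)).right
      dsimp only [t]
      rw [Category.id_comp, IsIso.eq_inv_comp, IsIso.comp_inv_eq, x_right_comp]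

end ImageSequence

/-- If the endofunctor satisfies Kelly's smallness condition, then the sequence stops. -/
theorem exists_isIso_x_succ [HasColimits C] (hG : KellySmallness G.right) :
    ∃ β, IsIso (P.x (Order.le_succ β)) := by
  obtain ⟨E, M, hEM, hcop, κ, hκ, hpres⟩ := hG
  replace hEM := hEM.isWeakFactorizationSystem
  have := hEM.hasFactorization
  have hepi {A B : C} (e : A ⟶ B) (he : E e) : Epi e := hcop.epi hEM e he
  have hstab (γ : Ordinal.{v}) : ∃ (b : Ordinal.{v}) (hb : γ < b), ∀ (β : Ordinal.{v}) (h : b ≤ β)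
      (f : E.MapFactorizationData M (P.x (hb.le.trans h)).left),
      ∃ r : f.Z ⟶ (P.X.obj b).left, f.i ≫ r = (P.x hb.le).left :=
    exists_stable_image hcop hEM (P.X ⋙ Arrow.leftFunc) γ
  choose b hb hr using hstab
  have := Cardinal.noMaxOrder hκ.aleph0_le
  have : Nonempty κ.ord.ToType := Ordinal.nonempty_toType_iff.2 hκ.ord_pos.ne'
  -- Each term passes the stabilization bounds of all earlier terms, so the images taken in the
  -- supremum map back below it.
  obtain ⟨s, hs⟩ := exists_rapid_sequence (J := κ.ord.ToType) b
  have hs_lt {ξ ξ' : κ.ord.ToType} (h : ξ < ξ') : s ξ < s ξ' := (hb _).trans_le (hs ξ ξ' h)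
  have hs_mono : Monotone s := (show StrictMono s from fun _ _ h => hs_lt h).monotone
  let α : Ordinal.{v} := ⨆ ξ, s ξ
  have hsα (ξ : κ.ord.ToType) : s ξ ≤ α := Ordinal.le_iSup s ξ
  -- There is no last index, so two further terms exist: the first dominates the bound, the second
  -- makes the inequality strict.
  have hbα (ξ : κ.ord.ToType) : b (s ξ) < α := by
    obtain ⟨ξ', h⟩ := exists_gt ξ
    obtain ⟨ξ'', h'⟩ := exists_gt ξ'
    exact (hs _ _ h).trans_lt ((hs_lt h').trans_le (hsα _))
  have hcof (γ : Ordinal.{v}) (hγ : γ < α) : ∃ ξ, γ < s ξ := Ordinal.lt_iSup_iff.1 hγ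
  have hα : Order.IsSuccLimit α := by
    obtain ⟨ξ⟩ := ‹Nonempty κ.ord.ToType›
    rw [Order.isSuccLimit_iff_of_orderBot]
    refine ⟨((bot_le).trans_lt (hbα ξ)).ne', ?_⟩
    refine Order.isSuccPrelimit_of_succ_lt fun γ hγ => ?_
    obtain ⟨ξ, hξ⟩ := hcof γ hγ
    exact (Order.succ_le_of_lt hξ).trans_lt ((hb _).trans (hbα ξ))
  let F (ξ : κ.ord.ToType) : E.MapFactorizationData M
      (P.x ((hb (s ξ)).le.trans (hbα ξ).le)).left :=
    E.factorizationData M _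
  choose r hr' using fun ξ => hr (s ξ) α (hbα ξ).le (F ξ)
  let Q : P.ImageSequence E M κ.ord.ToType α :=
    { s := s
      b ξ := b (s ξ)
      s_le_b ξ := (hb _).le
      s_mono := hs_mono
      b_mono := by
        intro ξ ξ' h
        obtain h | rfl := h.lt_or_eq
        · exact (hs _ _ h).trans (hb _).le
        · exact le_rfl
      b_lt := hbα
      cofinal γ hγ := (hcof γ hγ).imp fun _ h => h.le
      F := F
      r := r
      i_r := hr' }
  refine ⟨α, Q.isIso_x_succ hEM hepi hα ?_⟩
  exact hpres _ (Q.functor hEM hepi) (Q.cocone hEM hepi) (Q.nonempty_isColimit hEM hepi hα)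
    fun ξ => (Q.F ξ).hp

end FreeAlgebraSequence

/-- The free monad sequence of a pointed endofunctor over the codomain that satisfies Kelly's
smallness condition converges. -/
theorem FreeMonadSequence.converges [HasColimits C] (hG : KellySmallness G.right)
    (S : FreeMonadSequence G.right G.unit) : S.Converges := by
  intro A
  obtain ⟨β, hβ⟩ := (S.atObj A).exists_isIso_x_succ hG
  exact ⟨β, fun γ h => (S.atObj A).isIso_x_of_succ hβ γ h⟩

end Convergence

/-! ### Existence of the value -/

section ValueExistence

namespace FreeMonadSequence

section General

variable {D : Type u} [Category.{v} D] {T : D ⥤ D} {τ : 𝟭 D ⟶ T} {S : FreeMonadSequence T τ}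

/-- Transport of the value of a sequence along an isomorphism of pointed endofunctors. -/
def Value.ofIso {F F' : D ⥤ D} {η : 𝟭 D ⟶ F} {η' : 𝟭 D ⟶ F'} (c : S.Value F η) (e : F ≅ F')
    (h : η ≫ e.hom = η') : S.Value F' η' where
  ι := c.ι ≫ (Functor.const _).map e.hom
  isColimit A := by
    obtain ⟨hc⟩ := c.isColimit A
    exact ⟨hc.ofIsoColimit (Cocone.ext (e.app A) fun _ => rfl)⟩
  unit := by
    refine Eq.trans ?_ h
    exact (Category.assoc _ _ _).symm.trans (congr_arg (· ≫ e.hom) c.unit)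

/-- A convergent free monad sequence has a value. -/
lemma Converges.exists_value (hS : S.Converges) :
    ∃ (F : D ⥤ D) (η : 𝟭 D ⟶ F), Nonempty (S.Value F η) := by
  choose β hβ using hS.exists_isEventuallyConstantFrom
  -- At each object the sequence is eventually constant, so its colimit exists although the index
  -- category is large.
  let c (A : D) : ColimitCocone (S.X.flip.obj A) :=
    { cocone := (hβ A).cocone
      isColimit := (hβ A).isColimitCocone }
  exact ⟨_, S.zero.inv ≫ (combineCocones S.X c).ι.app 0,
    ⟨{ ι := (combineCocones S.X c).ι
       isColimit := fun A =>
        ⟨(c A).isColimit.ofIsoColimit (evaluateCombinedCocones S.X c A).symm⟩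
       unit := rfl }⟩⟩

end General

variable {C : Type u} [Category.{v} C] {G : FunctorialFactorization C}
  {S : FreeMonadSequence G.right G.unit}

/-- The unit is the isomorphism onto stage 0, a transition and an invertible leg; transitions are
invertible on codomains. -/
lemma Value.isIso_unit_right {F : Arrow C ⥤ Arrow C} {η : 𝟭 (Arrow C) ⟶ F} (c : S.Value F η)
    (hS : S.Converges) (f : Arrow C) : IsIso (c.unitApp f).right := by
  obtain ⟨β, hβ⟩ := (c.stableCocone hS f).exists_isIso_leg
  have := hβ β le_rfl
  have h : c.unitApp f = (zeroIso f).hom ≫ (S.atObj f).x zero_le ≫ (c.stableCocone hS f).leg β := by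
    rw [(c.stableCocone hS f).x_leg, zeroIso_hom_leg]
  have := (S.atObj f).isIso_x_right (zero_le : 0 ≤ β)
  have h₁ : IsIso (zeroIso (S := S) f).hom.right := inferInstanceAs
    (IsIso (Arrow.rightFunc.map (zeroIso (S := S) f).hom))
  have h₂ : IsIso ((c.stableCocone hS f).leg β).right := inferInstanceAs
    (IsIso (Arrow.rightFunc.map ((c.stableCocone hS f).leg β)))
  rw [h]
  change IsIso ((zeroIso f).hom.right ≫ ((S.atObj f).x zero_le).right ≫
    ((c.stableCocone hS f).leg β).right)
  infer_instance

section Strictify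

variable {F : Arrow C ⥤ Arrow C} (η : 𝟭 (Arrow C) ⟶ F)
  (r : ∀ f : Arrow C, f.right ≅ (F.obj f).right) (hr : ∀ f, (η.app f).right = (r f).hom)

include hr in
lemma codIso_naturality {f g : Arrow C} (φ : f ⟶ g) :
    (F.map φ).right ≫ (r g).inv = (r f).inv ≫ φ.right := by
  have h : φ.right ≫ (η.app g).right = (η.app f).right ≫ (F.map φ).right :=
    congr_arg Arrow.Hom.right (η.naturality φ)
  rw [Iso.comp_inv_eq, Category.assoc, ← hr g, h, hr f, Iso.inv_hom_id_assoc]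

/-- An endofunctor of the arrow category that is pointed by isomorphisms in the codomain
component is the right functor of a functorial factorization. -/
def factorizationOfUnit : FunctorialFactorization C where
  Z := F ⋙ Arrow.leftFunc
  i :=
    { app f := (η.app f).left
      naturality f g φ := congr_arg Arrow.Hom.left (η.naturality φ) }
  p :=
    { app f := (F.obj f).hom ≫ (r f).inv
      naturality f g φ := by
        change (F.map φ).left ≫ (F.obj g).hom ≫ (r g).inv =
          ((F.obj f).hom ≫ (r f).inv) ≫ φ.right
        rw [Category.assoc, ← codIso_naturality η r hr, ← Category.assoc, ← Category.assoc,
          Arrow.w] }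
  fac := by
    ext f
    change (η.app f).left ≫ (F.obj f).hom ≫ (r f).inv = f.hom
    rw [← Category.assoc, Iso.comp_inv_eq, ← hr f]
    exact (η.app f).w
  hi _ := trivial
  hp _ := trivial

/-- The comparison of a pointed endofunctor with the right functor of a factorization. -/
def factorizationOfUnitIso : F ≅ (factorizationOfUnit η r hr).right :=
  NatIso.ofComponents
    (fun f => Arrow.isoMk (Iso.refl (F.obj f).left) (r f).symm (Category.id_comp _))
    (fun {f g} φ => by
      ext
      · exact (Category.comp_id _).trans (Category.id_comp _).symm
      · exact codIso_naturality η r hr φ)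

lemma comp_factorizationOfUnitIso_hom :
    η ≫ (factorizationOfUnitIso η r hr).hom = (factorizationOfUnit η r hr).unit := by
  refine NatTrans.ext (funext fun f => Arrow.hom_ext _ _ ?_ ?_)
  · exact Category.comp_id _
  · exact (congr_arg (· ≫ (r f).inv) (hr f)).trans (Iso.hom_inv_id (r f))

end Strictify

/-- The value of the free monad sequence is the right functor of a functorial factorization. -/
theorem Converges.exists_functorialFactorization (hS : S.Converges) :
    ∃ G' : FunctorialFactorization C, Nonempty (S.Value G'.right G'.unit) := by
  obtain ⟨F, η, ⟨c⟩⟩ := hS.exists_value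
  have h (f : Arrow C) : IsIso (c.unitApp f).right := c.isIso_unit_right hS f
  let r (f : Arrow C) : f.right ≅ (F.obj f).right :=
    { hom := (c.unitApp f).right
      inv := inv (c.unitApp f).right }
  have hr (f : Arrow C) : (η.app f).right = (r f).hom := rfl
  exact ⟨factorizationOfUnit η r hr,
    ⟨c.ofIso (factorizationOfUnitIso η r hr) (comp_factorizationOfUnitIso_hom η r hr)⟩⟩

end FreeMonadSequence

end ValueExistence

/-! ### Algebra structures and their vertical composition -/

section VerticalComposition

variable {C : Type u} [Category.{v} C]

namespace FunctorialFactorization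

variable (G : FunctorialFactorization C)

/-- The middle object of the factorization of `f`. -/
abbrev mid {X Y : C} (f : X ⟶ Y) : C := G.Z.obj (Arrow.mk f)

/-- The left factor of `f`. -/
def lfac {X Y : C} (f : X ⟶ Y) : X ⟶ G.mid f := G.i.app (Arrow.mk f)

/-- The right factor of `f`. -/
def rfac {X Y : C} (f : X ⟶ Y) : G.mid f ⟶ Y := G.p.app (Arrow.mk f)

/-- The functoriality of the middle object. -/
def midMap {X Y X' Y' : C} {f : X ⟶ Y} {g : X' ⟶ Y'} (u : X ⟶ X') (v : Y ⟶ Y')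
    (h : f ≫ v = u ≫ g) : G.mid f ⟶ G.mid g :=
  G.Z.map (Arrow.homMk u v h.symm : Arrow.mk f ⟶ Arrow.mk g)

lemma lfac_rfac {X Y : C} (f : X ⟶ Y) : G.lfac f ≫ G.rfac f = f := G.fac_app (Arrow.mk f)

lemma midMap_id {X Y : C} (f : X ⟶ Y) :
    G.midMap (𝟙 X) (𝟙 Y) ((Category.comp_id f).trans (Category.id_comp f).symm) = 𝟙 (G.mid f) :=
  G.Z.map_id (Arrow.mk f)

section

variable {X Y X' Y' : C} {f : X ⟶ Y} {g : X' ⟶ Y'} {u : X ⟶ X'} {v : Y ⟶ Y'}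

lemma lfac_midMap (h : f ≫ v = u ≫ g) : G.lfac f ≫ G.midMap u v h = u ≫ G.lfac g :=
  (G.i.naturality (Arrow.homMk u v h.symm : Arrow.mk f ⟶ Arrow.mk g)).symm

lemma midMap_rfac (h : f ≫ v = u ≫ g) : G.midMap u v h ≫ G.rfac g = G.rfac f ≫ v :=
  G.p.naturality (Arrow.homMk u v h.symm : Arrow.mk f ⟶ Arrow.mk g)

lemma midMap_comp {X'' Y'' : C} {k : X'' ⟶ Y''} {u' : X' ⟶ X''} {v' : Y' ⟶ Y''}
    (h : f ≫ v = u ≫ g) (h' : g ≫ v' = u' ≫ k) (h'' : f ≫ v ≫ v' = (u ≫ u') ≫ k) :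
    G.midMap (u ≫ u') (v ≫ v') h'' = G.midMap u v h ≫ G.midMap u' v' h' :=
  G.Z.map_comp (Arrow.homMk u v h.symm : Arrow.mk f ⟶ Arrow.mk g)
    (Arrow.homMk u' v' h'.symm : Arrow.mk g ⟶ Arrow.mk k)

end

/-- An algebra structure on `f` for the pointed endofunctor `R` of a functorial factorization. -/
structure AlgStr {X Y : C} (f : X ⟶ Y) where
  /-- the structure map -/
  str : G.mid f ⟶ X
  unit : G.lfac f ≫ str = 𝟙 X
  fac : str ≫ f = G.rfac f

namespace AlgStr

variable {G}

/-- A square between algebras that is a map of algebras. -/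
def IsHom {X Y X' Y' : C} {f : X ⟶ Y} {g : X' ⟶ Y'} (s : G.AlgStr f) (t : G.AlgStr g)
    (u : X ⟶ X') (v : Y ⟶ Y') : Prop :=
  ∃ h : f ≫ v = u ≫ g, G.midMap u v h ≫ t.str = s.str ≫ u

lemma IsHom.refl {X Y : C} {f : X ⟶ Y} (s : G.AlgStr f) : IsHom s s (𝟙 X) (𝟙 Y) :=
  ⟨_, by rw [midMap_id, Category.id_comp, Category.comp_id]⟩

lemma IsHom.comp {X Y X' Y' X'' Y'' : C} {f : X ⟶ Y} {g : X' ⟶ Y'} {k : X'' ⟶ Y''}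
    {s : G.AlgStr f} {t : G.AlgStr g} {r : G.AlgStr k} {u : X ⟶ X'} {v : Y ⟶ Y'}
    {u' : X' ⟶ X''} {v' : Y' ⟶ Y''} (h : IsHom s t u v) (h' : IsHom t r u' v') :
    IsHom s r (u ≫ u') (v ≫ v') := by
  obtain ⟨h₁, h₂⟩ := h
  obtain ⟨h₁', h₂'⟩ := h'
  refine ⟨by rw [← Category.assoc, h₁, Category.assoc, h₁', Category.assoc], ?_⟩
  rw [G.midMap_comp h₁ h₁', Category.assoc, h₂', ← Category.assoc, h₂, Category.assoc]

/-- The algebra structure on an identity. -/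
def id (G : FunctorialFactorization C) (Y : C) : G.AlgStr (𝟙 Y) where
  str := G.rfac (𝟙 Y)
  unit := G.lfac_rfac _
  fac := Category.comp_id _

lemma isHom_id {X Y : C} {f : X ⟶ Y} (s : G.AlgStr f) : IsHom s (id G Y) f (𝟙 Y) :=
  ⟨rfl, (G.midMap_rfac _).trans ((Category.comp_id _).trans s.fac.symm)⟩

end AlgStr

/-- A composition law for the algebra structures on composable morphisms. -/
structure VerticalComposition where
  /-- the composite structure -/
  comp : ∀ {X Y W : C} {f : X ⟶ Y} {g : Y ⟶ W}, G.AlgStr f → G.AlgStr g → G.AlgStr (f ≫ g)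
  isHom_comp : ∀ {X Y W X' Y' W' : C} {f : X ⟶ Y} {g : Y ⟶ W} {f' : X' ⟶ Y'} {g' : Y' ⟶ W'}
    {s : G.AlgStr f} {t : G.AlgStr g} {s' : G.AlgStr f'} {t' : G.AlgStr g'}
    {u : X ⟶ X'} {v : Y ⟶ Y'} {w : W ⟶ W'}, s.IsHom s' u v → t.IsHom t' v w →
    (comp s t).IsHom (comp s' t') u w
  isHom_assoc : ∀ {W X Y Z : C} {f : W ⟶ X} {g : X ⟶ Y} {h : Y ⟶ Z}
    (s : G.AlgStr f) (t : G.AlgStr g) (r : G.AlgStr h),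
    (comp (comp s t) r).IsHom (comp s (comp t r)) (𝟙 W) (𝟙 Z)
  isHom_right : ∀ {X Y W : C} {f : X ⟶ Y} {g : Y ⟶ W} (s : G.AlgStr f) (t : G.AlgStr g),
    (comp s t).IsHom t f (𝟙 W)
  isHom_comp_id : ∀ {X Y : C} {f : X ⟶ Y} (s : G.AlgStr f),
    (comp s (AlgStr.id G Y)).IsHom s (𝟙 X) (𝟙 Y)

/-- Free algebra structures on the right factors of a functorial factorization `G`. -/
structure FreeAlgStr (G₀ G : FunctorialFactorization C) where
  /-- the structure on a right factor -/
  str : ∀ {X Y : C} (f : X ⟶ Y), G₀.AlgStr (G.rfac f)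
  isHom_midMap : ∀ {X Y X' Y' : C} {f : X ⟶ Y} {g : X' ⟶ Y'} {u : X ⟶ X'} {v : Y ⟶ Y'}
    (h : f ≫ v = u ≫ g), (str f).IsHom (str g) (G.midMap u v h) v
  hom_ext : ∀ {X Y X' Y' : C} {f : X ⟶ Y} {g : X' ⟶ Y'} {t : G₀.AlgStr g} {k k' : G.mid f ⟶ X'}
    {v : Y ⟶ Y'}, (str f).IsHom t k v → (str f).IsHom t k' v →
    G.lfac f ≫ k = G.lfac f ≫ k' → k = k'
  exists_lift : ∀ {X Y X' Y' : C} {f : X ⟶ Y} {g : X' ⟶ Y'} (t : G₀.AlgStr g) (u : X ⟶ X')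
    (v : Y ⟶ Y'), f ≫ v = u ≫ g → ∃ k, (str f).IsHom t k v ∧ G.lfac f ≫ k = u

namespace FreeAlgStr

variable {G₀ G : FunctorialFactorization C} (Φ : FreeAlgStr G₀ G) (κ : G₀.VerticalComposition)

/-- The target is the composite algebra of the free ones on `G.lfac f` and on `f`; the
comultiplication is the algebra map over the identity of `Y` that extends `G.lfac (G.lfac f)`. -/
lemma exists_comul {X Y : C} (f : X ⟶ Y) : ∃ k : G.mid f ⟶ G.mid (G.lfac f),
    (Φ.str f).IsHom (κ.comp (Φ.str (G.lfac f)) (Φ.str f)) k (𝟙 Y) ∧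
      G.lfac f ≫ k = G.lfac (G.lfac f) :=
  Φ.exists_lift (κ.comp (Φ.str (G.lfac f)) (Φ.str f)) (G.lfac (G.lfac f)) (𝟙 Y)
    (by rw [← Category.assoc, lfac_rfac, lfac_rfac, Category.comp_id])

/-- The comultiplication induced by the composition of algebras. -/
noncomputable def comul {X Y : C} (f : X ⟶ Y) : G.mid f ⟶ G.mid (G.lfac f) :=
  (Φ.exists_comul κ f).choose

lemma isHom_comul {X Y : C} (f : X ⟶ Y) :
    (Φ.str f).IsHom (κ.comp (Φ.str (G.lfac f)) (Φ.str f)) (Φ.comul κ f) (𝟙 Y) :=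
  (Φ.exists_comul κ f).choose_spec.1

lemma lfac_comul {X Y : C} (f : X ⟶ Y) : G.lfac f ≫ Φ.comul κ f = G.lfac (G.lfac f) :=
  (Φ.exists_comul κ f).choose_spec.2

/-- A variant of `hom_ext` for squares with equal codomain components. -/
lemma hom_ext' {X Y X' Y' : C} {f : X ⟶ Y} {g : X' ⟶ Y'} {t : G₀.AlgStr g} {k k' : G.mid f ⟶ X'}
    {v v' : Y ⟶ Y'} (h : (Φ.str f).IsHom t k v) (h' : (Φ.str f).IsHom t k' v') (hv : v = v')
    (hk : G.lfac f ≫ k = G.lfac f ≫ k') : k = k' := by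
  subst hv
  exact Φ.hom_ext h h' hk

/-- Both sides are algebra maps into a composite algebra, because composition of algebras is
functorial, and they agree on the unit. -/
lemma comul_naturality {X Y X' Y' : C} {f : X ⟶ Y} {g : X' ⟶ Y'} {u : X ⟶ X'} {v : Y ⟶ Y'}
    (h : f ≫ v = u ≫ g) :
    G.midMap u v h ≫ Φ.comul κ g =
      Φ.comul κ f ≫ G.midMap u (G.midMap u v h) (G.lfac_midMap h) := by
  refine Φ.hom_ext' ((Φ.isHom_midMap h).comp (Φ.isHom_comul κ g))
    ((Φ.isHom_comul κ f).comp (κ.isHom_comp (Φ.isHom_midMap (G.lfac_midMap h)) (Φ.isHom_midMap h)))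
    ((Category.comp_id v).trans (Category.id_comp v).symm) ?_
  rw [← Category.assoc, ← Category.assoc, lfac_midMap, lfac_comul, lfac_midMap, Category.assoc,
    lfac_comul]

/-- By `isHom_right` the composite is an endomorphism of the free algebra that fixes the unit. -/
lemma comul_rfac {X Y : C} (f : X ⟶ Y) : Φ.comul κ f ≫ G.rfac (G.lfac f) = 𝟙 (G.mid f) := by
  refine Φ.hom_ext' ((Φ.isHom_comul κ f).comp (κ.isHom_right _ _)) (AlgStr.IsHom.refl (Φ.str f))
    (Category.comp_id _) ?_
  rw [← Category.assoc, lfac_comul, lfac_rfac, Category.comp_id]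

/-- Composing the counit square with the map from `Φ.str f` to the identity algebra, and cancelling
that identity by `isHom_comp_id`, turns the left side into an algebra endomorphism that fixes the
unit. -/
lemma comul_midMap_counit {X Y : C} (f : X ⟶ Y) :
    Φ.comul κ f ≫ G.midMap (𝟙 X) (G.rfac f) ((G.lfac_rfac f).trans (Category.id_comp f).symm) =
      𝟙 (G.mid f) := by
  have h := κ.isHom_comp (Φ.isHom_midMap (f := G.lfac f) (g := f) (u := 𝟙 X) (v := G.rfac f)
    ((G.lfac_rfac f).trans (Category.id_comp f).symm)) (Φ.str f).isHom_id
  refine Φ.hom_ext' (((Φ.isHom_comul κ f).comp h).comp (κ.isHom_comp_id _))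
    (AlgStr.IsHom.refl (Φ.str f)) ?_ ?_ |> fun h' => (Category.comp_id _).symm.trans h'
  · rw [Category.comp_id, Category.comp_id]
  · rw [Category.comp_id, ← Category.assoc, lfac_comul, lfac_midMap, Category.id_comp,
      Category.comp_id]

/-- The two sides land in the two bracketings of a triple composite of free algebras, which
`isHom_assoc` identifies. -/
lemma comul_coassoc {X Y : C} (f : X ⟶ Y)
    (h : G.lfac f ≫ Φ.comul κ f = 𝟙 X ≫ G.lfac (G.lfac f)) :
    Φ.comul κ f ≫ G.midMap (𝟙 X) (Φ.comul κ f) h = Φ.comul κ f ≫ Φ.comul κ (G.lfac f) := by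
  have h₁ := κ.isHom_comp (Φ.isHom_midMap h) (Φ.isHom_comul κ f)
  have h₂ := κ.isHom_comp (Φ.isHom_comul κ (G.lfac f)) (AlgStr.IsHom.refl (Φ.str f))
  have h₃ := (((Φ.isHom_comul κ f).comp h₂).comp (κ.isHom_assoc _ _ _))
  rw [Category.comp_id] at h₃
  refine Φ.hom_ext' ((Φ.isHom_comul κ f).comp h₁) h₃ (Category.comp_id _).symm ?_
  rw [← Category.assoc, ← Category.assoc, lfac_comul, lfac_midMap, lfac_comul, Category.id_comp]

variable {mul : ∀ {X Y : C} (f : X ⟶ Y), G.mid (G.rfac f) ⟶ G.mid f}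
  (hmul : ∀ {X Y : C} (f : X ⟶ Y), (Φ.str (G.rfac f)).IsHom (Φ.str f) (mul f) (𝟙 Y))
  (lfac_mul : ∀ {X Y : C} (f : X ⟶ Y), G.lfac (G.rfac f) ≫ mul f = 𝟙 (G.mid f))

include hmul lfac_mul in
-- The multiplications are algebra maps as well, so both sides are algebra maps from the free
-- algebra on `G.rfac f` to the composite algebra, and both restrict to the comultiplication along
-- the unit.
lemma mul_comul {X Y : C} (f : X ⟶ Y)
    (h₀ : G.lfac (G.rfac f) ≫ mul f = Φ.comul κ f ≫ G.rfac (G.lfac f)) :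
    mul f ≫ Φ.comul κ f =
      Φ.comul κ (G.rfac f) ≫ G.midMap (Φ.comul κ f) (mul f) h₀ ≫ mul (G.lfac f) := by
  have h := κ.isHom_comp ((Φ.isHom_midMap h₀).comp (hmul (G.lfac f)))
    (t := Φ.str (G.rfac f)) (t' := Φ.str f) (w := 𝟙 Y)
    (by rw [Category.comp_id]; exact hmul f)
  refine Φ.hom_ext' ((hmul f).comp (Φ.isHom_comul κ f)) ((Φ.isHom_comul κ _).comp h) rfl ?_
  rw [← Category.assoc, lfac_mul, Category.id_comp, ← Category.assoc, lfac_comul,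
    ← Category.assoc, lfac_midMap, Category.assoc, lfac_mul, Category.comp_id]

end FreeAlgStr

end FunctorialFactorization

end VerticalComposition

/-! ### The algebraic weak factorization system of a free monad -/

section FreeAWFS

variable {C : Type u} [Category.{v} C]

namespace FunctorialFactorization

variable {G₀ G : FunctorialFactorization C}

/-- The algebra of the pointed endofunctor that corresponds to an algebra structure. -/
def AlgStr.hom {X Y : C} {f : X ⟶ Y} (s : G₀.AlgStr f) : G₀.right.obj (Arrow.mk f) ⟶ Arrow.mk f :=
  Arrow.homMk s.str (𝟙 Y) (s.fac.trans (Category.comp_id _).symm)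

lemma AlgStr.unit_hom {X Y : C} {f : X ⟶ Y} (s : G₀.AlgStr f) :
    G₀.unit.app (Arrow.mk f) ≫ s.hom = 𝟙 (Arrow.mk f) :=
  Arrow.hom_ext _ _ s.unit (Category.comp_id _)

/-- The algebra structure that corresponds to an algebra of the pointed endofunctor. -/
def AlgStr.ofHom {X Y : C} {f : X ⟶ Y} (b : G₀.right.obj (Arrow.mk f) ⟶ Arrow.mk f)
    (hb : G₀.unit.app (Arrow.mk f) ≫ b = 𝟙 (Arrow.mk f)) : G₀.AlgStr f where
  str := b.left
  unit := congr_arg Arrow.Hom.left hb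
  fac := by
    have h₁ : b.right = 𝟙 Y := (Category.id_comp _).symm.trans (congr_arg Arrow.Hom.right hb)
    exact Eq.trans b.w ((congr_arg (G₀.rfac f ≫ ·) h₁).trans (Category.comp_id _))

lemma AlgStr.ofHom_hom {X Y : C} {f : X ⟶ Y} (b : G₀.right.obj (Arrow.mk f) ⟶ Arrow.mk f)
    (hb : G₀.unit.app (Arrow.mk f) ≫ b = 𝟙 (Arrow.mk f)) : (AlgStr.ofHom b hb).hom = b :=
  Arrow.hom_ext _ _ rfl
    ((Category.id_comp _).symm.trans (congr_arg Arrow.Hom.right hb)).symm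

lemma AlgStr.isHom_iff {X Y X' Y' : C} {f : X ⟶ Y} {g : X' ⟶ Y'} (s : G₀.AlgStr f)
    (t : G₀.AlgStr g) (φ : Arrow.mk f ⟶ Arrow.mk g) :
    s.IsHom t φ.left φ.right ↔ G₀.right.map φ ≫ t.hom = s.hom ≫ φ := by
  constructor
  · rintro ⟨_, h⟩
    exact Arrow.hom_ext _ _ h ((Category.comp_id _).trans (Category.id_comp _).symm)
  · intro h
    exact ⟨φ.w.symm, congr_arg Arrow.Hom.left h⟩

variable {S : FreeMonadSequence G₀.right G₀.unit} (c : S.Value G.right G.unit) (hS : S.Converges)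

/-- The structure map of the value at an arrow. -/
noncomputable def valueStr {X Y : C} (f : X ⟶ Y) :
    G₀.right.obj (Arrow.mk (G.rfac f)) ⟶ Arrow.mk (G.rfac f) :=
  c.str hS (Arrow.mk f)

lemma unit_valueStr {X Y : C} (f : X ⟶ Y) :
    G₀.unit.app (Arrow.mk (G.rfac f)) ≫ valueStr c hS f = 𝟙 (Arrow.mk (G.rfac f)) :=
  c.unit_str hS (Arrow.mk f)

/-- The square out of a right factor with given components. -/
def rfacHom {X Y X' Y' : C} {f : X ⟶ Y} {g : X' ⟶ Y'} (k : G.mid f ⟶ X') (v : Y ⟶ Y')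
    (h : G.rfac f ≫ v = k ≫ g) : Arrow.mk (G.rfac f) ⟶ Arrow.mk g :=
  Arrow.homMk k v h.symm

lemma isHom_rfacHom {X Y X' Y' : C} {f : X ⟶ Y} {g : X' ⟶ Y'} {t : G₀.AlgStr g}
    {k : G.mid f ⟶ X'} {v : Y ⟶ Y'}
    (h : (AlgStr.ofHom _ (unit_valueStr c hS f)).IsHom t k v) :
    G₀.right.map (rfacHom k v h.choose) ≫ t.hom = valueStr c hS f ≫ rfacHom k v h.choose := by
  have h₁ := ((AlgStr.ofHom _ (unit_valueStr c hS f)).isHom_iff t (rfacHom k v h.choose)).1 h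
  rwa [AlgStr.ofHom_hom] at h₁

/-- The free algebra structures on the right factors of the value. -/
noncomputable def freeAlgStr : FreeAlgStr G₀ G where
  str f := AlgStr.ofHom (valueStr c hS f) (unit_valueStr c hS f)
  isHom_midMap {X Y X' Y' f g u v} h := by
    have h₁ := c.str_naturality hS (Arrow.homMk u v h.symm : Arrow.mk f ⟶ Arrow.mk g)
    refine ((AlgStr.isHom_iff _ _ (rfacHom (G.midMap u v h) v (G.midMap_rfac h).symm)).2 ?_)
    rw [AlgStr.ofHom_hom, AlgStr.ofHom_hom]
    exact h₁
  hom_ext {X Y X' Y' f g t k k' v} h h' hk := by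
    have h₁ := c.str_hom_ext hS (A := Arrow.mk f) t.hom t.unit_hom (isHom_rfacHom c hS h)
      (isHom_rfacHom c hS h') (Arrow.hom_ext _ _ hk rfl)
    exact congr_arg Arrow.Hom.left h₁
  exists_lift {X Y X' Y' f g} t u v h := by
    obtain ⟨k, hk, hk'⟩ := c.exists_lift hS (A := Arrow.mk f) t.hom t.unit_hom
      (Arrow.homMk u v h.symm)
    -- The unit of a right functor has identity codomain component, so the codomain component of the
    -- extension is prescribed.
    have hr : k.right = v :=
      (Category.id_comp k.right).symm.trans (congr_arg Arrow.Hom.right hk')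
    have h₁ := (AlgStr.isHom_iff (AlgStr.ofHom _ (unit_valueStr c hS f)) t k).2 (by
      rw [AlgStr.ofHom_hom]
      exact hk)
    rw [hr] at h₁
    exact ⟨k.left, h₁, congr_arg Arrow.Hom.left hk'⟩

/-- The nontrivial component of the multiplication of the value. -/
noncomputable def valueMul {X Y : C} (f : X ⟶ Y) : G.mid (G.rfac f) ⟶ G.mid f :=
  (c.mulApp hS (Arrow.mk f)).left

lemma mulApp_right {X Y : C} (f : X ⟶ Y) : (c.mulApp hS (Arrow.mk f)).right = 𝟙 Y :=
  (Category.id_comp _).symm.trans (congr_arg Arrow.Hom.right (c.unit_mulApp hS (Arrow.mk f)))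

lemma lfac_valueMul {X Y : C} (f : X ⟶ Y) : G.lfac (G.rfac f) ≫ valueMul c hS f = 𝟙 (G.mid f) :=
  congr_arg Arrow.Hom.left (c.unit_mulApp hS (Arrow.mk f))

lemma isHom_valueMul {X Y : C} (f : X ⟶ Y) :
    ((freeAlgStr c hS).str (G.rfac f)).IsHom ((freeAlgStr c hS).str f) (valueMul c hS f) (𝟙 Y) := by
  let φ : Arrow.mk (G.rfac (G.rfac f)) ⟶ Arrow.mk (G.rfac f) := c.mulApp hS (Arrow.mk f)
  have h := (AlgStr.isHom_iff ((freeAlgStr c hS).str (G.rfac f)) ((freeAlgStr c hS).str f) φ).2 (by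
    refine (congr_arg (G₀.right.map φ ≫ ·) (AlgStr.ofHom_hom _ (unit_valueStr c hS f))).trans
      (Eq.trans ?_ (congr_arg (· ≫ φ) (AlgStr.ofHom_hom _ (unit_valueStr c hS _)).symm))
    exact c.map_mulApp hS (Arrow.mk f))
  rwa [show φ.right = 𝟙 Y from mulApp_right c hS f] at h

variable (κ : G₀.VerticalComposition)

/-- The algebraic weak factorization system on the value of a convergent free monad sequence. -/
noncomputable def valueAWFS : G.AWFS where
  δ :=
    { app f := Arrow.homMk (𝟙 f.left) ((freeAlgStr c hS).comul κ f.hom)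
        ((Category.id_comp _).trans ((freeAlgStr c hS).lfac_comul κ f.hom).symm)
      naturality _ _ φ := Arrow.hom_ext _ _ ((Category.comp_id _).trans (Category.id_comp _).symm)
        ((freeAlgStr c hS).comul_naturality κ φ.w.symm) }
  μ := c.mul hS
  coassoc f := Arrow.hom_ext _ _ rfl ((freeAlgStr c hS).comul_coassoc κ f.hom
    (((freeAlgStr c hS).lfac_comul κ f.hom).trans (Category.id_comp _).symm))
  left_counit f := Arrow.hom_ext _ _ (Category.comp_id _) ((freeAlgStr c hS).comul_rfac κ f.hom)
  right_counit f := Arrow.hom_ext _ _ (Category.comp_id _)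
    ((freeAlgStr c hS).comul_midMap_counit κ f.hom)
  assoc f := c.mulApp_assoc hS f
  left_unit f := c.unit_mulApp hS f
  right_unit f := c.map_unit_mulApp hS f
  distributive f := (freeAlgStr c hS).mul_comul κ (isHom_valueMul c hS) (lfac_valueMul c hS) f.hom
    ((lfac_valueMul c hS f.hom).trans ((freeAlgStr c hS).comul_rfac κ f.hom).symm)

lemma valueAWFS_μ : (valueAWFS c hS κ).μ = c.mul hS := rfl

lemma isFreeMonad_valueAWFS :
    IsFreeMonad G₀.unit (valueAWFS c hS κ).monad c.fromGenerator :=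
  FreeMonadSequence.Value.isFreeMonad (valueAWFS c hS κ).monad c hS
    (fun f => congr_app (valueAWFS_μ c hS κ) f)

end FunctorialFactorization

end FreeAWFS

/-! ### The algebras of Cole's factorization -/

section ColeAlgebras

variable {V : Type u'} [Category.{v'} V] [MonoidalCategory V]
  {C : Type u} [Category.{v} C] [EnrichedOrdinaryCategory V C] [Cotensored V C]
  [HasPullbacks C] {I : V} (z : 𝟙_ V ⟶ I)

namespace Cole

/-- The mapping path object of a morphism. -/
noncomputable abbrev path {X Y : C} (f : X ⟶ Y) : C := (mappingPath C z).obj (Arrow.mk f)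

/-- The projection of the mapping path object to the domain. -/
noncomputable def pathFst {X Y : C} (f : X ⟶ Y) : path z f ⟶ X := mappingPathFst z (Arrow.mk f)

/-- The projection of the mapping path object to the paths in the codomain. -/
noncomputable def pathSnd {X Y : C} (f : X ⟶ Y) : path z f ⟶ (cotensorFunctor C I).obj Y :=
  mappingPathSnd z (Arrow.mk f)

variable {z}

/-- The universal property of the mapping path object. -/
noncomputable def pathLift {X Y Z : C} {f : X ⟶ Y} (a : Z ⟶ X)
    (b : Z ⟶ (cotensorFunctor C I).obj Y) (h : a ≫ f = b ≫ cotensorPoint z Y) : Z ⟶ path z f :=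
  pullback.lift a b h

@[simp]
lemma pathLift_fst {X Y Z : C} {f : X ⟶ Y} (a : Z ⟶ X)
    (b : Z ⟶ (cotensorFunctor C I).obj Y) (h : a ≫ f = b ≫ cotensorPoint z Y) :
    pathLift a b h ≫ pathFst z f = a :=
  pullback.lift_fst _ _ _

@[simp]
lemma pathLift_snd {X Y Z : C} {f : X ⟶ Y} (a : Z ⟶ X)
    (b : Z ⟶ (cotensorFunctor C I).obj Y) (h : a ≫ f = b ≫ cotensorPoint z Y) :
    pathLift a b h ≫ pathSnd z f = b :=
  pullback.lift_snd _ _ _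

lemma path_hom_ext {X Y Z : C} {f : X ⟶ Y} {a b : Z ⟶ path z f}
    (h₁ : a ≫ pathFst z f = b ≫ pathFst z f) (h₂ : a ≫ pathSnd z f = b ≫ pathSnd z f) : a = b :=
  pullback.hom_ext h₁ h₂

/-- The functoriality of the mapping path object. -/
noncomputable def pathMap {X Y X' Y' : C} {f : X ⟶ Y} {g : X' ⟶ Y'} (u : X ⟶ X') (v : Y ⟶ Y')
    (h : f ≫ v = u ≫ g) : path z f ⟶ path z g :=
  (mappingPath C z).map (Arrow.homMk u v h.symm : Arrow.mk f ⟶ Arrow.mk g)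

@[simp]
lemma pathMap_fst {X Y X' Y' : C} {f : X ⟶ Y} {g : X' ⟶ Y'} (u : X ⟶ X') (v : Y ⟶ Y')
    (h : f ≫ v = u ≫ g) : pathMap u v h ≫ pathFst z g = pathFst z f ≫ u :=
  mappingPathFst_naturality z (Arrow.homMk u v h.symm : Arrow.mk f ⟶ Arrow.mk g)

@[simp]
lemma pathMap_snd {X Y X' Y' : C} {f : X ⟶ Y} {g : X' ⟶ Y'} (u : X ⟶ X') (v : Y ⟶ Y')
    (h : f ≫ v = u ≫ g) :
    pathMap u v h ≫ pathSnd z g = pathSnd z f ≫ (cotensorFunctor C I).map v :=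
  mappingPathSnd_naturality z (Arrow.homMk u v h.symm : Arrow.mk f ⟶ Arrow.mk g)

lemma pathMap_fst_assoc {X Y X' Y' Z : C} {f : X ⟶ Y} {g : X' ⟶ Y'} (u : X ⟶ X') (v : Y ⟶ Y')
    (h : f ≫ v = u ≫ g) (k : X' ⟶ Z) :
    pathMap u v h ≫ pathFst z g ≫ k = pathFst z f ≫ u ≫ k := by
  rw [← Category.assoc, pathMap_fst, Category.assoc]

/-- A path lifting function for `f`. -/
structure PathLifting (z : 𝟙_ V ⟶ I) {X Y : C} (f : X ⟶ Y) where
  /-- the lifting function -/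
  lift : path z f ⟶ (cotensorFunctor C I).obj X
  lift_point : lift ≫ cotensorPoint z X = pathFst z f
  lift_map : lift ≫ (cotensorFunctor C I).map f = pathSnd z f

namespace PathLifting

/-- The path in the intermediate object obtained by lifting along the second morphism. -/
noncomputable def step {X Y W : C} (f : X ⟶ Y) {g : Y ⟶ W} (t : PathLifting z g) :
    path z (f ≫ g) ⟶ path z f :=
  pathLift (pathFst z _) (pathMap f (𝟙 W) (Category.comp_id _) ≫ t.lift)
    (by rw [Category.assoc, t.lift_point, pathMap_fst])

@[simp]
lemma step_fst {X Y W : C} (f : X ⟶ Y) {g : Y ⟶ W} (t : PathLifting z g) :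
    t.step f ≫ pathFst z f = pathFst z (f ≫ g) := pathLift_fst _ _ _

@[simp]
lemma step_snd {X Y W : C} (f : X ⟶ Y) {g : Y ⟶ W} (t : PathLifting z g) :
    t.step f ≫ pathSnd z f = pathMap f (𝟙 W) (Category.comp_id _) ≫ t.lift := pathLift_snd _ _ _

lemma step_fst_assoc {X Y W Z : C} (f : X ⟶ Y) {g : Y ⟶ W} (t : PathLifting z g) (k : X ⟶ Z) :
    t.step f ≫ pathFst z f ≫ k = pathFst z (f ≫ g) ≫ k := by
  rw [← Category.assoc, step_fst]

/-- The composite of path lifting functions. -/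
@[simps]
noncomputable def comp {X Y W : C} {f : X ⟶ Y} {g : Y ⟶ W} (s : PathLifting z f)
    (t : PathLifting z g) : PathLifting z (f ≫ g) where
  lift := t.step f ≫ s.lift
  lift_point := by rw [Category.assoc, s.lift_point, step_fst]
  lift_map := by
    rw [Functor.map_comp, Category.assoc, ← Category.assoc s.lift, s.lift_map, ← Category.assoc,
      step_snd, Category.assoc, t.lift_map, pathMap_snd, (cotensorFunctor C I).map_id,
      Category.comp_id]

/-- A square between path lifting functions that commutes with lifting. -/
def IsHom {X Y X' Y' : C} {f : X ⟶ Y} {g : X' ⟶ Y'} (s : PathLifting z f) (t : PathLifting z g)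
    (u : X ⟶ X') (v : Y ⟶ Y') : Prop :=
  ∃ h : f ≫ v = u ≫ g, pathMap u v h ≫ t.lift = s.lift ≫ (cotensorFunctor C I).map u

/-- Both stages of composite lifting are natural: `h₅` treats the lift along the second morphism,
and `h₂` the lift along the first. -/
lemma isHom_comp {X Y W X' Y' W' : C} {f : X ⟶ Y} {g : Y ⟶ W} {f' : X' ⟶ Y'} {g' : Y' ⟶ W'}
    {s : PathLifting z f} {t : PathLifting z g} {s' : PathLifting z f'} {t' : PathLifting z g'}
    {u : X ⟶ X'} {v : Y ⟶ Y'} {w : W ⟶ W'} (h : s.IsHom s' u v) (h' : t.IsHom t' v w) :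
    (s.comp t).IsHom (s'.comp t') u w := by
  obtain ⟨h₁, h₂⟩ := h
  obtain ⟨h₁', h₂'⟩ := h'
  have h₃ : (f ≫ g) ≫ w = u ≫ f' ≫ g' := by
    rw [Category.assoc, h₁', ← Category.assoc, h₁, Category.assoc]
  have h₄ : pathMap (z := z) u w h₃ ≫ pathMap f' (𝟙 W') (Category.comp_id _) =
      pathMap f (𝟙 W) (Category.comp_id _) ≫ pathMap v w h₁' := by
    apply path_hom_ext
    · simp only [Category.assoc, pathMap_fst]
      rw [← Category.assoc, pathMap_fst, ← Category.assoc, pathMap_fst, Category.assoc,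
        Category.assoc, h₁]
    · simp only [Category.assoc, pathMap_snd]
      rw [← Category.assoc, pathMap_snd, ← Category.assoc, pathMap_snd]
      simp
  have h₅ : pathMap u w h₃ ≫ t'.step f' = t.step f ≫ pathMap u v h₁ := by
    apply path_hom_ext
    · rw [Category.assoc, step_fst, pathMap_fst, Category.assoc, pathMap_fst, ← Category.assoc,
        step_fst]
    · rw [Category.assoc, step_snd, ← Category.assoc, h₄, Category.assoc, h₂', Category.assoc,
        pathMap_snd, ← Category.assoc, ← Category.assoc, step_snd]
  refine ⟨h₃, ?_⟩
  rw [comp_lift, comp_lift, ← Category.assoc, h₅, Category.assoc, h₂, Category.assoc]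

lemma isHom_right {X Y W : C} {f : X ⟶ Y} {g : Y ⟶ W} (s : PathLifting z f)
    (t : PathLifting z g) : (s.comp t).IsHom t f (𝟙 W) :=
  ⟨Category.comp_id _, by rw [comp_lift, Category.assoc, s.lift_map, step_snd]⟩

/-- Either bracketing lifts a path along `h`, then `g`, then `f`. The equations `h₁`, `h₂`, `h₃`
compare the intermediate paths in this order. -/
lemma isHom_assoc {W X Y Z : C} {f : W ⟶ X} {g : X ⟶ Y} {h : Y ⟶ Z}
    (s : PathLifting z f) (t : PathLifting z g) (r : PathLifting z h) :
    ((s.comp t).comp r).IsHom (s.comp (t.comp r)) (𝟙 W) (𝟙 Z) := by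
  have h₀ : ((f ≫ g) ≫ h) ≫ 𝟙 Z = 𝟙 W ≫ f ≫ g ≫ h := by simp
  have h₁ : pathMap (z := z) (𝟙 W) (𝟙 Z) h₀ ≫ pathMap f (𝟙 Z) (Category.comp_id _) ≫
      pathMap g (𝟙 Z) (Category.comp_id _) = pathMap (f ≫ g) (𝟙 Z) (Category.comp_id _) := by
    apply path_hom_ext
    · simp only [Category.assoc, pathMap_fst, pathMap_fst_assoc, Category.id_comp]
    · simp only [Category.assoc, pathMap_snd, CategoryTheory.Functor.map_id, Category.comp_id]
  have h₂ : pathMap (z := z) (𝟙 W) (𝟙 Z) h₀ ≫ pathMap f (𝟙 Z) (Category.comp_id _) ≫ r.step g =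
      r.step (f ≫ g) ≫ pathMap f (𝟙 Y) (Category.comp_id _) := by
    apply path_hom_ext
    · simp only [Category.assoc, step_fst, step_fst_assoc, pathMap_fst, pathMap_fst_assoc,
        Category.id_comp]
    · have h₃ := congr_arg (· ≫ r.lift) h₁
      simp only [Category.assoc] at h₃
      simp only [Category.assoc, step_snd, pathMap_snd, CategoryTheory.Functor.map_id,
        Category.comp_id]
      exact h₃
  have h₃ : pathMap (𝟙 W) (𝟙 Z) h₀ ≫ (t.comp r).step f = r.step (f ≫ g) ≫ t.step f := by
    apply path_hom_ext
    · simp only [Category.assoc, step_fst, pathMap_fst, Category.comp_id]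
    · have h₄ := congr_arg (· ≫ t.lift) h₂
      simp only [Category.assoc] at h₄
      simp only [Category.assoc, step_snd, comp_lift]
      exact h₄
  refine ⟨h₀, ?_⟩
  rw [comp_lift, comp_lift, comp_lift, ← Category.assoc, h₃, CategoryTheory.Functor.map_id]
  exact (Category.assoc _ _ _).trans (Category.comp_id _).symm

/-- A lifting function for the identity that returns the given path makes the first step of the
composite lifting trivial. -/
lemma isHom_comp_of_lift_eq {X Y : C} {f : X ⟶ Y} (s : PathLifting z f)
    (t : PathLifting z (𝟙 Y)) (ht : t.lift = pathSnd z (𝟙 Y)) :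
    (s.comp t).IsHom s (𝟙 X) (𝟙 Y) := by
  have h₀ : (f ≫ 𝟙 Y) ≫ 𝟙 Y = 𝟙 X ≫ f := by simp
  have h₁ : pathMap (𝟙 X) (𝟙 Y) h₀ = t.step f := by
    apply path_hom_ext
    · simp only [step_fst, pathMap_fst, Category.comp_id]
    · simp only [step_snd, pathMap_snd, ht]
  exact ⟨h₀, by
    rw [comp_lift, h₁, CategoryTheory.Functor.map_id]
    exact (Category.comp_id _).symm⟩

end PathLifting

variable [Tensored V C] [HasPushouts C]

open FunctorialFactorization

variable (z) in
/-- The coprojection of the middle object. -/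
noncomputable def cylinderInr {X Y : C} (f : X ⟶ Y) :
    (tensorFunctor C I).obj (path z f) ⟶ (coleFactorization C z).mid f :=
  coleInr z (Arrow.mk f)

lemma mid_hom_ext {X Y Z : C} {f : X ⟶ Y} {a b : (coleFactorization C z).mid f ⟶ Z}
    (h₁ : (coleFactorization C z).lfac f ≫ a = (coleFactorization C z).lfac f ≫ b)
    (h₂ : cylinderInr z f ≫ a = cylinderInr z f ≫ b) : a = b :=
  coleObj_hom_ext z h₁ h₂

lemma mid_condition {X Y : C} (f : X ⟶ Y) : pathFst z f ≫ (coleFactorization C z).lfac f =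
    tensorPoint z (path z f) ≫ cylinderInr z f :=
  pushout.condition

/-- Morphisms out of the middle object. -/
noncomputable def midDesc {X Y Z : C} {f : X ⟶ Y} (a : X ⟶ Z)
    (b : path z f ⟶ (cotensorFunctor C I).obj Z) (h : b ≫ cotensorPoint z Z = pathFst z f ≫ a) :
    (coleFactorization C z).mid f ⟶ Z :=
  pushout.desc a (adjunct I _ _ b) (h.symm.trans (tensorPoint_adjunct z b).symm)

lemma lfac_midDesc {X Y Z : C} {f : X ⟶ Y} (a : X ⟶ Z)
    (b : path z f ⟶ (cotensorFunctor C I).obj Z) (h : b ≫ cotensorPoint z Z = pathFst z f ≫ a) :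
    (coleFactorization C z).lfac f ≫ midDesc a b h = a :=
  pushout.inl_desc _ _ _

lemma cylinderInr_midDesc {X Y Z : C} {f : X ⟶ Y} (a : X ⟶ Z)
    (b : path z f ⟶ (cotensorFunctor C I).obj Z) (h : b ≫ cotensorPoint z Z = pathFst z f ≫ a) :
    cylinderInr z f ≫ midDesc a b h = adjunct I _ _ b :=
  pushout.inr_desc _ _ _

lemma cylinderInr_rfac {X Y : C} (f : X ⟶ Y) :
    cylinderInr z f ≫ (coleFactorization C z).rfac f = adjunct I _ _ (pathSnd z f) :=
  coleInr_desc z (Arrow.mk f)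

lemma cylinderInr_midMap {X Y X' Y' : C} {f : X ⟶ Y} {g : X' ⟶ Y'} {u : X ⟶ X'} {v : Y ⟶ Y'}
    (h : f ≫ v = u ≫ g) :
    cylinderInr z f ≫ (coleFactorization C z).midMap u v h =
      (tensorFunctor C I).map (pathMap u v h) ≫ cylinderInr z g :=
  (coleInr_naturality z (Arrow.homMk u v h.symm : Arrow.mk f ⟶ Arrow.mk g)).symm

/-- The path lifting function of an algebra. -/
noncomputable def toPathLifting {X Y : C} {f : X ⟶ Y} (s : (coleFactorization C z).AlgStr f) :
    PathLifting z f where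
  lift := (adjunct I _ _).symm (cylinderInr z f ≫ s.str)
  lift_point := by
    rw [← tensorPoint_adjunct, Equiv.apply_symm_apply, ← Category.assoc, ← mid_condition,
      Category.assoc, s.unit, Category.comp_id]
  lift_map := by
    apply (adjunct I _ _).injective
    rw [adjunct_comp, Equiv.apply_symm_apply, Category.assoc, s.fac, cylinderInr_rfac]

lemma adjunct_toPathLifting_lift {X Y : C} {f : X ⟶ Y} (s : (coleFactorization C z).AlgStr f) :
    adjunct I _ _ (toPathLifting s).lift = cylinderInr z f ≫ s.str :=
  Equiv.apply_symm_apply _ _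

/-- The algebra of a path lifting function. -/
noncomputable def ofPathLifting {X Y : C} {f : X ⟶ Y} (s : PathLifting z f) :
    (coleFactorization C z).AlgStr f where
  str := midDesc (𝟙 X) s.lift (s.lift_point.trans (Category.comp_id _).symm)
  unit := lfac_midDesc _ _ _
  fac := by
    apply mid_hom_ext
    · rw [← Category.assoc, lfac_midDesc, lfac_rfac, Category.id_comp]
    · rw [← Category.assoc, cylinderInr_midDesc, cylinderInr_rfac, ← adjunct_comp, s.lift_map]

lemma toPathLifting_ofPathLifting {X Y : C} {f : X ⟶ Y} (s : PathLifting z f) :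
    toPathLifting (ofPathLifting s) = s := by
  obtain ⟨l, h, h'⟩ := s
  simp only [toPathLifting, ofPathLifting, cylinderInr_midDesc, Equiv.symm_apply_apply]

/-- The algebra equation lives on a pushout. On the summand `X` it follows from the unit laws; on
the cylinder it is the transpose of the path lifting equation. -/
lemma isHom_iff {X Y X' Y' : C} {f : X ⟶ Y} {g : X' ⟶ Y'} (s : (coleFactorization C z).AlgStr f)
    (t : (coleFactorization C z).AlgStr g) (u : X ⟶ X') (v : Y ⟶ Y') :
    s.IsHom t u v ↔ (toPathLifting s).IsHom (toPathLifting t) u v := by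
  refine exists_congr fun h => ?_
  rw [← (adjunct I _ _).injective.eq_iff, comp_adjunct, adjunct_comp, adjunct_toPathLifting_lift,
    adjunct_toPathLifting_lift, ← Category.assoc, ← cylinderInr_midMap]
  constructor
  · intro h'
    rw [Category.assoc, h', Category.assoc]
  · intro h'
    apply mid_hom_ext
    · rw [← Category.assoc, lfac_midMap, Category.assoc, t.unit, ← Category.assoc, s.unit,
        Category.comp_id, Category.id_comp]
    · rw [← Category.assoc, h', Category.assoc]

variable (C z) in
/-- The composition of algebras of Cole's factorization. -/
noncomputable def verticalComposition : (coleFactorization C z).VerticalComposition where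
  comp s t := ofPathLifting ((toPathLifting s).comp (toPathLifting t))
  isHom_comp h h' := by
    rw [isHom_iff] at h h' ⊢
    rw [toPathLifting_ofPathLifting, toPathLifting_ofPathLifting]
    exact PathLifting.isHom_comp h h'
  isHom_assoc s t r := by
    rw [isHom_iff]
    simp only [toPathLifting_ofPathLifting]
    exact PathLifting.isHom_assoc _ _ _
  isHom_right s t := by
    rw [isHom_iff, toPathLifting_ofPathLifting]
    exact PathLifting.isHom_right _ _
  isHom_comp_id {X Y f} s := by
    rw [isHom_iff, toPathLifting_ofPathLifting]
    refine PathLifting.isHom_comp_of_lift_eq _ _ ?_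
    -- The identity algebra has the right factor as its structure map, and the cylinder part of that
    -- is the transpose of `pathSnd`.
    apply (adjunct I _ _).injective
    rw [adjunct_toPathLifting_lift]
    exact cylinderInr_rfac (𝟙 Y)

end Cole

end ColeAlgebras

/-! ### Smallness of Cole's factorization -/

section ColeSmallness

/-- The tensor with an object is left adjoint to the cotensor. -/
noncomputable def tensorCotensorAdjunction {V : Type u'} [Category.{v'} V] [MonoidalCategory V]
    (C : Type u) [Category.{v} C] [EnrichedOrdinaryCategory V C] [Cotensored V C] [Tensored V C]
    (K : V) : tensorFunctor C K ⊣ cotensorFunctor C K :=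
  Adjunction.mkOfHomEquiv
    { homEquiv X Y := (adjunct K X Y).symm
      homEquiv_naturality_left_symm u g := comp_adjunct K u g
      homEquiv_naturality_right g u := by
        rw [Equiv.symm_apply_eq, adjunct_comp, Equiv.apply_symm_apply] }

/-- A cocone of arrows whose components are colimit cocones is a colimit cocone. -/
def isColimitOfComponents {C : Type u} [Category.{v} C] {J : Type u'} [Category.{v'} J]
    {X : J ⥤ Arrow C} (s : Cocone X) (hl : IsColimit (Arrow.leftFunc.mapCocone s))
    (hr : IsColimit (Arrow.rightFunc.mapCocone s)) : IsColimit s where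
  desc d := Arrow.homMk (hl.desc (Arrow.leftFunc.mapCocone d))
    (hr.desc (Arrow.rightFunc.mapCocone d)) (hl.hom_ext fun j => by
      have h₁ : (s.ι.app j).left ≫ hl.desc (Arrow.leftFunc.mapCocone d) = (d.ι.app j).left :=
        hl.fac (Arrow.leftFunc.mapCocone d) j
      have h₂ : (s.ι.app j).right ≫ hr.desc (Arrow.rightFunc.mapCocone d) = (d.ι.app j).right :=
        hr.fac (Arrow.rightFunc.mapCocone d) j
      let t : X.obj j ⟶ s.pt := s.ι.app j
      let l : s.pt.left ⟶ d.pt.left := hl.desc (Arrow.leftFunc.mapCocone d)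
      let r : s.pt.right ⟶ d.pt.right := hr.desc (Arrow.rightFunc.mapCocone d)
      change t.left ≫ l ≫ d.pt.hom = t.left ≫ s.pt.hom ≫ r
      rw [Arrow.w_assoc, ← Category.assoc]
      refine (congr_arg (· ≫ d.pt.hom) h₁).trans
        (Eq.trans ?_ (congr_arg ((X.obj j).hom ≫ ·) h₂).symm)
      exact (d.ι.app j).w)
  fac d j := Arrow.hom_ext _ _ (hl.fac (Arrow.leftFunc.mapCocone d) j)
    (hr.fac (Arrow.rightFunc.mapCocone d) j)
  uniq d m h := Arrow.hom_ext _ _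
    (hl.uniq (Arrow.leftFunc.mapCocone d) m.left fun j => congr_arg Arrow.Hom.left (h j))
    (hr.uniq (Arrow.rightFunc.mapCocone d) m.right fun j => congr_arg Arrow.Hom.right (h j))

namespace Cole

variable {V : Type u'} [Category.{v'} V] [MonoidalCategory V]
  {C : Type u} [Category.{v} C] [EnrichedOrdinaryCategory V C] [Cotensored V C]
  [HasPullbacks C] {I : V} (z : 𝟙_ V ⟶ I) [Tensored V C] [HasPushouts C]

/-- The middle object of Cole's factorization preserves the colimits that the domain and the mapping
path object preserve. -/
lemma isColimit_coleObj {J : Type v} [SmallCategory J] {X : J ⥤ Arrow C} (c : Cocone X)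
    (hc : IsColimit (Arrow.leftFunc.mapCocone c)) (hN : IsColimit ((mappingPath C z).mapCocone c)) :
    Nonempty (IsColimit ((coleObj C z).mapCocone c)) := by
  have : PreservesColimits (tensorFunctor C I) :=
    (tensorCotensorAdjunction C I).leftAdjoint_preservesColimits
  have hT : IsColimit ((tensorFunctor C I).mapCocone ((mappingPath C z).mapCocone c)) :=
    isColimitOfPreserves _ hN
  have hcond (f : Arrow C) : mappingPathFst z f ≫ coleInl z f =
    tensorPoint z ((mappingPath C z).obj f) ≫ coleInr z f := pushout.condition
  let leg (j : J) : X.obj j ⟶ c.pt := c.ι.app j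
  let dleg (d : Cocone (X ⋙ coleObj C z)) (j : J) : (coleObj C z).obj (X.obj j) ⟶ d.pt := d.ι.app j
  have dleg_w (d) {i j : J} (φ : i ⟶ j) : (coleObj C z).map (X.map φ) ≫ dleg d j = dleg d i :=
    d.w φ
  have w₁ (d) {i j : J} (φ : i ⟶ j) : (X.map φ).left ≫ coleInl z (X.obj j) ≫ dleg d j =
      coleInl z (X.obj i) ≫ dleg d i := by
    rw [← dleg_w d φ, ← Category.assoc, ← Category.assoc, coleInl_naturality]
  have w₂ (d) {i j : J} (φ : i ⟶ j) : (tensorFunctor C I).map ((mappingPath C z).map (X.map φ)) ≫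
      coleInr z (X.obj j) ≫ dleg d j = coleInr z (X.obj i) ≫ dleg d i := by
    rw [← dleg_w d φ, ← Category.assoc, ← Category.assoc, coleInr_naturality]
  let s₁ (d : Cocone (X ⋙ coleObj C z)) : Cocone (X ⋙ Arrow.leftFunc) :=
    { pt := d.pt
      ι :=
        { app j := coleInl z (X.obj j) ≫ dleg d j
          naturality i j φ := (w₁ d φ).trans (Category.comp_id _).symm } }
  let s₂ (d : Cocone (X ⋙ coleObj C z)) :
      Cocone ((X ⋙ mappingPath C z) ⋙ tensorFunctor C I) :=
    { pt := d.pt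
      ι :=
        { app j := coleInr z (X.obj j) ≫ dleg d j
          naturality i j φ := (w₂ d φ).trans (Category.comp_id _).symm } }
  let a (d : Cocone (X ⋙ coleObj C z)) : c.pt.left ⟶ d.pt := hc.desc (s₁ d)
  let b (d : Cocone (X ⋙ coleObj C z)) :
      (tensorFunctor C I).obj ((mappingPath C z).obj c.pt) ⟶ d.pt := hT.desc (s₂ d)
  have ha (d) (j : J) : (leg j).left ≫ a d = coleInl z (X.obj j) ≫ dleg d j := hc.fac (s₁ d) j
  have hb (d) (j : J) : (tensorFunctor C I).map ((mappingPath C z).map (leg j)) ≫ b d =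
      coleInr z (X.obj j) ≫ dleg d j := hT.fac (s₂ d) j
  have hd (d) : mappingPathFst z c.pt ≫ a d =
      tensorPoint z ((mappingPath C z).obj c.pt) ≫ b d := by
    -- The two maps agree on the corner N of the pushout because they agree on each leg of its
    -- colimit; here preservation by N is used a second time.
    refine hN.hom_ext fun j => ?_
    change (mappingPath C z).map (leg j) ≫ mappingPathFst z c.pt ≫ a d =
      (mappingPath C z).map (leg j) ≫ tensorPoint z ((mappingPath C z).obj c.pt) ≫ b d
    rw [← Category.assoc, ← Category.assoc, mappingPathFst_naturality, tensorPoint_naturality,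
      Category.assoc, Category.assoc, hb, ha, ← Category.assoc, hcond, Category.assoc]
  let desc (d : Cocone (X ⋙ coleObj C z)) : (coleObj C z).obj c.pt ⟶ d.pt :=
    pushout.desc (a d) (b d) (hd d)
  have inl_desc (d) : coleInl z c.pt ≫ desc d = a d := pushout.inl_desc _ _ _
  have inr_desc (d) : coleInr z c.pt ≫ desc d = b d := pushout.inr_desc _ _ _
  refine ⟨⟨desc, fun d j => ?_, fun d m hm => ?_⟩⟩
  · change (coleObj C z).map (leg j) ≫ desc d = dleg d j
    apply coleObj_hom_ext
    · rw [← Category.assoc, ← coleInl_naturality, Category.assoc, inl_desc, ha]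
    · rw [← Category.assoc, ← coleInr_naturality, Category.assoc, inr_desc, hb]
  · have hm' (j : J) : (coleObj C z).map (leg j) ≫ m = dleg d j := hm j
    let m' : (coleObj C z).obj c.pt ⟶ d.pt := m
    change m' = desc d
    apply coleObj_hom_ext
    · rw [inl_desc]
      refine hc.uniq (s₁ d) (coleInl z c.pt ≫ m') fun j => ?_
      change (leg j).left ≫ coleInl z c.pt ≫ m' = coleInl z (X.obj j) ≫ dleg d j
      rw [← hm' j, ← Category.assoc, ← Category.assoc, coleInl_naturality]
    · rw [inr_desc]
      refine hT.uniq (s₂ d) (coleInr z c.pt ≫ m') fun j => ?_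
      change (tensorFunctor C I).map ((mappingPath C z).map (leg j)) ≫ coleInr z c.pt ≫ m' =
        coleInr z (X.obj j) ≫ dleg d j
      rw [← hm' j, ← Category.assoc, ← Category.assoc, coleInr_naturality]

/-- The domain component is `isColimit_coleObj`. The codomain component is a constant diagram at `Y`
over a nonempty chain, whose colimit is `Y`. -/
lemma preservesSequentialColimitsOverCod_right [HasColimits C] {M : MorphismProperty C}
    {κ : Cardinal.{v}} (hκ : κ.IsRegular)
    (h : PreservesSequentialColimitsOverCod M κ (mappingPath C z)) :
    PreservesSequentialColimitsOverCod M κ (coleFactorization C z).right := by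
  rintro Y X c ⟨hc⟩ hM
  obtain ⟨hN⟩ := h Y X c ⟨hc⟩ hM
  obtain ⟨hE⟩ := isColimit_coleObj z ((overToArrow Y).mapCocone c)
    (isColimitOfPreserves (Over.forget Y) hc) hN
  have : Nonempty κ.ord.ToType := by
    rw [Ordinal.nonempty_toType_iff]
    exact fun h₀ => hκ.ne_zero (Cardinal.ord_eq_zero.1 h₀)
  let β₀ : κ.ord.ToType := Classical.arbitrary _
  -- A cocone on the constant diagram has equal legs, so any one of them, here at `β₀`, is the
  -- induced map.
  refine ⟨isColimitOfComponents _ hE ⟨fun d => (d.ι.app β₀ : Y ⟶ d.pt), fun d β => ?_,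
    fun d m hm => ?_⟩⟩
  · have hmap {β γ : κ.ord.ToType} (φ : β ⟶ γ) :
        (d.ι.app β : Y ⟶ d.pt) = (d.ι.app γ : Y ⟶ d.pt) :=
      (d.w φ).symm.trans (Category.id_comp (d.ι.app γ : Y ⟶ d.pt))
    refine (Category.id_comp (d.ι.app β₀ : Y ⟶ d.pt)).trans ?_
    rcases le_total β β₀ with h | h
    · exact (hmap (homOfLE h)).symm
    · exact hmap (homOfLE h)
  · exact (Category.id_comp (m : Y ⟶ d.pt)).symm.trans (hm β₀)

end Cole

lemma MonomorphismHypothesis.kellySmallness (P : ObjectProperty TopCat.{v}) [ConvenientSpaces P]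
    (C : Type u) [Category.{v} C] [HasLimits C] [HasColimits C]
    [EnrichedOrdinaryCategory P.FullSubcategory C]
    [Tensored P.FullSubcategory C] [Cotensored P.FullSubcategory C]
    (hC : MonomorphismHypothesis P C) : KellySmallness (coleStepOne P C).right := by
  obtain ⟨E, M, hEM, hE, κ, hκ, h⟩ := hC
  exact ⟨E, M, hEM, hE, κ, hκ, Cole.preservesSequentialColimitsOverCod_right _ hκ h⟩

end ColeSmallness

/-! ### Transfinite sequences indexed by all small ordinals -/

section TransfiniteSequences

universe w

/-- The proper initial segments of the class of small ordinals are small. -/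
lemma hasColimitsOfShape_ordinalIio (K : Type u) [Category.{v} K] [HasColimitsOfSize.{w, w} K]
    (β : Ordinal.{w}) : HasColimitsOfShape (Set.Iio β) K :=
  have : EssentiallySmall.{w} (Set.Iio β) := essentiallySmall_of_small_of_locallySmall _
  hasColimitsOfShape_of_equivalence (equivSmallModel.{w} (Set.Iio β)).symm

lemma preservesColimitsOfShape_ordinalIio {K : Type u} [Category.{v} K] {K' : Type u'}
    [Category.{v'} K'] (F : K ⥤ K') [PreservesColimitsOfSize.{w, w} F] (β : Ordinal.{w}) :
    PreservesColimitsOfShape (Set.Iio β) F :=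
  have : EssentiallySmall.{w} (Set.Iio β) := essentiallySmall_of_small_of_locallySmall _
  preservesColimitsOfShape_of_equiv (equivSmallModel.{w} (Set.Iio β)).symm F

variable {K : Type u} [Category.{v} K] [HasColimitsOfSize.{w, w} K]

/-- A choice of successors in a full subcategory closed under small colimits can be iterated along
all the small ordinals. -/
lemma exists_transfiniteSequence_of_embedding {K' : Type u'} [Category.{v'} K'] (y : K ⥤ K')
    [y.Full] [y.Faithful] [PreservesColimitsOfSize.{w, w} y] [HasIterationOfShape Ordinal.{w} K']
    (X₀ : K) (P : MorphismProperty K) [P.RespectsIso]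
    (hP : ∀ A, ∃ (B : K) (f : A ⟶ B), P f) :
    ∃ X : Ordinal.{w} ⥤ K, Nonempty (X.obj 0 ≅ X₀) ∧
      (∀ β, P (X.map (homOfLE (Order.le_succ β)))) ∧ X.IsWellOrderContinuous := by
  -- The iteration needs a successor for every object of `K'`; outside the essential image the
  -- identity serves as a dummy value.
  have hsucc (A : K') : ∃ (B : K') (f : A ⟶ B), y.essImage A → P.map y f := by
    by_cases hA : y.essImage A
    · obtain ⟨A', ⟨e⟩⟩ := hA
      obtain ⟨B', f', hf'⟩ := hP A'
      exact ⟨_, e.inv ≫ y.map f', fun _ => ⟨_, _, f', hf', ⟨Arrow.isoMk e (Iso.refl _)⟩⟩⟩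
    · exact ⟨A, 𝟙 A, fun h => (hA h).elim⟩
  choose B f hf using hsucc
  let Φ : SmallObject.SuccStruct K' := { X₀ := y.obj X₀, succ := B, toSucc := f }
  let F : Ordinal.{w} ⥤ K' := Φ.iterationFunctor Ordinal.{w}
  have hF (β : Ordinal.{w}) :
      y.essImage (F.obj β) → P.map y (F.map (homOfLE (Order.le_succ β))) := by
    intro h
    have e := Φ.iterationFunctor_map_succ β (not_isMax β)
    change F.map (homOfLE (Order.le_succ β)) = _ at e
    rw [e]
    exact MorphismProperty.RespectsIso.postcomp _ _ _ (hf (F.obj β) h)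
  have hess (β : Ordinal.{w}) : y.essImage (F.obj β) := by
    induction β using WellFoundedLT.induction with
    | ind β ih =>
      rcases Ordinal.zero_or_succ_or_isSuccLimit β with rfl | ⟨γ, rfl⟩ | h
      · exact ⟨X₀, ⟨(Φ.iterationFunctorObjBotIso Ordinal.{w}).symm⟩⟩
      · obtain ⟨_, B', _, _, ⟨e⟩⟩ := hF γ (ih γ (Order.lt_succ γ))
        exact ⟨B', ⟨Arrow.rightFunc.mapIso e⟩⟩
      -- The index category below β is essentially small, so `K` has this colimit and `y` preserves
      -- it; the limit stage remains in the essential image.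
      · have := hasColimitsOfShape_ordinalIio K β
        have := preservesColimitsOfShape_ordinalIio y β
        exact ObjectProperty.prop_of_isColimit _ (F.isColimitOfIsWellOrderContinuous β h)
          fun γ => ih γ.1 γ.2
  let X : Ordinal.{w} ⥤ K := Functor.essImage.liftFunctor F y hess
  let e : X ⋙ y ≅ F := Functor.essImage.liftFunctorCompIso F y hess
  refine ⟨X, ⟨y.preimageIso (e.app 0 ≪≫ Φ.iterationFunctorObjBotIso Ordinal.{w})⟩, fun β => ?_, ?_⟩
  · obtain ⟨_, _, g, hg, ⟨i⟩⟩ := hF β (hess β)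
    let j : Arrow.mk (F.map (homOfLE (Order.le_succ β))) ≅
        Arrow.mk (y.map (X.map (homOfLE (Order.le_succ β)))) :=
      Arrow.isoMk (e.app β).symm (e.app _).symm (e.inv.naturality _).symm
    let k := i ≪≫ j
    have h₁ : y.map (y.preimage k.hom.left) = k.hom.left := y.map_preimage _
    have h₂ : y.map (y.preimage k.hom.right) = k.hom.right := y.map_preimage _
    have h₃ : y.preimage k.hom.left ≫ X.map (homOfLE (Order.le_succ β)) =
        g ≫ y.preimage k.hom.right := y.map_injective (by
      rw [y.map_comp, y.map_comp, h₁, h₂]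
      exact k.hom.w)
    exact (P.arrow_mk_iso_iff (Arrow.isoMk (y.preimageIso (Arrow.leftFunc.mapIso k))
      (y.preimageIso (Arrow.rightFunc.mapIso k)) h₃)).1 hg
  -- A fully faithful functor reflects colimits, so continuity descends from `K'` to `K`.
  · have := Functor.isWellOrderContinuous_of_iso e.symm
    exact ⟨fun β hβ => ⟨isColimitOfReflects y
      ((X ⋙ y).isColimitOfIsWellOrderContinuous β hβ)⟩⟩

/-- In a cocomplete category a choice of successors can be iterated along all the small
ordinals. -/
lemma exists_transfiniteSequence (X₀ : K) (P : MorphismProperty K) [P.RespectsIso]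
    (hP : ∀ A, ∃ (B : K) (f : A ⟶ B), P f) :
    ∃ X : Ordinal.{w} ⥤ K, Nonempty (X.obj 0 ≅ X₀) ∧
      (∀ β, P (X.map (homOfLE (Order.le_succ β)))) ∧ X.IsWellOrderContinuous := by
  -- The opposite of the category of copresheaves has colimits indexed by the class of all small
  -- ordinals, and the Yoneda embedding into it preserves small colimits.
  let y : K ⥤ (K ⥤ Type (max (w + 1) v))ᵒᵖ := uliftCoyoneda.{w + 1}.rightOp
  have : PreservesColimitsOfSize.{w, w} y := preservesColimitsOfSize_rightOp _
  have : HasColimitsOfSize.{w + 1, w + 1} (K ⥤ Type (max (w + 1) v))ᵒᵖ := inferInstance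
  exact exists_transfiniteSequence_of_embedding y X₀ P hP

end TransfiniteSequences

/-! ### The category of partial algebras of an endofunctor -/

section PartialAlgebras

universe w

variable {A : Type u} [Category.{v} A]

/-- A partial algebra of an endofunctor `L`: a morphism `L X ⟶ Y`. -/
structure PartialAlgebra (L : A ⥤ A) where
  /-- the domain -/
  dom : A
  /-- the codomain -/
  cod : A
  /-- the structure map -/
  str : L.obj dom ⟶ cod

namespace PartialAlgebra

variable {L : A ⥤ A}

/-- A morphism of partial algebras. -/
@[ext]
structure Hom (X Y : PartialAlgebra L) where
  /-- the component at the domains -/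
  left : X.dom ⟶ Y.dom
  /-- the component at the codomains -/
  right : X.cod ⟶ Y.cod
  w : L.map left ≫ Y.str = X.str ≫ right

instance : Category (PartialAlgebra L) where
  Hom := Hom
  id X :=
    { left := 𝟙 X.dom
      right := 𝟙 X.cod
      w := by rw [L.map_id, Category.id_comp, Category.comp_id] }
  comp f g :=
    { left := f.left ≫ g.left
      right := f.right ≫ g.right
      w := by rw [L.map_comp, Category.assoc, g.w, ← Category.assoc, f.w, Category.assoc] }
  id_comp _ := Hom.ext (Category.id_comp _) (Category.id_comp _)
  comp_id _ := Hom.ext (Category.comp_id _) (Category.comp_id _)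
  assoc _ _ _ := Hom.ext (Category.assoc _ _ _) (Category.assoc _ _ _)

variable (L) in
/-- The domain functor. -/
def domFunctor : PartialAlgebra L ⥤ A where
  obj X := X.dom
  map f := f.left

variable (L) in
/-- The codomain functor. -/
def codFunctor : PartialAlgebra L ⥤ A where
  obj X := X.cod
  map f := f.right

section Colimits

variable {J : Type w} [Category.{v'} J] [HasColimitsOfShape J A] (F : J ⥤ PartialAlgebra L)

/-- The comparison of the colimit of the structure maps. -/
noncomputable def colimStr :
    colimit ((F ⋙ domFunctor L) ⋙ L) ⟶ colimit (F ⋙ codFunctor L) :=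
  colimMap
    { app j := (F.obj j).str
      naturality _ _ φ := (F.map φ).w }

/-- The legs of the colimit of the domains. -/
noncomputable def domLeg (j : J) : (F.obj j).dom ⟶ colimit (F ⋙ domFunctor L) :=
  colimit.ι (F ⋙ domFunctor L) j

/-- The legs of the colimit of the codomains. -/
noncomputable def codLeg (j : J) : (F.obj j).cod ⟶ colimit (F ⋙ codFunctor L) :=
  colimit.ι (F ⋙ codFunctor L) j

/-- The legs of the colimit of the images of the domains. -/
noncomputable def mapLeg (j : J) : L.obj (F.obj j).dom ⟶ colimit ((F ⋙ domFunctor L) ⋙ L) :=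
  colimit.ι ((F ⋙ domFunctor L) ⋙ L) j

lemma mapLeg_colimStr (j : J) : mapLeg F j ≫ colimStr F = (F.obj j).str ≫ codLeg F j :=
  ι_colimMap _ j

lemma mapLeg_post (j : J) :
    mapLeg F j ≫ colimit.post (F ⋙ domFunctor L) L = L.map (domLeg F j) :=
  colimit.ι_post (F ⋙ domFunctor L) L j

section

variable {F} (s : Cocone F)

/-- The legs of a cocone of partial algebras. -/
def coconeLeg (j : J) : F.obj j ⟶ s.pt := s.ι.app j

/-- The component at the domains of the morphism out of the colimit. -/
noncomputable def domDesc : colimit (F ⋙ domFunctor L) ⟶ s.pt.dom :=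
  colimit.desc (F ⋙ domFunctor L) ((domFunctor L).mapCocone s)

/-- The component at the codomains of the morphism out of the colimit. -/
noncomputable def codDesc : colimit (F ⋙ codFunctor L) ⟶ s.pt.cod :=
  colimit.desc (F ⋙ codFunctor L) ((codFunctor L).mapCocone s)

lemma domLeg_desc (j : J) : domLeg F j ≫ domDesc s = (coconeLeg s j).left :=
  colimit.ι_desc _ _

lemma codLeg_desc (j : J) : codLeg F j ≫ codDesc s = (coconeLeg s j).right :=
  colimit.ι_desc _ _

lemma desc_condition : colimit.post (F ⋙ domFunctor L) L ≫ L.map (domDesc s) ≫ s.pt.str =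
    colimStr F ≫ codDesc s := by
  refine colimit.hom_ext fun j => ?_
  change mapLeg F j ≫ colimit.post (F ⋙ domFunctor L) L ≫ L.map (domDesc s) ≫ s.pt.str =
    mapLeg F j ≫ colimStr F ≫ codDesc s
  rw [← Category.assoc (mapLeg F j), mapLeg_post, ← Category.assoc (mapLeg F j), mapLeg_colimStr,
    Category.assoc, codLeg_desc, ← Category.assoc, ← L.map_comp, domLeg_desc]
  exact (coconeLeg s j).w

end

variable [HasPushouts A]

/-- The colimit of a diagram of partial algebras. -/
noncomputable def colim : PartialAlgebra L where
  dom := colimit (F ⋙ domFunctor L)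
  -- `L` need not preserve the colimit of the domains, so the colimit of the structure maps is
  -- pushed out along the comparison map.
  cod := pushout (colimit.post (F ⋙ domFunctor L) L) (colimStr F)
  str := pushout.inl _ _

/-- The legs of the colimit cocone. -/
noncomputable def colimLeg (j : J) : F.obj j ⟶ colim F where
  left := domLeg F j
  right := codLeg F j ≫ pushout.inr _ _
  w := by
    have h : L.map (domLeg F j) ≫ pushout.inl (colimit.post (F ⋙ domFunctor L) L) (colimStr F) =
        (F.obj j).str ≫ codLeg F j ≫ pushout.inr _ _ := by
      rw [← mapLeg_post, Category.assoc, pushout.condition, ← Category.assoc, mapLeg_colimStr,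
        Category.assoc]
    exact h

/-- The colimit cocone of a diagram of partial algebras. -/
noncomputable def colimCocone : Cocone F where
  pt := colim F
  ι :=
    { app j := colimLeg F j
      naturality i j φ := by
        apply Hom.ext
        · exact (colimit.w (F ⋙ domFunctor L) φ).trans (Category.comp_id _).symm
        · refine Eq.trans ?_ (Category.comp_id _).symm
          exact (Category.assoc _ _ _).symm.trans
            (congr_arg (· ≫ _) (colimit.w (F ⋙ codFunctor L) φ)) }

variable {F} in
/-- The morphism out of the colimit. -/
noncomputable def colimDesc (s : Cocone F) : colim F ⟶ s.pt where
  left := domDesc s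
  right := pushout.desc (L.map (domDesc s) ≫ s.pt.str) (codDesc s) (desc_condition s)
  w := (pushout.inl_desc _ _ _).symm

/-- The universal property of the colimit. -/
noncomputable def isColimitColimCocone : IsColimit (colimCocone F) where
  desc s := colimDesc s
  fac s j := Hom.ext (domLeg_desc s j)
    ((Category.assoc _ _ _).trans ((congr_arg (codLeg F j ≫ ·)
      (pushout.inr_desc _ _ _)).trans (codLeg_desc s j)))
  uniq s m hm := by
    have h : m.left = (colimDesc s).left := colimit.hom_ext fun j =>
      (congr_arg Hom.left (hm j)).trans (domLeg_desc s j).symm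
    refine Hom.ext h (pushout.hom_ext ?_ (colimit.hom_ext fun j => ?_))
    · exact m.w.symm.trans ((congr_arg (fun k => L.map k ≫ s.pt.str) h).trans (colimDesc s).w)
    · refine (Category.assoc _ _ _).symm.trans ((congr_arg Hom.right (hm j)).trans ?_)
      exact ((congr_arg (codLeg F j ≫ ·) (pushout.inr_desc _ _ _)).trans (codLeg_desc s j)).symm

end Colimits

instance hasColimitsOfShape {J : Type w} [Category.{v'} J] [HasColimitsOfShape J A]
    [HasPushouts A] : HasColimitsOfShape J (PartialAlgebra L) where
  has_colimit F := ⟨⟨colimCocone F, isColimitColimCocone F⟩⟩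

instance preservesColimitsOfShape_domFunctor {J : Type w} [Category.{v'} J]
    [HasColimitsOfShape J A] [HasPushouts A] : PreservesColimitsOfShape J (domFunctor L) where
  preservesColimit {F} := preservesColimit_of_preserves_colimit_cocone (isColimitColimCocone F)
    ((colimit.isColimit (F ⋙ domFunctor L)).ofIsoColimit (Cocone.ext (Iso.refl _)
      fun _ => Category.comp_id _))

instance hasColimitsOfSize [HasColimitsOfSize.{w, w} A] :
    HasColimitsOfSize.{w, w} (PartialAlgebra L) :=
  have : HasPushouts A := (hasFiniteColimits_of_hasColimitsOfSize A).out _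
  ⟨fun _ _ => inferInstance⟩

end PartialAlgebra

end PartialAlgebras

/-! ### Existence of free algebra sequences -/

section FreeAlgebraSequenceExistence

universe w

variable {A : Type u} [Category.{v} A] {L : A ⥤ A}

namespace PartialAlgebra

/-- The component at an object of the point of `L`. -/
def pt (lam : 𝟭 A ⟶ L) (X : A) : X ⟶ L.obj X := lam.app X

lemma pt_naturality (lam : 𝟭 A ⟶ L) {X Y : A} (f : X ⟶ Y) : f ≫ pt lam Y = pt lam X ≫ L.map f :=
  lam.naturality f

variable (lam : 𝟭 A ⟶ L)

/-- The successor steps of the free algebra sequence. -/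
def isStep : MorphismProperty (PartialAlgebra L) := fun X Y f =>
  ∃ θ : X.cod ≅ Y.dom, f.left = pt lam X.dom ≫ X.str ≫ θ.hom ∧
    f.right = θ.hom ≫ pt lam Y.dom ≫ Y.str ∧
    ∀ (Z : A) (g : L.obj Y.dom ⟶ Z), L.map f.left ≫ g = X.str ≫ θ.hom ≫ pt lam Y.dom ≫ g →
      ∃! k : Y.cod ⟶ Z, Y.str ≫ k = g

/-- For `X.str` in the role of `σ_β`, the next structure map is the coequalizer of the pair L X_β ⇉
L X_{β+1}. -/
lemma exists_isStep [HasCoequalizers A] (X : PartialAlgebra L) :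
    ∃ (Y : PartialAlgebra L) (f : X ⟶ Y), isStep lam f := by
  let p := L.map (pt lam X.dom ≫ X.str)
  let q := X.str ≫ pt lam X.cod
  refine ⟨{ dom := X.cod, cod := coequalizer p q, str := coequalizer.π p q },
    { left := pt lam X.dom ≫ X.str
      right := pt lam X.cod ≫ coequalizer.π p q
      w := (coequalizer.condition p q).trans (Category.assoc _ _ _) }, Iso.refl _, ?_, ?_, ?_⟩
  · exact (congr_arg (pt lam X.dom ≫ ·) (Category.comp_id X.str)).symm
  · exact (Category.id_comp _).symm
  · intro Z g hg
    have hg' : p ≫ g = q ≫ g := hg.trans (by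
      change X.str ≫ 𝟙 X.cod ≫ pt lam X.cod ≫ g = (X.str ≫ pt lam X.cod) ≫ g
      rw [Category.id_comp, Category.assoc])
    exact ⟨coequalizer.desc g hg', coequalizer.π_desc _ _, fun k hk =>
      coequalizer.hom_ext (hk.trans (coequalizer.π_desc _ _).symm)⟩

/-- The components of an isomorphism of partial algebras at the domains. -/
@[simps]
def domIso {X Y : PartialAlgebra L} (e : X ≅ Y) : X.dom ≅ Y.dom where
  hom := e.hom.left
  inv := e.inv.left
  hom_inv_id := congr_arg Hom.left e.hom_inv_id
  inv_hom_id := congr_arg Hom.left e.inv_hom_id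

/-- The components of an isomorphism of partial algebras at the codomains. -/
@[simps]
def codIso {X Y : PartialAlgebra L} (e : X ≅ Y) : X.cod ≅ Y.cod where
  hom := e.hom.right
  inv := e.inv.right
  hom_inv_id := congr_arg Hom.right e.hom_inv_id
  inv_hom_id := congr_arg Hom.right e.inv_hom_id

lemma comp_left {X Y Z : PartialAlgebra L} (f : X ⟶ Y) (g : Y ⟶ Z) :
    (f ≫ g).left = f.left ≫ g.left := rfl

lemma comp_right {X Y Z : PartialAlgebra L} (f : X ⟶ Y) (g : Y ⟶ Z) :
    (f ≫ g).right = f.right ≫ g.right := rfl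

lemma hom_w {X Y : PartialAlgebra L} (f : X ⟶ Y) : L.map f.left ≫ Y.str = X.str ≫ f.right := f.w

/-- The iteration determines its successor maps only up to isomorphism of arrows, so the notion of a
step must be invariant. -/
instance isStep_respectsIso : (isStep lam).RespectsIso := by
  refine MorphismProperty.RespectsIso.mk _ (fun {X Y Z} e f hf => ?_) (fun {X Y Z} e f hf => ?_)
  · obtain ⟨θ, h₁, h₂, h₃⟩ := hf
    refine ⟨codIso e ≪≫ θ, ?_, ?_, fun W g hg => h₃ W g ?_⟩
    · rw [comp_left, h₁, Iso.trans_hom, codIso_hom, ← Category.assoc, pt_naturality,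
        Category.assoc, ← Category.assoc (L.map _), hom_w, Category.assoc]
    · rw [comp_right, h₂, Iso.trans_hom, codIso_hom, Category.assoc]
    · have : IsIso e.hom.left := (domIso e).isIso_hom
      rw [← cancel_epi (L.map e.hom.left)]
      rw [comp_left, L.map_comp, Category.assoc] at hg
      rw [hg, Iso.trans_hom, codIso_hom, Category.assoc, ← Category.assoc X.str, ← hom_w,
        Category.assoc]
  · obtain ⟨θ, h₁, h₂, h₃⟩ := hf
    have h₄ : (θ ≪≫ domIso e).hom = θ.hom ≫ e.hom.left := rfl
    refine ⟨θ ≪≫ domIso e, ?_, ?_, fun W g hg => ?_⟩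
    · rw [comp_left, h₁, h₄, Category.assoc, Category.assoc]
    · rw [comp_right, h₂, h₄, Category.assoc, Category.assoc, Category.assoc, ← hom_w,
        ← Category.assoc (pt lam Y.dom), ← pt_naturality, Category.assoc]
    · obtain ⟨k, hk, hk'⟩ := h₃ W (L.map e.hom.left ≫ g) (by
        rw [comp_left, L.map_comp, Category.assoc] at hg
        rw [hg, h₄, Category.assoc, ← Category.assoc e.hom.left, pt_naturality, Category.assoc])
      have h₅ : IsIso e.hom.left := (domIso e).isIso_hom
      have h₆ : e.inv.right ≫ e.hom.right = 𝟙 _ := (codIso e).inv_hom_id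
      have h₇ : e.hom.right ≫ e.inv.right = 𝟙 _ := (codIso e).hom_inv_id
      refine ⟨e.inv.right ≫ k, ?_, fun l hl => ?_⟩
      · change Z.str ≫ e.inv.right ≫ k = g
        rw [← cancel_epi (L.map e.hom.left), ← Category.assoc, hom_w, Category.assoc,
          ← Category.assoc e.hom.right, h₇, Category.id_comp, hk]
      · rw [← hk' (e.hom.right ≫ l) (by
          change Y.str ≫ e.hom.right ≫ l = _
          rw [← Category.assoc, ← hom_w, Category.assoc, hl]), ← Category.assoc, h₆,
          Category.id_comp]

section Sequence

variable {lam} (X : Ordinal.{w} ⥤ PartialAlgebra L)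

/-- The transition maps of a sequence of partial algebras. -/
def seqMap {γ β : Ordinal.{w}} (h : γ ≤ β) : X.obj γ ⟶ X.obj β := X.map (homOfLE h)

lemma seqMap_comp {γ β α : Ordinal.{w}} (h : γ ≤ β) (h' : β ≤ α) :
    seqMap X h ≫ seqMap X h' = seqMap X (h.trans h') :=
  (X.map_comp _ _).symm

lemma seqMap_left_comp {γ β α : Ordinal.{w}} (h : γ ≤ β) (h' : β ≤ α) :
    (seqMap X h).left ≫ (seqMap X h').left = (seqMap X (h.trans h')).left :=
  congr_arg Hom.left (seqMap_comp X h h')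

lemma seqMap_right_comp {γ β α : Ordinal.{w}} (h : γ ≤ β) (h' : β ≤ α) :
    (seqMap X h).right ≫ (seqMap X h').right = (seqMap X (h.trans h')).right :=
  congr_arg Hom.right (seqMap_comp X h h')

lemma seqMap_left_self (β : Ordinal.{w}) : (seqMap X (le_refl β)).left = 𝟙 (X.obj β).dom :=
  congr_arg Hom.left (X.map_id β)

lemma seqMap_right_self (β : Ordinal.{w}) : (seqMap X (le_refl β)).right = 𝟙 (X.obj β).cod :=
  congr_arg Hom.right (X.map_id β)

variable {X} (hX : ∀ β, isStep lam (seqMap X (Order.le_succ β)))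

/-- The identification of the codomain of a stage with the domain of the next stage. -/
noncomputable def stepIso (β : Ordinal.{w}) : (X.obj β).cod ≅ (X.obj (Order.succ β)).dom :=
  (hX β).choose

lemma step_left (β : Ordinal.{w}) : (seqMap X (Order.le_succ β)).left =
    pt lam (X.obj β).dom ≫ (X.obj β).str ≫ (stepIso hX β).hom :=
  (hX β).choose_spec.1

lemma step_right (β : Ordinal.{w}) : (seqMap X (Order.le_succ β)).right =
    (stepIso hX β).hom ≫ pt lam (X.obj (Order.succ β)).dom ≫ (X.obj (Order.succ β)).str :=
  (hX β).choose_spec.2.1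

lemma step_universal (β : Ordinal.{w}) {Z : A} (g : L.obj (X.obj (Order.succ β)).dom ⟶ Z)
    (hg : L.map (seqMap X (Order.le_succ β)).left ≫ g =
      (X.obj β).str ≫ (stepIso hX β).hom ≫ pt lam (X.obj (Order.succ β)).dom ≫ g) :
    ∃! k : (X.obj (Order.succ β)).cod ⟶ Z, (X.obj (Order.succ β)).str ≫ k = g :=
  (hX β).choose_spec.2.2 Z g hg

/-- The transition X_{γ+1} ⟶ X_{β+1} factors through X_β and its point; this turns the squares of
the transitions into `σ_condition`. -/
lemma seqMap_right_eq {γ β : Ordinal.{w}} (h : γ < β) : (seqMap X h.le).right =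
    (stepIso hX γ).hom ≫ (seqMap X (Order.succ_le_of_lt h)).left ≫ pt lam (X.obj β).dom ≫
      (X.obj β).str := by
  rw [← seqMap_right_comp X (Order.le_succ γ) (Order.succ_le_of_lt h), step_right hX,
    Category.assoc, Category.assoc, ← hom_w, ← Category.assoc (pt lam _), ← pt_naturality,
    Category.assoc]

lemma seqMap_right_stepIso {γ β : Ordinal.{w}} (h : γ ≤ β) :
    (seqMap X h).right ≫ (stepIso hX β).hom =
      (stepIso hX γ).hom ≫ (seqMap X (Order.succ_le_succ h)).left := by
  rcases h.eq_or_lt with rfl | h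
  · rw [seqMap_right_self, seqMap_left_self, Category.id_comp, Category.comp_id]
  · rw [seqMap_right_eq hX h, Category.assoc, Category.assoc, Category.assoc, ← step_left hX,
      seqMap_left_comp]

lemma seq_condition {γ β : Ordinal.{w}} (h : γ < β) :
    L.map (seqMap X h.le).left ≫ (X.obj β).str = (X.obj γ).str ≫ (stepIso hX γ).hom ≫
      (seqMap X (Order.succ_le_of_lt h)).left ≫ pt lam (X.obj β).dom ≫ (X.obj β).str := by
  rw [hom_w, seqMap_right_eq hX h]

/-- The map `g` is itself a partial algebra on the domain of stage β, and its compatibility makes it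
the vertex of a cocone on the earlier stages. The induced map has identity domain component, since
the domains form a colimit too, and its codomain component is the required factorization. -/
lemma exists_unique_of_isSuccLimit [X.IsWellOrderContinuous]
    [(X ⋙ domFunctor L).IsWellOrderContinuous] {β : Ordinal.{w}} (hβ : Order.IsSuccLimit β) {Z : A}
    (g : L.obj (X.obj β).dom ⟶ Z)
    (hg : ∀ (γ : Ordinal.{w}) (h : γ < β), L.map (seqMap X h.le).left ≫ g =
      (X.obj γ).str ≫ (stepIso hX γ).hom ≫ (seqMap X (Order.succ_le_of_lt h)).left ≫
        pt lam (X.obj β).dom ≫ g) :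
    ∃! k : (X.obj β).cod ⟶ Z, (X.obj β).str ≫ k = g := by
  have hc := X.isColimitOfIsWellOrderContinuous β hβ
  have hd := (X ⋙ domFunctor L).isColimitOfIsWellOrderContinuous β hβ
  let Q : PartialAlgebra L := { dom := (X.obj β).dom, cod := Z, str := g }
  let leg (γ : Ordinal.{w}) (h : γ < β) : X.obj γ ⟶ Q :=
    { left := (seqMap X h.le).left
      right := (stepIso hX γ).hom ≫ (seqMap X (Order.succ_le_of_lt h)).left ≫
        pt lam (X.obj β).dom ≫ g
      w := hg γ h }
  have leg_w {γ δ : Ordinal.{w}} (h : γ ≤ δ) (h' : δ < β) :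
      seqMap X h ≫ leg δ h' = leg γ (h.trans_lt h') := by
    apply Hom.ext
    · exact seqMap_left_comp X h h'.le
    · change (seqMap X h).right ≫ (stepIso hX δ).hom ≫ (seqMap X (Order.succ_le_of_lt h')).left ≫
        pt lam (X.obj β).dom ≫ g = (stepIso hX γ).hom ≫
          (seqMap X (Order.succ_le_of_lt (h.trans_lt h'))).left ≫ pt lam (X.obj β).dom ≫ g
      rw [← Category.assoc, seqMap_right_stepIso, Category.assoc,
        ← Category.assoc (seqMap X _).left, seqMap_left_comp]
  let s : Cocone ((Set.principalSegIio β).monotone.functor ⋙ X) :=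
    { pt := Q
      ι :=
        { app γ := leg γ.1 γ.2
          naturality γ δ φ := (leg_w (leOfHom φ) δ.2).trans (Category.comp_id _).symm } }
  have hext {f f' : X.obj β ⟶ Q} (h : ∀ (γ : Ordinal.{w}) (hγ : γ < β),
      seqMap X hγ.le ≫ f = seqMap X hγ.le ≫ f') : f = f' :=
    hc.hom_ext fun γ => h γ.1 γ.2
  let l : X.obj β ⟶ Q := hc.desc s
  have hl (γ : Ordinal.{w}) (h : γ < β) : seqMap X h.le ≫ l = leg γ h := hc.fac s ⟨γ, h⟩
  have hleft : l.left = 𝟙 (X.obj β).dom := hd.hom_ext fun γ =>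
    (congr_arg Hom.left (hl γ.1 γ.2)).trans (Category.comp_id _).symm
  refine ⟨l.right, ?_, fun k hk => ?_⟩
  · refine (hom_w l).symm.trans ((congr_arg (fun a => L.map a ≫ g) hleft).trans ?_)
    exact (congr_arg (· ≫ g) (L.map_id _)).trans (Category.id_comp g)
  · let m : X.obj β ⟶ Q :=
      { left := 𝟙 _
        right := k
        w := (congr_arg (· ≫ g) (L.map_id _)).trans ((Category.id_comp g).trans hk.symm) }
    refine congr_arg Hom.right (hext (f := m) (f' := l) fun γ h => ?_)
    rw [hl γ h]
    apply Hom.ext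
    · exact Category.comp_id _
    · change (seqMap X h.le).right ≫ k = (stepIso hX γ).hom ≫
        (seqMap X (Order.succ_le_of_lt h)).left ≫ pt lam (X.obj β).dom ≫ g
      rw [seqMap_right_eq hX h, Category.assoc, Category.assoc, Category.assoc, hk]

/-- At 0 there is no condition and the structure map is invertible; at a successor the condition for
the immediate predecessor suffices. -/
lemma exists_unique_of_isIso_zero [X.IsWellOrderContinuous]
    [(X ⋙ domFunctor L).IsWellOrderContinuous] (h₀ : IsIso (X.obj 0).str) (β : Ordinal.{w}) {Z : A}
    (g : L.obj (X.obj β).dom ⟶ Z)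
    (hg : ∀ (γ : Ordinal.{w}) (h : γ < β), L.map (seqMap X h.le).left ≫ g =
      (X.obj γ).str ≫ (stepIso hX γ).hom ≫ (seqMap X (Order.succ_le_of_lt h)).left ≫
        pt lam (X.obj β).dom ≫ g) :
    ∃! k : (X.obj β).cod ⟶ Z, (X.obj β).str ≫ k = g := by
  rcases Ordinal.zero_or_succ_or_isSuccLimit β with rfl | ⟨γ, rfl⟩ | h
  · exact ⟨inv (X.obj 0).str ≫ g, IsIso.hom_inv_id_assoc _ _, fun k hk => by
      rw [← hk, IsIso.inv_hom_id_assoc]⟩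
  · refine step_universal hX γ g ((hg γ (Order.lt_succ γ)).trans ?_)
    rw [seqMap_left_self, Category.id_comp]
  · exact exists_unique_of_isSuccLimit hX h g hg

/-- The free algebra sequence underlying a sequence of partial algebras. -/
noncomputable def freeAlgebraSequence [X.IsWellOrderContinuous]
    [(X ⋙ domFunctor L).IsWellOrderContinuous] (h₀ : IsIso (X.obj 0).str) :
    FreeAlgebraSequence.{v, u, w} L lam where
  X := X ⋙ domFunctor L
  σ β := (X.obj β).str ≫ (stepIso hX β).hom
  unit_σ β := (step_left hX β).symm
  σ_condition γ β h := by
    refine (Category.assoc _ _ _).symm.trans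
      ((congr_arg (· ≫ (stepIso hX β).hom) (seq_condition hX h)).trans ?_)
    change ((X.obj γ).str ≫ (stepIso hX γ).hom ≫
      (seqMap X (Order.succ_le_of_lt h)).left ≫ pt lam (X.obj β).dom ≫ (X.obj β).str) ≫
        (stepIso hX β).hom = ((X.obj γ).str ≫ (stepIso hX γ).hom) ≫
      (seqMap X (Order.succ_le_of_lt h)).left ≫ pt lam (X.obj β).dom ≫ (X.obj β).str ≫
        (stepIso hX β).hom
    simp only [Category.assoc]
  σ_universal β Z g hg := by
    obtain ⟨k, hk, hk'⟩ := exists_unique_of_isIso_zero hX h₀ β g fun γ h =>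
      (hg γ h).trans (Category.assoc _ _ _)
    refine ⟨(stepIso hX β).inv ≫ k, ?_, fun l hl => ?_⟩
    · change ((X.obj β).str ≫ (stepIso hX β).hom) ≫ (stepIso hX β).inv ≫ k = g
      rw [Category.assoc, Iso.hom_inv_id_assoc, hk]
    · exact (Iso.eq_inv_comp (stepIso hX β)).2 (hk' _ ((Category.assoc _ _ _).symm.trans hl))
  continuous := inferInstance

end Sequence

end PartialAlgebra

/-- Free algebra sequences exist in cocomplete categories. -/
theorem exists_freeAlgebraSequence [HasColimitsOfSize.{w, w} A] (lam : 𝟭 A ⟶ L) (X₀ : A) :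
    ∃ S : FreeAlgebraSequence.{v, u, w} L lam, Nonempty (S.X.obj 0 ≅ X₀) := by
  have : HasFiniteColimits A := hasFiniteColimits_of_hasColimitsOfSize A
  obtain ⟨X, ⟨e⟩, hX, _⟩ := exists_transfiniteSequence
    -- Starting from the identity of `L.obj X₀` makes the first stage after `X₀` equal to `L.obj
    -- X₀`, up to isomorphism.
    ({ dom := X₀, cod := L.obj X₀, str := 𝟙 _ } : PartialAlgebra L) (PartialAlgebra.isStep lam)
    (PartialAlgebra.exists_isStep lam)
  have hdom : (X ⋙ PartialAlgebra.domFunctor L).IsWellOrderContinuous := ⟨fun β hβ => by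
    have := hasColimitsOfShape_ordinalIio A β
    exact ⟨isColimitOfPreserves (PartialAlgebra.domFunctor L)
      (X.isColimitOfIsWellOrderContinuous β hβ)⟩⟩
  have h₀ : IsIso (X.obj 0).str := by
    have h : L.map e.hom.left ≫ 𝟙 (L.obj X₀) = (X.obj 0).str ≫ e.hom.right := e.hom.w
    have h₁ : IsIso e.hom.left := (PartialAlgebra.domIso e).isIso_hom
    have h₂ : IsIso e.hom.right := (PartialAlgebra.codIso e).isIso_hom
    have h₃ : IsIso ((X.obj 0).str ≫ e.hom.right) := by
      rw [← h]
      exact IsIso.comp_isIso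
    exact IsIso.of_isIso_comp_right _ e.hom.right
  exact ⟨PartialAlgebra.freeAlgebraSequence hX h₀, ⟨PartialAlgebra.domIso e⟩⟩

end FreeAlgebraSequenceExistence

/-! ### Existence of the free monad sequence -/

section FreeMonadSequenceExistence

variable {D : Type u} [Category.{v} D] {T : D ⥤ D} (τ : 𝟭 D ⟶ T)

/-- Postcomposition with a pointed endofunctor is a pointed endofunctor of the category of
endofunctors. -/
def whiskeringPoint : 𝟭 (D ⥤ D) ⟶ (Functor.whiskeringRight D D D).obj T where
  app F :=
    { app A := τ.app (F.obj A)
      naturality _ _ f := τ.naturality (F.map f) }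
  naturality F G α := by
    ext A
    exact τ.naturality (α.app A)

variable {τ}

/-- The free algebra sequence at the identity functor of postcomposition with a pointed endofunctor
is the free monad sequence. -/
noncomputable def FreeAlgebraSequence.freeMonadSequence [HasColimitsOfSize.{v, v} D]
    [HasLimitsOfSize.{v, v} D]
    (S : FreeAlgebraSequence.{max u v, max u v, v} _ (whiskeringPoint τ)) (e : S.X.obj 0 ≅ 𝟭 D) :
    FreeMonadSequence T τ where
  X := S.X
  zero := e
  σ := S.σ
  unit_σ β A := congr_app (S.unit_σ β) A
  σ_condition γ β h A := congr_app (S.σ_condition γ β h) A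
  σ_universal β A Z g hg := by
    -- Morphisms out of a value at `A` are natural transformations into a cofree functor, so
    -- universality among functors implies universality at each object.
    let adj := evaluationAdjunctionLeft (C := D) D A
    have nat {F G : D ⥤ D} (f : F ⟶ G) (k : G ⟶ (evaluationRightAdjoint D A).obj Z) :
        (adj.homEquiv F Z).symm (f ≫ k) = f.app A ≫ (adj.homEquiv G Z).symm k :=
      adj.homEquiv_naturality_left_symm f k
    let g' := adj.homEquiv (S.X.obj β ⋙ T) Z g
    have hg' : (adj.homEquiv (S.X.obj β ⋙ T) Z).symm g' = g := Equiv.symm_apply_apply _ _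
    obtain ⟨k, hk, hk'⟩ := S.σ_universal β _ g' fun γ h => by
      let x : S.X.obj γ ⋙ T ⟶ S.X.obj β ⋙ T := Functor.whiskerRight (S.X.map (homOfLE h.le)) T
      let s : S.X.obj γ ⋙ T ⟶ S.X.obj (Order.succ γ) := S.σ γ
      let x' : S.X.obj (Order.succ γ) ⟶ S.X.obj β := S.X.map (homOfLE (Order.succ_le_of_lt h))
      let p : S.X.obj β ⟶ S.X.obj β ⋙ T := (whiskeringPoint τ).app (S.X.obj β)
      have hx : (adj.homEquiv _ Z).symm (x ≫ g') = (adj.homEquiv _ Z).symm (s ≫ x' ≫ p ≫ g') := by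
        rw [nat, nat, nat, nat, hg']
        exact hg γ h
      exact (adj.homEquiv _ Z).symm.injective hx
    refine ⟨(adj.homEquiv _ Z).symm k, ?_, fun l hl => ?_⟩
    · exact (nat _ _).symm.trans ((congr_arg (adj.homEquiv (S.X.obj β ⋙ T) Z).symm hk).trans hg')
    · rw [Equiv.eq_symm_apply]
      refine hk' _ ((adj.homEquiv (S.X.obj β ⋙ T) Z).symm.injective ((nat _ _).trans ?_))
      exact (congr_arg ((S.σ β).app A ≫ ·) (Equiv.symm_apply_apply _ l)).trans (hl.trans hg'.symm)
  continuous A := ⟨fun β hβ => by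
    have := hasColimitsOfShape_ordinalIio D β
    have := S.continuous
    exact ⟨isColimitOfPreserves ((evaluation D D).obj A)
      (S.X.isColimitOfIsWellOrderContinuous β hβ)⟩⟩

variable (τ) in
/-- The free monad sequence of a pointed endofunctor of a bicomplete category exists. -/
theorem nonempty_freeMonadSequence [HasColimitsOfSize.{v, v} D] [HasLimitsOfSize.{v, v} D] :
    Nonempty (FreeMonadSequence T τ) := by
  obtain ⟨S, ⟨e⟩⟩ := exists_freeAlgebraSequence.{max u v, max u v, v} (whiskeringPoint τ) (𝟭 D)
  exact ⟨S.freeMonadSequence e⟩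

end FreeMonadSequenceExistence

/-! ### Smallness, convergence and the algebraic weak factorization system for Cole's factorization
-/

theorem mainTheorem1 (P : ObjectProperty TopCat.{v}) [ConvenientSpaces P]
    (C : Type u) [Category.{v} C] [HasLimits C] [HasColimits C]
    [EnrichedOrdinaryCategory P.FullSubcategory C]
    [Tensored P.FullSubcategory C] [Cotensored P.FullSubcategory C]
    (hC : MonomorphismHypothesis P C) :
    KellySmallness (coleStepOne P C).right ∧
    Nonempty (FreeMonadSequence (coleStepOne P C).right (coleStepOne P C).unit) ∧
    ∀ S : FreeMonadSequence (coleStepOne P C).right (coleStepOne P C).unit,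
      S.Converges ∧
      (∃ G : FunctorialFactorization C, Nonempty (S.Value G.right G.unit)) ∧
      ∀ (G : FunctorialFactorization C) (c : S.Value G.right G.unit),
        ∃ A : G.AWFS, IsFreeMonad (coleStepOne P C).unit A.monad c.fromGenerator := by
  have hR := MonomorphismHypothesis.kellySmallness P C hC
  refine ⟨hR, nonempty_freeMonadSequence (coleStepOne P C).unit, fun S => ?_⟩
  have hS := FreeMonadSequence.converges hR S
  exact ⟨hS, hS.exists_functorialFactorization, fun G c =>
    ⟨FunctorialFactorization.valueAWFS c hS (Cole.verticalComposition C (intervalZero P)),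
      FunctorialFactorization.isFreeMonad_valueAWFS c hS _⟩⟩
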